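/- Let $w_0,w_1\in\mathbb{C}$, $\Lambda=\frac14(w_0-w_1)^2$, and consider the spectral curve $(\mathbb{CP}^1,x,y)$ over $\mathbb{C}^*\times\mathbb{C}$ with $$x(z)=z^2-\Lambda,\qquad y(z)=z+\tfrac12(w_0+w_1),$$ which parametrizes $y^2-(w_0+w_1)y+w_0w_1-x=0$. Its only zero of $dx$ is $z=0$, with local Galois conjugation $\bar z=-z$. Put $\omega=y\,dx/x$ and $B(z_1,z_2)=\frac{dz_1dz_2}{(z_1-z_2)^2}$, and define $\omega_n^{(g)}$ ($g\ge0$, $n\ge1$) by $\omega_1^{(0)}=0$, $\omega_2^{(0)}=B$ and, for all other $(g,n+1)$, the local topological recursion $$\omega^{(g)}_{n+1}(z,z_N)=\mathop{\mathrm{Res}}_{w=0}\frac{\frac12\int_{\bar w}^{w}B(\cdot,z)}{\omega(w)-\omega(\bar w)}\Big(\omega^{(g-1)}_{n+2}(w,\bar w,z_N)+\sum_{\ell=0}^{g}\sum_{J\subseteq N}\omega^{(g-\ell)}_{|J|+1}(w,z_J)\,\omega^{(\ell)}_{|N\setminus J|+1}(\bar w,z_{N\setminus J})\Big),$$ where $N=\{1,\dots,n\}$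 and $\omega^{(-1)}_{n}=0$. For $2g-2+n>0$ let $$F_n^{(g)}(z_1,\dots,z_n)=\int_\infty^{z_1}\!\!\cdots\int_\infty^{z_n}\omega_n^{(g)}$$ (for $z_1,\dots,z_n\neq 0$); these integrals converge. Let $F_1^{(0)}(z)$ and $F_2^{(0)}(z_1,z_2)$ (the latter near the diagonal) be the divergent integrals from $\infty$ of $\omega$ and of $B(z_1,z_2)-\frac{dx(z_1)dx(z_2)}{(x(z_1)-x(z_2))^2}$, regularized by an additive constant. That is, $dF_1^{(0)}=\omega$, and the partial derivatives of $F_2^{(0)}$ in $z_1$ and in $z_2$ are the convergent single integrals from $\infty$ in the other variable. Such local regularizations exist near every $z$ with $z\ne0$ and $x(z)\neq0$. On an open subset of the $x$-plane minus $\{0,-\Lambda\}$ with a continuous branch $z=z(x)$ of the inverse of $x(z)$ and with regularizations as above, define the wave function with integration divisor $[z]-[\infty]$ as the formal WKB series $$\psi(x)=\exp\Big(\sum_{m\ge0}\hbar^{m-1}F_m(x)\Big),\qquad F_m(x)=\sum_{\substack{g\ge0,\ n\ge1\\ 2g-1+n=m}}\frac1{n!}F_n^{(g)}(z(x),\dots,z(x)),$$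 that is, $\psi=e^{F_0/\hbar}\sum_{k\ge0}\hbar^k\varphi_k(x)$ with $\sum_k\hbar^k\varphi_k=e^{F_1}\exp\big(\sum_{m\ge2}\hbar^{m-1}F_m\big)$. Then $F_0$ and all $\varphi_k$ are holomorphic in $x$, and $\psi$ satisfies the GKZ equation $$\Big(\hbar x\frac{d}{dx}-w_0\Big)\Big(\hbar x\frac{d}{dx}-w_1\Big)\psi=x\,\psi$$ as an identity of formal WKB series, i.e. coefficientwise in $\hbar$ after division by $e^{F_0/\hbar}$. -/

import Mathlib

open Filter Topology MeasureTheory Set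

namespace TopRec

/-- The residue at `q` of the differential `f(w) dw`: the integral of `f` over the positively
oriented circle of radius `r` about `q`, divided by `2πi`, for `r → 0`.  For `f` meromorphic at `q`
the value does not depend on small `r`. -/
noncomputable def residue (f : ℂ → ℂ) (q : ℂ) : ℂ :=
  limUnder (𝓝[>] (0 : ℝ)) fun r => (2 * Real.pi * Complex.I)⁻¹ * ∮ w in C(q, r), f w

/-- A simply ramified spectral curve with `C = ℂP¹`, given in an affine coordinate `z` in which
`x` and `y` are entire: `ram` is the (finite) set of zeros of `dx`, all of them simple and none a
zero of `dy`, and `conj q` is the local Galois conjugation near the ramification point `q`. -/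
structure SpectralCurve where
  x : ℂ → ℂ
  y : ℂ → ℂ
  ram : Finset ℂ
  conj : ℂ → ℂ → ℂ
  x_differentiable : Differentiable ℂ x
  y_differentiable : Differentiable ℂ y
  mem_ram : ∀ q, q ∈ ram ↔ deriv x q = 0
  simple : ∀ q ∈ ram, deriv (deriv x) q ≠ 0
  deriv_y_ne : ∀ q ∈ ram, deriv y q ≠ 0
  conj_analytic : ∀ q ∈ ram, AnalyticAt ℂ (conj q) q
  conj_self : ∀ q ∈ ram, conj q q = q
  x_conj : ∀ q ∈ ram, ∀ᶠ w in 𝓝 q, x (conj q w) = x w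
  conj_ne : ∀ q ∈ ram, ∀ᶠ w in 𝓝[≠] q, conj q w ≠ w

/-- The Bergman kernel of `ℂP¹`: `B(z₁, z₂) = bergman z₁ z₂ dz₁ dz₂`. -/
noncomputable def bergman (z₁ z₂ : ℂ) : ℂ := 1 / (z₁ - z₂) ^ 2

/-- The integral of `f(t) dt` along the straight segment from `a` to `b`. -/
noncomputable def segmentIntegral (a b : ℂ) (f : ℂ → ℂ) : ℂ :=
  ∫ t in (0 : ℝ)..1, f (a + t * (b - a)) * (b - a)

namespace SpectralCurve

variable (C : SpectralCurve)

/-- The one-form `y dx / x` of a curve in `ℂ* × ℂ`, as a coefficient of `dz`. -/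
noncomputable def oneForm (z : ℂ) : ℂ := C.y z * deriv C.x z / C.x z

/-- The recursion kernel near the ramification point `q`, with `w̄ = conj q w`:
`(½ ∫_{w̄}^{w} B(·, z)) / (ω(x(w)) - ω(x(w̄))) = kernel q w z dz / dw`.
The form `ω(x(w̄))` is pulled back along `conj q`. -/
noncomputable def kernel (q w z : ℂ) : ℂ :=
  (1 / 2 * segmentIntegral (C.conj q w) w fun t => bergman t z) /
    (C.oneForm w - C.oneForm (C.conj q w) * deriv (C.conj q) w)

/-- The correlators: `ω_n^{(g)} = omega g n (z₁, …, z_n) dz₁ ⋯ dz_n`, defined by the local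
topological recursion.  `J` runs over all subsets of the index set of the last variables. The
factor `deriv (C.conj q) w` comes from `d w̄`.  The summands left out in the `if` are
exactly those with a factor `ω_1^{(0)} = 0`; see `omega_recursion` for the full formula.
(The value for `n = 0` is not used.) -/
noncomputable def omega : (g n : ℕ) → (Fin n → ℂ) → ℂ
  | _, 0, _ => 0
  | 0, 1, _ => 0
  | 0, 2, z => bergman (z 0) (z 1)
  | g, n + 1, z => ∑ q ∈ C.ram, residue (fun w =>
      C.kernel q w (z 0) * deriv (C.conj q) w *
        ((if _h : g = 0 then 0 else
            omega (g - 1) (n + 2) (Fin.cons w (Fin.cons (C.conj q w) (Fin.tail z)))) +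
          ∑ l : Fin (g + 1), ∑ J : Finset (Fin n),
            if _h : (l.val = g ∧ J.card = 0) ∨ (l.val = 0 ∧ J.card = n) then 0 else
              omega (g - l) (J.card + 1)
                  (Fin.cons w fun i => Fin.tail z (J.orderEmbOfFin rfl i)) *
                omega l (Jᶜ.card + 1)
                  (Fin.cons (C.conj q w) fun i => Fin.tail z (Jᶜ.orderEmbOfFin rfl i)))) q
termination_by g n => 2 * g + n
decreasing_by
  all_goals
    first
    | omega
    | (have h1 := Finset.card_le_univ J
       have h2 := Finset.card_compl J
       have h3 := l.isLt
       simp only [Fintype.card_fin] at h1 h2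
       omega)

theorem omega_zero_one (z : Fin 1 → ℂ) : C.omega 0 1 z = 0 := by
  rw [omega]

theorem omega_zero_two (z : Fin 2 → ℂ) : C.omega 0 2 z = bergman (z 0) (z 1) := by
  rw [omega]

/-- The local topological recursion, for `(g, n + 1) ≠ (0, 1), (0, 2)`. -/
theorem omega_recursion (g n : ℕ) (h : g ≠ 0 ∨ 2 ≤ n) (z : Fin (n + 1) → ℂ) :
    C.omega g (n + 1) z = ∑ q ∈ C.ram, residue (fun w =>
      C.kernel q w (z 0) * deriv (C.conj q) w *
        ((if g = 0 then 0 else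
            C.omega (g - 1) (n + 2) (Fin.cons w (Fin.cons (C.conj q w) (Fin.tail z)))) +
          ∑ l : Fin (g + 1), ∑ J : Finset (Fin n),
            C.omega (g - l) (J.card + 1)
                (Fin.cons w fun i => Fin.tail z (J.orderEmbOfFin rfl i)) *
              C.omega l (Jᶜ.card + 1)
                (Fin.cons (C.conj q w) fun i => Fin.tail z (Jᶜ.orderEmbOfFin rfl i)))) q := by
  have h01 : ∀ a b, a = 0 → b = 0 → ∀ v : Fin (b + 1) → ℂ, C.omega a (b + 1) v = 0 := by
    rintro a b rfl rfl v
    exact C.omega_zero_one v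
  rw [omega]
  · simp only [dite_eq_ite]
    refine Finset.sum_congr rfl fun q _ => ?_
    congr 1
    funext w
    congr 2
    refine Finset.sum_congr rfl fun l _ => Finset.sum_congr rfl fun J _ => ?_
    split_ifs with hif
    · rcases hif with ⟨h1, h2⟩ | ⟨h1, h2⟩
      · rw [h01 (g - l) J.card (by omega) h2, zero_mul]
      · rw [h01 l Jᶜ.card h1 (by simp [Finset.card_compl, h2]), mul_zero]
    · rfl
  · intro h1 h2
    omega
  · intro h1 h2
    omega

end SpectralCurve

/-- `∫_∞^z f(t) dt`, along the straight ray from `∞` through `z`. -/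
noncomputable def integralFromInfinity (f : ℂ → ℂ) (z : ℂ) : ℂ :=
  -z * ∫ t in Ioi (1 : ℝ), f (t * z)

/-- `∫_∞^{z₁} ⋯ ∫_∞^{z_n} f(t₁, …, t_n) dt₁ ⋯ dt_n`, along the straight rays from `∞` through the
`z_i`. -/
noncomputable def multiIntegralFromInfinity {n : ℕ} (f : (Fin n → ℂ) → ℂ) (z : Fin n → ℂ) : ℂ :=
  (∏ i, -z i) * ∫ t in {t : Fin n → ℝ | ∀ i, 1 < t i}, f fun i => t i * z i

/-- Absolute convergence of the integral `multiIntegralFromInfinity f z`. -/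
def ConvergesFromInfinity {n : ℕ} (f : (Fin n → ℂ) → ℂ) (z : Fin n → ℂ) : Prop :=
  IntegrableOn (fun t : Fin n → ℝ => f fun i => t i * z i) {t | ∀ i, 1 < t i}

namespace SpectralCurve

variable (C : SpectralCurve)

/-- `B(z₁, z₂) - dx(z₁) dx(z₂) / (x(z₁) - x(z₂))²`, as a coefficient of `dz₁ dz₂`. -/
noncomputable def hatOmega₂ (z₁ z₂ : ℂ) : ℂ :=
  bergman z₁ z₂ - deriv C.x z₁ * deriv C.x z₂ / (C.x z₁ - C.x z₂) ^ 2

/-- The functions `F_n^{(g)}(z₁, …, z_n)` with reference point `∞`.  The two unstable ones need a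
regularization and are taken as arguments, see `IsLocalBranch`. -/
noncomputable def freeEnergy (F₁ : ℂ → ℂ) (F₂ : ℂ → ℂ → ℂ) : (g n : ℕ) → (Fin n → ℂ) → ℂ
  | 0, 1, z => F₁ (z 0)
  | 0, 2, z => F₂ (z 0) (z 1)
  | g, n, z => multiIntegralFromInfinity (C.omega g n) z

/-- `F_m = ∑_{g ≥ 0, n ≥ 1, 2g - 1 + n = m} F_n^{(g)}(z, …, z) / n!`, as a function of `z`. -/
noncomputable def wkbF (F₁ : ℂ → ℂ) (F₂ : ℂ → ℂ → ℂ) (m : ℕ) (z : ℂ) : ℂ :=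
  ∑ p ∈ (Finset.range (m + 1) ×ˢ Finset.Icc 1 (m + 1)).filter (fun p => 2 * p.1 + p.2 = m + 1),
    1 / (p.2.factorial : ℂ) * C.freeEnergy F₁ F₂ p.1 p.2 fun _ => z

/-- The data of a local branch of the wave function on an open set `V` of the `x`-plane `ℂ*`:
a branch `s` of the inverse of `x(z)` away from ramification points; a regularized integral `F₁` of
`ω = y dx / x` (a primitive: the divergent integral from `∞`, up to an additive constant);
a regularized double integral `F₂` of `hatOmega₂`, near the diagonal (the divergent double integral
from `∞`, up to an additive constant: the partial derivatives are the convergent single integrals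
from `∞`). -/
structure IsLocalBranch (V : Set ℂ) (s : ℂ → ℂ) (F₁ : ℂ → ℂ) (F₂ : ℂ → ℂ → ℂ) : Prop where
  isOpen : IsOpen V
  ne_zero : ∀ x ∈ V, x ≠ 0
  continuousOn : ContinuousOn s V
  x_s : ∀ x ∈ V, C.x (s x) = x
  not_ram : ∀ x ∈ V, s x ∉ C.ram
  hasDerivAt_F₁ : ∀ x ∈ V, HasDerivAt F₁ (C.oneForm (s x)) (s x)
  hasDerivAt_F₂_left : ∀ x ∈ V, ∀ᶠ p : ℂ × ℂ in 𝓝 (s x, s x),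
    HasDerivAt (fun u => F₂ u p.2) (integralFromInfinity (fun t => C.hatOmega₂ p.1 t) p.2) p.1
  hasDerivAt_F₂_right : ∀ x ∈ V, ∀ᶠ p : ℂ × ℂ in 𝓝 (s x, s x),
    HasDerivAt (fun u => F₂ p.1 u) (integralFromInfinity (fun t => C.hatOmega₂ t p.2) p.1) p.2

end SpectralCurve

/-- A formal WKB series `e^{S(x)/ħ} ∑_k ħ^k φ_k(x)` with phase `S`.  The power series variable
is `ħ`, so that `φ_k(x)` is the `k`-th coefficient of `amp x`. -/
@[ext] structure WKBSeries (S : ℂ → ℂ) where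
  amp : ℂ → PowerSeries ℂ

namespace WKBSeries

variable {S : ℂ → ℂ}

instance : Sub (WKBSeries S) := ⟨fun φ ψ => ⟨fun x => φ.amp x - ψ.amp x⟩⟩

/-- Multiplication by a function of `x`. -/
noncomputable def mulFun (a : ℂ → ℂ) (ψ : WKBSeries S) : WKBSeries S :=
  ⟨fun x => PowerSeries.C (a x) * ψ.amp x⟩

/-- `ħ x d/dx`: it takes `e^{S/ħ} φ` to `e^{S/ħ} (x S' φ + ħ x ∂φ/∂x)`. -/
noncomputable def hbarTheta (ψ : WKBSeries S) : WKBSeries S :=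
  ⟨fun x => PowerSeries.C (x * deriv S x) * ψ.amp x +
    PowerSeries.X * PowerSeries.C x *
      PowerSeries.mk fun k => deriv (fun t => PowerSeries.coeff k (ψ.amp t)) x⟩

/-- `(ħ x d/dx - w) ψ`. -/
noncomputable def thetaSub (w : ℂ) (ψ : WKBSeries S) : WKBSeries S :=
  hbarTheta ψ - mulFun (fun _ => w) ψ

/-- Holomorphy on `V` of the phase and of all coefficients of the amplitude. -/
def HolomorphicOn (ψ : WKBSeries S) (V : Set ℂ) : Prop :=
  DifferentiableOn ℂ S V ∧
    ∀ k, DifferentiableOn ℂ (fun x => PowerSeries.coeff k (ψ.amp x)) V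

end WKBSeries

/-- The wave function `exp(∑_{m ≥ 0} ħ^{m-1} F_m(x))`, `F_m(x) = F_m(s(x))`, for the divisor
`[z] - [∞]`: its phase is `F_0`, its amplitude `e^{F_1} exp(∑_{m ≥ 2} ħ^{m-1} F_m)`, where the second
factor is the exponential of a formal power series in `ħ` without constant term. -/
noncomputable def SpectralCurve.waveFunction (C : SpectralCurve) (s : ℂ → ℂ) (F₁ : ℂ → ℂ)
    (F₂ : ℂ → ℂ → ℂ) : WKBSeries (fun x => C.wkbF F₁ F₂ 0 (s x)) :=
  ⟨fun x => PowerSeries.C (Complex.exp (C.wkbF F₁ F₂ 1 (s x))) *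
    (PowerSeries.exp ℂ).subst
      (PowerSeries.mk fun k => if k = 0 then 0 else C.wkbF F₁ F₂ (k + 1) (s x))⟩

/-- The curve of the equivariant `ℂP¹` model:
`x = z² - Λ`, `y = z + (w₀ + w₁)/2`, `Λ = (w₀ - w₁)²/4`. -/
noncomputable def gkzCurve (w₀ w₁ : ℂ) : SpectralCurve where
  x z := z ^ 2 - (w₀ - w₁) ^ 2 / 4
  y z := z + (w₀ + w₁) / 2
  ram := {0}
  conj _ z := -z
  x_differentiable := by fun_prop
  y_differentiable := by fun_prop
  mem_ram q := by simp
  simple q _ := by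
    have h : deriv (fun z : ℂ => z ^ 2 - (w₀ - w₁) ^ 2 / 4) = fun z => 2 * z := by
      funext z; simp
    rw [h]; simp
  deriv_y_ne q _ := by simp
  conj_analytic q _ := by fun_prop
  conj_self q hq := by simp at hq; simp [hq]
  x_conj q _ := by simp
  conj_ne q hq := by
    simp at hq
    subst hq
    filter_upwards [self_mem_nhdsWithin] with w hw h
    have : w ≠ 0 := hw
    exact this (self_eq_neg.mp h.symm)

/-- The parametrized curve is `{(x, y) : y² - (w₀ + w₁) y + w₀ w₁ - x = 0}`. -/
theorem gkzCurve_eq (w₀ w₁ z : ℂ) :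
    ((gkzCurve w₀ w₁).y z) ^ 2 - (w₀ + w₁) * (gkzCurve w₀ w₁).y z + w₀ * w₁
      - (gkzCurve w₀ w₁).x z = 0 := by
  simp only [gkzCurve]; ring

end TopRec

/-!
The idea is to recognize the correlators as Taylor coefficients of a partition function. In
variables `t₀, t₁, …`, the differential operators `Lᵢ = -(Vᵢ₊₁ - Λ Vᵢ) / 4`, with `Vᵢ` the Virasoro
operators, form an Airy structure: their commutators satisfy the integrability condition of the
system `∂ᵢ Z = ħ Lᵢ Z`, which therefore has a unique solution `Z(t) = ∑ Zₙ(t) ħⁿ` with `Z(0) = 1`.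
The derivatives of `log Z` at `t = 0` in the directions `(z ^ (-2k - 2))ₖ` obey the recursion which
the residue calculus at `w = 0` extracts from the topological recursion, hence they are the stable
`ω_n^{(g)}`.

Integration from `∞` turns the direction `z ^ (-2k - 2)` into `-z ^ (-2k - 1) / (2k + 1)`, so that
`∑_{m ≥ 2} ħ^{m-1} F_m` is `log Z` at the point `t_k = -z ^ (-2k - 1) / (2k + 1)`. There the
generating function of the equations `∂ᵢ Z = ħ Lᵢ Z` closes up to an ordinary differential equation
of second order in `z`: with `x = z ^ 2 - Λ` and `Θ` the conjugate of `x d/dx` by `z ^ (1 / 2)`, it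
reads `Θ² Zₙ = -x Zₙ₊₁'`. This is the GKZ equation, coefficient by coefficient in `ħ`.
-/

namespace TopRec

open MvPolynomial

section PolynomialDerivations

variable {σ R : Type*} [CommRing R]

theorem derivation_comm_apply_of_X {D₁ D₂ : Derivation R (MvPolynomial σ R) (MvPolynomial σ R)}
    (h : ∀ a, D₁ (D₂ (X a)) = D₂ (D₁ (X a))) (φ : MvPolynomial σ R) :
    D₁ (D₂ φ) = D₂ (D₁ φ) := by
  have hcomm : ⁅D₁, D₂⁆ = 0 := derivation_ext fun a => by
    rw [Derivation.commutator_apply, h, sub_self, Derivation.zero_apply]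
  rw [← sub_eq_zero, ← Derivation.commutator_apply, hcomm, Derivation.zero_apply]

theorem derivation_C_mul (D : Derivation R (MvPolynomial σ R) (MvPolynomial σ R)) (c : R)
    (φ : MvPolynomial σ R) : D (C c * φ) = C c * D φ := by
  rw [C_mul', D.map_smul, C_mul']

theorem pderiv_comm_apply (i j : σ) (φ : MvPolynomial σ R) :
    pderiv i (pderiv j φ) = pderiv j (pderiv i φ) := by
  classical
  refine derivation_comm_apply_of_X (fun a => ?_) φ
  rw [pderiv_X, pderiv_X, Pi.single_apply, Pi.single_apply]
  split_ifs <;> simp only [pderiv_one, map_zero]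

theorem derivation_apply_eq_sum_pderiv (D : Derivation R (MvPolynomial σ R) (MvPolynomial σ R))
    {φ : MvPolynomial σ R} {s : Finset σ} (h : ∀ i ∉ s, pderiv i φ = 0) :
    D φ = ∑ i ∈ s, pderiv i φ * D (X i) := by
  classical
  have hsum : ∀ ψ, (∑ i ∈ φ.vars ∪ s, D (X i) • pderiv (R := R) i) ψ =
      ∑ i ∈ φ.vars ∪ s, pderiv i ψ * D (X i) := fun ψ => by
    rw [← Derivation.coeFnAddMonoidHom_apply, map_sum, Finset.sum_apply]
    exact Finset.sum_congr rfl fun i _ => mul_comm _ _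
  rw [Finset.sum_subset (Finset.subset_union_right (s₁ := φ.vars)) fun i _ hi => by
    rw [h i hi, zero_mul], ← hsum]
  refine derivation_eq_of_forall_mem_vars fun i hi => ?_
  rw [hsum, Finset.sum_eq_single_of_mem i (Finset.mem_union_left s hi), pderiv_X_self, one_mul]
  intro j _ hj
  rw [pderiv_X_of_ne hj.symm, zero_mul]

theorem exists_forall_ge_pderiv_eq_zero (φ : MvPolynomial ℕ R) :
    ∃ N, ∀ i, N ≤ i → pderiv i φ = 0 :=
  ⟨φ.vars.sup id + 1, fun _ hi => pderiv_eq_zero_of_notMem_vars fun h =>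
    (Finset.le_sup (f := id) h).not_gt hi⟩

theorem derivation_apply_eq_sum_range (D : Derivation R (MvPolynomial ℕ R) (MvPolynomial ℕ R))
    {φ : MvPolynomial ℕ R} {N : ℕ} (h : ∀ i, N ≤ i → pderiv i φ = 0) :
    D φ = ∑ i ∈ Finset.range N, pderiv i φ * D (X i) :=
  derivation_apply_eq_sum_pderiv D fun i hi => h i (by simpa using hi)

end PolynomialDerivations

section Poincare

variable {σ K : Type*}

theorem exists_eq_add_single {m : σ →₀ ℕ} {i : σ} (h : m i ≠ 0) :
    ∃ n, m = n + Finsupp.single i 1 :=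
  ⟨m - Finsupp.single i 1,
    (tsub_add_cancel_of_le (by simpa [Nat.one_le_iff_ne_zero] using h)).symm⟩

variable [Field K]

/-- The polynomial `x ↦ ∫₀¹ φ (t x) dt`, which gives the homotopy operator in the proof of the
Poincaré lemma. -/
noncomputable def radialIntegral (φ : MvPolynomial σ K) : MvPolynomial σ K :=
  ∑ m ∈ φ.support, monomial m (coeff m φ / (m.degree + 1))

theorem coeff_radialIntegral (m : σ →₀ ℕ) (φ : MvPolynomial σ K) :
    coeff m (radialIntegral φ) = coeff m φ / (m.degree + 1) := by
  classical
  simp +contextual [radialIntegral, coeff_sum, coeff_monomial]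

theorem coeff_X_mul_radialIntegral {R : σ → MvPolynomial σ K}
    (hR : ∀ i j, pderiv j (R i) = pderiv i (R j)) [DecidableEq σ] (i j : σ) (m : σ →₀ ℕ) :
    coeff (m + Finsupp.single j 1) (X i * radialIntegral (R i)) * (m j + 1) =
      (m i + if i = j then 1 else 0) * coeff m (R j) / (m.degree + 1) := by
  rcases eq_or_ne i j with rfl | hij
  · rw [add_comm m, coeff_X_mul, coeff_radialIntegral, if_pos rfl]
    ring
  · rw [coeff_X_mul', if_neg hij, add_zero]
    by_cases hi : m i = 0
    · simp [hi, hij.symm]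
    · obtain ⟨n, rfl⟩ := exists_eq_add_single hi
      have hclosed := congrArg (coeff n) (hR i j)
      rw [coeff_pderiv, coeff_pderiv] at hclosed
      rw [if_pos (by simp), add_right_comm, add_tsub_cancel_right, coeff_radialIntegral]
      simp only [Finsupp.add_apply, Finsupp.single_eq_same, Finsupp.single_eq_of_ne' hij, map_add,
        Finsupp.degree_single, Nat.cast_add, Nat.cast_one, add_zero]
      linear_combination hclosed / ((n.degree : K) + 1 + 1)

variable [CharZero K]

theorem eq_C_of_pderiv_eq_zero {φ : MvPolynomial σ K} (h : ∀ i, pderiv i φ = 0) :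
    φ = C (constantCoeff φ) := by
  classical
  ext m
  rw [coeff_C]
  split_ifs with hm
  · rw [← hm, constantCoeff_eq]
  · obtain ⟨i, hi⟩ : ∃ i, m i ≠ 0 := by
      by_contra! hall
      exact hm (Finsupp.ext fun i => (hall i).symm)
    obtain ⟨n, rfl⟩ := exists_eq_add_single hi
    have hcoeff := coeff_pderiv (i := i) φ n
    rw [h, coeff_zero] at hcoeff
    exact (mul_eq_zero.mp hcoeff.symm).resolve_right (Nat.cast_add_one_ne_zero _)

theorem exists_pderiv_eq {R : σ → MvPolynomial σ K} {s : Finset σ} (hs : ∀ i ∉ s, R i = 0)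
    (hR : ∀ i j, pderiv j (R i) = pderiv i (R j)) :
    ∃ φ, constantCoeff φ = 0 ∧ ∀ i, pderiv i φ = R i := by
  classical
  refine ⟨∑ i ∈ s, X i * radialIntegral (R i), by simp, fun j => ?_⟩
  ext m
  have hsupp : ∀ i ∉ s, (m i : K) * coeff m (R j) = 0 := by
    intro i hi
    by_cases h0 : m i = 0
    · rw [h0, Nat.cast_zero, zero_mul]
    · obtain ⟨n, rfl⟩ := exists_eq_add_single h0
      have hclosed := congrArg (coeff n) (hR j i)
      rw [hs i hi, map_zero, coeff_zero, coeff_pderiv] at hclosed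
      rw [(mul_eq_zero.mp hclosed).resolve_right (Nat.cast_add_one_ne_zero _), mul_zero]
  have hdegree : ∑ i ∈ s, (m i : K) * coeff m (R j) = m.degree * coeff m (R j) := by
    rw [Finset.sum_subset (Finset.subset_union_left (s₂ := m.support)) fun i _ hi => hsupp i hi,
      ← Finset.sum_subset (Finset.subset_union_right (s₁ := s)) fun i _ hi => by simp_all,
      ← Finset.sum_mul, Finsupp.degree_apply, Nat.cast_sum]
  have hdiag : ∑ i ∈ s, (if i = j then 1 else 0) * coeff m (R j) = coeff m (R j) := by
    by_cases hj : j ∈ s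
    · simp [hj]
    · simp [hs j hj]
  rw [coeff_pderiv, coeff_sum, Finset.sum_mul,
    Finset.sum_congr rfl fun i _ => coeff_X_mul_radialIntegral hR i j m, ← Finset.sum_div]
  simp only [add_mul, Finset.sum_add_distrib]
  rw [hdegree, hdiag, ← add_one_mul, mul_div_cancel_left₀ _ (Nat.cast_add_one_ne_zero _)]

end Poincare

section Virasoro

attribute [local instance] LieRing.ofAssociativeRing

variable (K : Type*) [Field K]

/-- The modes `J_{2a+1}`, `a ∈ ℤ`, of a boson with odd indices: multiplication by `(2k + 1) t_k` for
`a = -1 - k < 0` and `∂/∂t_a` for `a ≥ 0`. -/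
noncomputable def oddMode : ℤ → Module.End K (MvPolynomial ℕ K)
  | Int.ofNat a => (pderiv a).toLinearMap
  | Int.negSucc k => (2 * (k : K) + 1) • LinearMap.mulLeft K (X k)

/-- The second order part `∑_{i + j = m - 2} ∂_i ∂_j` of the Virasoro operator. -/
noncomputable def virasoroLaplacian (m : ℕ) : Module.End K (MvPolynomial ℕ K) :=
  ∑ i ∈ Finset.range (m - 1), (pderiv i).toLinearMap * (pderiv (m - 2 - i)).toLinearMap

/-- The first order part `∑_k 2 (2k + 1) t_k ∂_{k + m - 1}` of the Virasoro operator. -/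
noncomputable def virasoroShift (m : ℕ) : Derivation K (MvPolynomial ℕ K) (MvPolynomial ℕ K) :=
  mkDerivation K fun a =>
    if m ≤ a + 1 then C (2 * (2 * ((a + 1 - m : ℕ) : K) + 1)) * X (a + 1 - m) else 0

/-- The zeroth order part of the Virasoro operator. -/
noncomputable def virasoroConst : ℕ → MvPolynomial ℕ K
  | 0 => X 0 ^ 2
  | 1 => C (1 / 4)
  | _ => 0

/-- The Virasoro operators: the normally ordered sums of the products `J_{2a+1} J_{2b+1}` over
`a + b = m - 2`, with the central term `1 / 4` at `m = 1`. The index is shifted by one so that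
`[V_m, V_n] = 4 (m - n) V_{m+n-1}`. -/
noncomputable def virasoro (m : ℕ) : Module.End K (MvPolynomial ℕ K) :=
  virasoroLaplacian K m + (virasoroShift K m).toLinearMap + LinearMap.mulLeft K (virasoroConst K m)

variable {K}

theorem oddMode_natCast (a : ℕ) : oddMode K a = (pderiv a).toLinearMap := rfl

theorem oddMode_neg_natCast_sub_one (k : ℕ) :
    oddMode K (-k - 1) = (2 * (k : K) + 1) • LinearMap.mulLeft K (X k) := by
  rw [show -(k : ℤ) - 1 = Int.negSucc k by lia, oddMode]

theorem virasoroLaplacian_apply (m : ℕ) (φ : MvPolynomial ℕ K) :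
    virasoroLaplacian K m φ = ∑ i ∈ Finset.range (m - 1), pderiv i (pderiv (m - 2 - i) φ) := by
  simp only [virasoroLaplacian, LinearMap.sum_apply, Module.End.mul_apply, Derivation.coeFn_coe]

theorem virasoro_apply (m : ℕ) (φ : MvPolynomial ℕ K) :
    virasoro K m φ = virasoroLaplacian K m φ + virasoroShift K m φ + virasoroConst K m * φ := rfl

theorem virasoroShift_X_of_eq {m a k : ℕ} (h : a + 1 = m + k) :
    virasoroShift K m (X a) = C (2 * (2 * (k : K) + 1)) * X k := by
  rw [virasoroShift, mkDerivation_X, if_pos (by lia), show a + 1 - m = k by lia]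

theorem virasoroShift_X_of_lt {m a : ℕ} (h : a + 1 < m) :
    virasoroShift K m (X a : MvPolynomial ℕ K) = 0 := by
  rw [virasoroShift, mkDerivation_X, if_neg (by lia)]

theorem pderiv_virasoroConst_of_pos {a m : ℕ} (h : 0 < m + a) :
    pderiv a (virasoroConst K m) = 0 := by
  match m with
  | 0 => rw [virasoroConst, pderiv_pow, pderiv_X_of_ne (by lia), mul_zero]
  | 1 => exact pderiv_C
  | _ + 2 => exact map_zero _

theorem pderiv_virasoroLaplacian (a m : ℕ) (φ : MvPolynomial ℕ K) :
    pderiv a (virasoroLaplacian K m φ) = virasoroLaplacian K m (pderiv a φ) := by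
  simp only [virasoroLaplacian_apply, map_sum, pderiv_comm_apply a]

theorem virasoroLaplacian_X_mul (m k : ℕ) (φ : MvPolynomial ℕ K) :
    virasoroLaplacian K m (X k * φ) =
      X k * virasoroLaplacian K m φ + if k + 2 ≤ m then 2 * pderiv (m - 2 - k) φ else 0 := by
  have hterm : ∀ i j, pderiv i (pderiv j (X k * φ)) = X k * pderiv i (pderiv j φ) +
      ((if i = k then pderiv j φ else 0) + if j = k then pderiv i φ else 0) := by
    intro i j
    rw [pderiv_mul, map_add, pderiv_mul, pderiv_mul, pderiv_X, pderiv_X, Pi.single_apply,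
      Pi.single_apply]
    simp only [eq_comm (a := k)]
    split_ifs <;> simp <;> ring
  simp only [virasoroLaplacian_apply, hterm, Finset.sum_add_distrib, Finset.mul_sum]
  congr 1
  rw [Finset.sum_ite_eq']
  split_ifs with h₁ h₂ h₂
  · rw [Finset.sum_eq_single_of_mem (m - 2 - k) (by simp; lia) fun i hi hik => if_neg (by
      rw [Finset.mem_range] at hi; lia), if_pos (by lia), two_mul]
  · rw [Finset.mem_range] at h₁; lia
  · rw [Finset.mem_range] at h₁; lia
  · rw [zero_add]
    exact Finset.sum_eq_zero fun i hi => if_neg (by rw [Finset.mem_range] at hi; lia)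

theorem virasoroShift_lie_pderiv_of_eq {m a k : ℕ} (h : m + a = k + 1) :
    ⁅virasoroShift K m, pderiv a⁆ = (-(2 * (2 * (a : K) + 1))) • pderiv (R := K) k := by
  refine derivation_ext fun b => ?_
  have hconst : virasoroShift K m (pderiv a (X b)) = 0 := by
    rw [pderiv_X, Pi.single_apply]
    split_ifs <;> simp
  rw [Derivation.commutator_apply, hconst, zero_sub, Derivation.smul_apply, neg_smul, neg_inj]
  rcases lt_or_ge (b + 1) m with hb | hb
  · rw [virasoroShift_X_of_lt hb, map_zero, pderiv_X_of_ne (by lia), smul_zero]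
  · obtain ⟨l, hl⟩ := Nat.exists_eq_add_of_le hb
    rw [virasoroShift_X_of_eq hl, derivation_C_mul, smul_eq_C_mul]
    rcases eq_or_ne l a with rfl | hla
    · rw [show k = b by lia, pderiv_X_self, pderiv_X_self]
    · rw [pderiv_X_of_ne hla, pderiv_X_of_ne (by lia), mul_zero, mul_zero]

theorem virasoroShift_zero_lie_pderiv_zero : ⁅virasoroShift K 0, pderiv (R := K) 0⁆ = 0 := by
  refine derivation_ext fun b => ?_
  rw [Derivation.commutator_apply, virasoroShift_X_of_eq (k := b + 1) (by lia), derivation_C_mul,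
    pderiv_X_of_ne b.succ_ne_zero, mul_zero, sub_zero, pderiv_X, Pi.single_apply]
  split_ifs <;> simp

theorem virasoro_lie_pderiv_apply (m a : ℕ) (φ : MvPolynomial ℕ K) :
    ⁅virasoro K m, (pderiv a).toLinearMap⁆ φ =
      ⁅virasoroShift K m, pderiv a⁆ φ - pderiv a (virasoroConst K m) * φ := by
  simp only [Ring.lie_def, LinearMap.sub_apply, Module.End.mul_apply, Derivation.coeFn_coe,
    virasoro_apply, map_add, pderiv_virasoroLaplacian, pderiv_mul, Derivation.commutator_apply]
  ring

theorem virasoro_lie_pderiv (m a : ℕ) : ⁅virasoro K m, (pderiv a).toLinearMap⁆ =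
    (-(2 * (2 * (a : K) + 1))) • oddMode K (a + m - 1) := by
  refine LinearMap.ext fun φ => ?_
  rw [virasoro_lie_pderiv_apply]
  rcases Nat.eq_zero_or_eq_succ_pred (m + a) with h | h
  · obtain ⟨rfl, rfl⟩ := Nat.add_eq_zero_iff.mp h
    rw [virasoroShift_zero_lie_pderiv_zero, virasoroConst, pderiv_pow, pderiv_X_self]
    have hmode := oddMode_neg_natCast_sub_one (K := K) 0
    simp only [Nat.cast_zero, neg_zero, zero_sub, mul_zero, zero_add, one_smul] at hmode ⊢
    rw [hmode]
    simp [smul_eq_C_mul, map_ofNat C 2]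
    ring
  · rw [virasoroShift_lie_pderiv_of_eq (h.trans (Nat.succ_eq_add_one _)),
      show (a + m - 1 : ℤ) = (m + a - 1 : ℕ) by lia, oddMode_natCast]
    rw [pderiv_virasoroConst_of_pos (by lia), zero_mul, sub_zero]
    rfl

theorem virasoro_lie_mulLeft_X (m k : ℕ) : ⁅virasoro K m, LinearMap.mulLeft K (X k)⁆ =
    (2 : K) • oddMode K (m - 2 - k) := by
  refine LinearMap.ext fun φ => ?_
  have hlie : ⁅virasoro K m, LinearMap.mulLeft K (X k)⁆ φ =
      (if k + 2 ≤ m then 2 * pderiv (m - 2 - k) φ else 0) + φ * virasoroShift K m (X k) := by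
    simp only [Ring.lie_def, LinearMap.sub_apply, Module.End.mul_apply, LinearMap.mulLeft_apply,
      virasoro_apply, virasoroLaplacian_X_mul, Derivation.leibniz, smul_eq_mul]
    ring
  rw [hlie, LinearMap.smul_apply]
  split_ifs with h
  · rw [virasoroShift_X_of_lt h, mul_zero, add_zero,
      show (m : ℤ) - 2 - k = (m - 2 - k : ℕ) by lia, oddMode_natCast, Derivation.coeFn_coe,
      ofNat_smul_eq_nsmul, nsmul_eq_mul, Nat.cast_ofNat]
  · obtain ⟨l, hl⟩ := Nat.exists_eq_add_of_le (show m ≤ k + 1 by lia)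
    rw [virasoroShift_X_of_eq hl, show (m : ℤ) - 2 - k = -l - 1 by lia,
      oddMode_neg_natCast_sub_one, LinearMap.smul_apply, LinearMap.mulLeft_apply, smul_smul,
      smul_eq_C_mul]
    ring

theorem virasoro_lie_oddMode (m : ℕ) (a : ℤ) :
    ⁅virasoro K m, oddMode K a⁆ = (-(2 * (2 * (a : K) + 1))) • oddMode K (a + m - 1) := by
  cases a with
  | ofNat a =>
    rw [Int.ofNat_eq_natCast, Int.cast_natCast]
    exact virasoro_lie_pderiv m a
  | negSucc k =>
    rw [oddMode, lie_smul (M := Module.End K (MvPolynomial ℕ K)), virasoro_lie_mulLeft_X,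
      smul_smul, Int.negSucc_eq]
    congr 2 <;> push_cast <;> ring

theorem virasoro_apply_one (m : ℕ) : virasoro K m 1 = virasoroConst K m := by
  simp [virasoro_apply, virasoroLaplacian_apply]

theorem constantCoeff_virasoroConst (m : ℕ) :
    constantCoeff (virasoroConst K m) = if m = 1 then 1 / 4 else 0 := by
  match m with
  | 0 => simp [virasoroConst]
  | 1 => simp [virasoroConst]
  | _ + 2 => simp [virasoroConst]

theorem constantCoeff_virasoro_virasoroConst (m n : ℕ) :
    constantCoeff (virasoro K m (virasoroConst K n)) =
      if n = 0 then if m = 2 then 2 else 0 else if n = 1 ∧ m = 1 then 1 / 4 * (1 / 4) else 0 := by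
  match n with
  | 0 =>
    have hlaplacian : constantCoeff (virasoroLaplacian K m (X 0 * X 0)) =
        if m = 2 then 2 else 0 := by
      rw [virasoroLaplacian_X_mul, pderiv_X, Pi.single_apply]
      rcases lt_trichotomy m 2 with hm | rfl | hm
      · simp [hm.ne, hm.not_ge]
      · simp [map_ofNat constantCoeff 2]
      · rw [if_pos (by lia), if_neg (by lia), if_neg (by lia)]
        simp
    simp [virasoroConst, virasoro_apply, sq, hlaplacian]
  | 1 =>
    rw [virasoroConst, C_eq_smul_one, map_smul, virasoro_apply_one, constantCoeff_smul,
      constantCoeff_virasoroConst]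
    split_ifs <;> simp_all
  | _ + 2 => simp [virasoroConst]

variable [CharZero K]

theorem eq_smul_one_of_lie_oddMode_eq_zero {T : Module.End K (MvPolynomial ℕ K)}
    (h : ∀ a, ⁅T, oddMode K a⁆ = 0) : T = constantCoeff (T 1) • 1 := by
  have hcomm : ∀ a φ, T (oddMode K a φ) = oddMode K a (T φ) := fun a φ => by
    rw [← sub_eq_zero, ← LinearMap.zero_apply (σ₁₂ := RingHom.id K) φ, ← h a, Ring.lie_def]
    rfl
  have hT : T 1 = C (constantCoeff (T 1)) := eq_C_of_pderiv_eq_zero fun a => by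
    have := hcomm a 1
    rwa [oddMode_natCast, Derivation.coeFn_coe, pderiv_one, map_zero,
      eq_comm] at this
  have hX : ∀ k φ, T (X k * φ) = X k * T φ := fun k φ => by
    have := hcomm (-k - 1) φ
    simp only [oddMode_neg_natCast_sub_one, LinearMap.smul_apply, LinearMap.mulLeft_apply,
      map_smul] at this
    exact smul_right_injective _ (by exact_mod_cast (2 * k).succ_ne_zero) this
  refine LinearMap.ext fun φ => ?_
  rw [LinearMap.smul_apply, Module.End.one_apply, smul_eq_C_mul, ← hT]
  induction φ using MvPolynomial.induction_on with
  | C r => rw [C_eq_smul_one, map_smul, mul_smul_comm, mul_one]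
  | add p q hp hq => rw [map_add, hp, hq, mul_add]
  | mul_X p k hp => rw [mul_comm p, hX, hp, mul_left_comm]

theorem virasoro_lie_virasoro (m n : ℕ) :
    ⁅virasoro K m, virasoro K n⁆ = (4 * ((m : K) - n)) • virasoro K (m + n - 1) := by
  rcases eq_or_ne m n with rfl | hmn
  · rw [lie_self, sub_self, mul_zero, zero_smul]
  have hlie : ∀ a, ⁅⁅virasoro K m, virasoro K n⁆ - (4 * ((m : K) - n)) • virasoro K (m + n - 1),
      oddMode K a⁆ = 0 := fun a => by
    simp only [sub_lie, lie_lie, virasoro_lie_oddMode, smul_smul,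
      smul_lie (L := Module.End K (MvPolynomial ℕ K)) (M := Module.End K (MvPolynomial ℕ K)),
      lie_smul (M := Module.End K (MvPolynomial ℕ K))]
    rw [show a + n - 1 + m - 1 = a + (m + n - 1 : ℕ) - 1 by lia,
      show a + m - 1 + n - 1 = a + (m + n - 1 : ℕ) - 1 by lia, ← sub_smul, ← sub_smul]
    convert zero_smul K _ using 2
    push_cast
    ring
  have hone : constantCoeff ((⁅virasoro K m, virasoro K n⁆ -
      (4 * ((m : K) - n)) • virasoro K (m + n - 1)) 1) = 0 := by
    simp only [Ring.lie_def, LinearMap.sub_apply, Module.End.mul_apply, LinearMap.smul_apply,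
      virasoro_apply_one, map_sub, constantCoeff_smul, constantCoeff_virasoroConst,
      constantCoeff_virasoro_virasoroConst]
    by_cases h : m + n = 2
    · obtain ⟨rfl, rfl⟩ | ⟨rfl, rfl⟩ : m = 0 ∧ n = 2 ∨ m = 2 ∧ n = 0 := by lia
      all_goals norm_num
    · rw [if_neg (show m + n - 1 ≠ 1 by lia), smul_zero, sub_zero]
      split_ifs <;> first | lia | simp
  rw [← sub_eq_zero, eq_smul_one_of_lie_oddMode_eq_zero hlie, hone, zero_smul]

end Virasoro

section AiryStructure

attribute [local instance] LieRing.ofAssociativeRing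

variable {K : Type*} [Field K]

/-- The operators `L_i` of the Airy structure of the curve `x = z² - Λ`: the partition function of
the topological recursion solves `∂_i Z = ħ L_i Z`. -/
noncomputable def recursionOp (Λ : K) (i : ℕ) : Module.End K (MvPolynomial ℕ K) :=
  (-1 / 4 : K) • (virasoro K (i + 1) - Λ • virasoro K i)

theorem recursionOp_apply (Λ : K) (i : ℕ) (φ : MvPolynomial ℕ K) :
    recursionOp Λ i φ = C (-1 / 4) * (virasoro K (i + 1) φ - C Λ * virasoro K i φ) := by
  simp only [recursionOp, LinearMap.smul_apply, LinearMap.sub_apply, smul_eq_C_mul]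

theorem virasoro_eq_zero_of_le {φ : MvPolynomial ℕ K} {N : ℕ} (h : ∀ i, N ≤ i → pderiv i φ = 0)
    {m : ℕ} (hm : 2 * N + 2 ≤ m) : virasoro K m φ = 0 := by
  have hlaplacian : virasoroLaplacian K m φ = 0 := by
    rw [virasoroLaplacian_apply]
    refine Finset.sum_eq_zero fun i _ => ?_
    rcases le_or_gt N i with hi | hi
    · rw [pderiv_comm_apply, h i hi, map_zero]
    · rw [h _ (by lia), map_zero]
  have hshift : virasoroShift K m φ = 0 := by
    rw [derivation_apply_eq_sum_range _ h]
    refine Finset.sum_eq_zero fun i hi => ?_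
    rw [Finset.mem_range] at hi
    rw [virasoroShift_X_of_lt (by lia), mul_zero]
  obtain ⟨m, rfl⟩ := Nat.exists_eq_add_of_le' (show 2 ≤ m by lia)
  rw [virasoro_apply, hlaplacian, hshift, zero_add, zero_add]
  exact zero_mul φ

theorem exists_forall_ge_recursionOp_eq_zero (Λ : K) (φ : MvPolynomial ℕ K) :
    ∃ N, ∀ i, N ≤ i → recursionOp Λ i φ = 0 := by
  obtain ⟨N, hN⟩ := exists_forall_ge_pderiv_eq_zero φ
  refine ⟨2 * N + 2, fun i hi => ?_⟩
  rw [recursionOp_apply, virasoro_eq_zero_of_le hN hi, virasoro_eq_zero_of_le hN (by lia),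
    mul_zero, sub_zero, mul_zero]

variable [CharZero K]

theorem recursionOp_lie_pderiv (Λ : K) {i j k : ℕ} (h : i + j = k + 1) :
    ⁅recursionOp Λ i, (pderiv j).toLinearMap⁆ =
      ((2 * j + 1) / 2 : K) •
        ((pderiv (R := K) (k + 1)).toLinearMap - Λ • (pderiv k).toLinearMap) := by
  rw [recursionOp, smul_lie (L := Module.End K (MvPolynomial ℕ K)), sub_lie,
    smul_lie (L := Module.End K (MvPolynomial ℕ K)), virasoro_lie_pderiv, virasoro_lie_pderiv,
    show (j + (i + 1 : ℕ) - 1 : ℤ) = (k + 1 : ℕ) by lia, show (j + i - 1 : ℤ) = k by lia,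
    oddMode_natCast, oddMode_natCast]
  module

theorem recursionOp_lie_recursionOp (Λ : K) {i j k : ℕ} (h : i + j = k + 1) :
    ⁅recursionOp Λ i, recursionOp Λ j⁆ =
      ((j : K) - i) • (recursionOp Λ (k + 1) - Λ • recursionOp Λ k) := by
  simp only [recursionOp, smul_lie (L := Module.End K (MvPolynomial ℕ K)),
    lie_smul (M := Module.End K (MvPolynomial ℕ K)), sub_lie, lie_sub, virasoro_lie_virasoro]
  rw [show i + 1 + (j + 1) - 1 = k + 2 by lia, show i + 1 + j - 1 = k + 1 by lia,
    show i + (j + 1) - 1 = k + 1 by lia, show i + j - 1 = k by lia]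
  push_cast
  module

theorem pderiv_recursionOp_comm {Λ : K} {φ φ' : MvPolynomial ℕ K}
    (h : ∀ i, pderiv i φ = recursionOp Λ i φ') (i j : ℕ) :
    pderiv j (recursionOp Λ i φ) = pderiv i (recursionOp Λ j φ) := by
  rcases Nat.eq_zero_or_eq_succ_pred (i + j) with hij | hij
  · obtain ⟨rfl, rfl⟩ := Nat.add_eq_zero_iff.mp hij
    rfl
  · have hi := LinearMap.congr_fun (recursionOp_lie_pderiv Λ hij) φ
    have hj := LinearMap.congr_fun (recursionOp_lie_pderiv Λ ((add_comm j i).trans hij)) φ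
    have hL := LinearMap.congr_fun (recursionOp_lie_recursionOp Λ hij) φ'
    simp only [Ring.lie_def, LinearMap.sub_apply, Module.End.mul_apply, LinearMap.smul_apply,
      Derivation.coeFn_coe, h] at hi hj hL
    linear_combination (norm := module) hL - hi + hj

theorem exists_pderiv_eq_recursionOp {Λ : K} {φ φ' : MvPolynomial ℕ K}
    (h : ∀ i, pderiv i φ = recursionOp Λ i φ') :
    ∃ ψ, constantCoeff ψ = 0 ∧ ∀ i, pderiv i ψ = recursionOp Λ i φ := by
  obtain ⟨N, hN⟩ := exists_forall_ge_recursionOp_eq_zero Λ φ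
  exact exists_pderiv_eq (s := Finset.range N) (fun i hi => hN i (by simpa using hi))
    (pderiv_recursionOp_comm h)

open Classical in
/-- The coefficients `Z_n` of the partition function `Z = ∑ ħ^n Z_n`, normalized by `Z(0) = 1`. The
junk value `0` does not occur, by `partitionCoeff_succ_spec`. -/
noncomputable def partitionCoeff (Λ : K) : ℕ → MvPolynomial ℕ K
  | 0 => 1
  | n + 1 =>
    if h : ∃ ψ, constantCoeff ψ = 0 ∧ ∀ i, pderiv i ψ = recursionOp Λ i (partitionCoeff Λ n) then
      h.choose
    else 0

theorem partitionCoeff_succ_spec (Λ : K) (n : ℕ) :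
    constantCoeff (partitionCoeff Λ (n + 1)) = 0 ∧
      ∀ i, pderiv i (partitionCoeff Λ (n + 1)) = recursionOp Λ i (partitionCoeff Λ n) := by
  suffices h : ∃ ψ, constantCoeff ψ = 0 ∧ ∀ i, pderiv i ψ = recursionOp Λ i (partitionCoeff Λ n) by
    rw [partitionCoeff, dif_pos h]
    exact h.choose_spec
  induction n with
  | zero =>
    refine exists_pderiv_eq_recursionOp (φ' := 0) fun i => ?_
    rw [partitionCoeff, pderiv_one, map_zero]
  | succ n ih =>
    refine exists_pderiv_eq_recursionOp (φ' := partitionCoeff Λ n) fun i => ?_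
    rw [partitionCoeff, dif_pos ih]
    exact ih.choose_spec.2 i

end AiryStructure

section DirectionalDerivatives

variable {R : Type*} [CommRing R]

/-- The derivation `∑_a c_a ∂_a` with constant coefficients. -/
noncomputable def directionalDeriv (c : ℕ → R) :
    Derivation R (MvPolynomial ℕ R) (MvPolynomial ℕ R) :=
  mkDerivation R fun a => C (c a)

theorem directionalDeriv_X (c : ℕ → R) (a : ℕ) : directionalDeriv c (X a) = C (c a) :=
  mkDerivation_X _ _ _

theorem directionalDeriv_comm (c d : ℕ → R) (φ : MvPolynomial ℕ R) :
    directionalDeriv c (directionalDeriv d φ) = directionalDeriv d (directionalDeriv c φ) :=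
  derivation_comm_apply_of_X (fun a => by
    rw [directionalDeriv_X, directionalDeriv_X, derivation_C, derivation_C]) φ

theorem pderiv_directionalDeriv_comm (i : ℕ) (c : ℕ → R) (φ : MvPolynomial ℕ R) :
    pderiv i (directionalDeriv c φ) = directionalDeriv c (pderiv i φ) := by
  refine derivation_comm_apply_of_X (fun a => ?_) φ
  rw [directionalDeriv_X, pderiv_C, pderiv_X, Pi.single_apply]
  split_ifs <;> simp

theorem directionalDeriv_directionalDeriv_eq_sum {φ : MvPolynomial ℕ R} {N : ℕ}
    (h : ∀ i, N ≤ i → pderiv i φ = 0) (c : ℕ → R) :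
    directionalDeriv c (directionalDeriv c φ) = ∑ i ∈ Finset.range N, ∑ j ∈ Finset.range N,
      C (c i * c j) * pderiv i (pderiv j φ) := by
  have hD : ∀ i, N ≤ i → pderiv i (directionalDeriv c φ) = 0 := fun i hi => by
    rw [pderiv_directionalDeriv_comm, h i hi, map_zero]
  rw [derivation_apply_eq_sum_range (directionalDeriv c) hD]
  refine Finset.sum_congr rfl fun i _ => ?_
  rw [derivation_apply_eq_sum_range (directionalDeriv c) h, map_sum, Finset.sum_mul]
  refine Finset.sum_congr rfl fun j _ => ?_
  rw [directionalDeriv_X, directionalDeriv_X, pderiv_mul, pderiv_C, mul_zero, add_zero, C_mul]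
  ring

end DirectionalDerivatives

section GeneratingFunction

theorem sum_range_two_mul_sum_range_sub {M : Type*} [AddCommMonoid M] {f : ℕ → ℕ → M} {N : ℕ}
    (hl : ∀ i j, N ≤ i → f i j = 0) (hr : ∀ i j, N ≤ j → f i j = 0) :
    ∑ m ∈ Finset.range (2 * N), ∑ i ∈ Finset.range (m + 1), f i (m - i) =
      ∑ i ∈ Finset.range N, ∑ j ∈ Finset.range N, f i j := by
  rw [Finset.sum_range_diag_flip (2 * N) f, ← Finset.sum_subset
    (Finset.range_subset_range.mpr (show N ≤ 2 * N by lia))]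
  · refine Finset.sum_congr rfl fun i hi => ?_
    rw [Finset.mem_range] at hi
    rw [← Finset.sum_subset (Finset.range_subset_range.mpr (show N ≤ 2 * N - i by lia))]
    exact fun j _ hj => hr i j (by simpa using hj)
  · exact fun i _ hi => Finset.sum_eq_zero fun j _ => hl i j (by simpa using hi)

variable {K : Type*} [Field K]

/-- The coefficients of the derivation `∑_a u^(a+1) ∂_a`; for `u = z⁻²` it corresponds to the
insertion of a point `z` in the correlators. -/
def insertionDirection (u : K) (a : ℕ) : K := u ^ (a + 1)

/-- The generating function `∑_m u^m virasoroShift m`. -/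
noncomputable def virasoroShiftSeries (u : K) :
    Derivation K (MvPolynomial ℕ K) (MvPolynomial ℕ K) :=
  mkDerivation K fun a =>
    ∑ k ∈ Finset.range (a + 2), C (2 * (2 * (k : K) + 1) * u ^ (a + 1 - k)) * X k

theorem virasoroShiftSeries_X (u : K) (a : ℕ) : virasoroShiftSeries u (X a) =
    ∑ k ∈ Finset.range (a + 2), C (2 * (2 * (k : K) + 1) * u ^ (a + 1 - k)) * X k :=
  mkDerivation_X _ _ _

theorem sum_pow_mul_virasoroLaplacian {φ : MvPolynomial ℕ K} {N : ℕ}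
    (h : ∀ i, N ≤ i → pderiv i φ = 0) (u : K) :
    ∑ m ∈ Finset.range (2 * N + 2), C (u ^ m) * virasoroLaplacian K m φ =
      directionalDeriv (insertionDirection u) (directionalDeriv (insertionDirection u) φ) := by
  have hterm : ∀ m, C (u ^ (m + 2)) * virasoroLaplacian K (m + 2) φ =
      ∑ i ∈ Finset.range (m + 1), (fun i j => C (insertionDirection u i * insertionDirection u j) *
        pderiv i (pderiv j φ)) i (m - i) := by
    intro m
    rw [virasoroLaplacian_apply, Finset.mul_sum]
    refine Finset.sum_congr rfl fun i hi => ?_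
    have hi' : i < m + 1 := Finset.mem_range.mp hi
    simp only [insertionDirection]
    rw [← pow_add, show m + 2 - 2 - i = m - i by lia, show i + 1 + (m - i + 1) = m + 2 by lia]
  rw [Finset.sum_range_succ', Finset.sum_range_succ']
  simp only [add_assoc, one_add_one_eq_two, hterm]
  simp only [virasoroLaplacian_apply, zero_add, Nat.zero_sub, Nat.sub_self, Finset.range_zero,
    Finset.sum_empty, mul_zero, add_zero]
  rw [directionalDeriv_directionalDeriv_eq_sum h, sum_range_two_mul_sum_range_sub
    (f := fun i j => C (insertionDirection u i * insertionDirection u j) * pderiv i (pderiv j φ))]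
  · intro i j hi
    rw [pderiv_comm_apply, h i hi, map_zero, mul_zero]
  · intro i j hj
    rw [h j hj, map_zero, mul_zero]

theorem sum_pow_mul_virasoroShift {φ : MvPolynomial ℕ K} {N M : ℕ}
    (h : ∀ i, N ≤ i → pderiv i φ = 0) (hM : N + 1 ≤ M) (u : K) :
    ∑ m ∈ Finset.range M, C (u ^ m) * virasoroShift K m φ = virasoroShiftSeries u φ := by
  have hterm : ∀ m, C (u ^ m) * virasoroShift K m φ =
      ∑ i ∈ Finset.range N, pderiv i φ * (C (u ^ m) * virasoroShift K m (X i)) := by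
    intro m
    rw [derivation_apply_eq_sum_range (virasoroShift K m) h, Finset.mul_sum]
    exact Finset.sum_congr rfl fun i _ => by ring
  rw [Finset.sum_congr rfl fun m _ => hterm m, Finset.sum_comm,
    derivation_apply_eq_sum_range (virasoroShiftSeries u) h]
  refine Finset.sum_congr rfl fun i hi => ?_
  rw [Finset.mem_range] at hi
  rw [← Finset.mul_sum, virasoroShiftSeries_X]
  congr 1
  rw [← Finset.sum_subset (Finset.range_subset_range.mpr (show i + 2 ≤ M by lia)),
    ← Finset.sum_range_reflect]
  · refine Finset.sum_congr rfl fun k hk => ?_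
    rw [Finset.mem_range] at hk
    rw [virasoroShift_X_of_eq (k := k) (by lia), ← mul_assoc, ← C_mul,
      show i + 2 - 1 - k = i + 1 - k by lia, mul_comm (u ^ _)]
  · intro m _ hm
    rw [Finset.mem_range] at hm
    rw [virasoroShift_X_of_lt (by lia), mul_zero]

theorem sum_pow_mul_virasoroConst {M : ℕ} (hM : 2 ≤ M) (u : K) :
    ∑ m ∈ Finset.range M, C (u ^ m) * virasoroConst K m = C (u / 4) + X 0 ^ 2 := by
  obtain ⟨k, rfl⟩ := Nat.exists_eq_add_of_le' hM
  rw [Finset.sum_range_succ', Finset.sum_range_succ', Finset.sum_eq_zero]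
  · simp only [virasoroConst, zero_add, pow_one, pow_zero, C_1, one_mul, ← C_mul]
    rw [mul_one_div]
  · intro i _
    rw [show virasoroConst K (i + 1 + 1) = 0 from rfl, mul_zero]

theorem sum_pow_mul_virasoro {φ : MvPolynomial ℕ K} {N : ℕ} (h : ∀ i, N ≤ i → pderiv i φ = 0)
    (u : K) : ∑ m ∈ Finset.range (2 * N + 2), C (u ^ m) * virasoro K m φ =
      directionalDeriv (insertionDirection u) (directionalDeriv (insertionDirection u) φ) +
        virasoroShiftSeries u φ + (C (u / 4) + X 0 ^ 2) * φ := by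
  rw [← sum_pow_mul_virasoroLaplacian h,
    ← sum_pow_mul_virasoroShift (M := 2 * N + 2) h (by lia),
    ← sum_pow_mul_virasoroConst (M := 2 * N + 2) (by lia), Finset.sum_mul,
    ← Finset.sum_add_distrib, ← Finset.sum_add_distrib]
  exact Finset.sum_congr rfl fun m _ => by rw [virasoro_apply]; ring

theorem directionalDeriv_insertionDirection {Λ : K} {φ φ' : MvPolynomial ℕ K}
    (h : ∀ i, pderiv i φ = recursionOp Λ i φ') (u : K) :
    directionalDeriv (insertionDirection u) φ = C (-1 / 4) * (C (1 - Λ * u) *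
      (directionalDeriv (insertionDirection u) (directionalDeriv (insertionDirection u) φ') +
        virasoroShiftSeries u φ' + (C (u / 4) + X 0 ^ 2) * φ') -
          virasoroShift K 0 φ' - X 0 ^ 2 * φ') := by
  obtain ⟨N, hN⟩ := exists_forall_ge_pderiv_eq_zero φ'
  have hV : ∀ m, 2 * N + 2 ≤ m → virasoro K m φ' = 0 := fun m hm => virasoro_eq_zero_of_le hN hm
  have hφ : ∀ i, 2 * N + 2 ≤ i → pderiv i φ = 0 := fun i hi => by
    rw [h, recursionOp_apply, hV i hi, hV (i + 1) (by lia)]; ring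
  have hshift : ∑ i ∈ Finset.range (2 * N + 2), C (u ^ (i + 1)) * virasoro K (i + 1) φ' =
      (∑ m ∈ Finset.range (2 * N + 2), C (u ^ m) * virasoro K m φ') - virasoro K 0 φ' := by
    have hsucc := Finset.sum_range_succ' (fun m => C (u ^ m) * virasoro K m φ') (2 * N + 2)
    rw [Finset.sum_range_succ, hV _ le_rfl, mul_zero, add_zero] at hsucc
    rw [hsucc, pow_zero, C_1, one_mul, add_sub_cancel_right]
  have hzero : virasoro K 0 φ' = virasoroShift K 0 φ' + X 0 ^ 2 * φ' := by
    rw [virasoro_apply, virasoroLaplacian_apply, Nat.zero_sub, Finset.range_zero,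
      Finset.sum_empty, virasoroConst, zero_add]
  have hterm : ∀ i, pderiv i φ * directionalDeriv (insertionDirection u) (X i) =
      C (-1 / 4) * (C (u ^ (i + 1)) * virasoro K (i + 1) φ') -
        C (-1 / 4) * C (Λ * u) * (C (u ^ i) * virasoro K i φ') := by
    intro i
    rw [h, directionalDeriv_X, recursionOp_apply, insertionDirection, pow_succ, C_mul, C_mul]
    ring
  rw [derivation_apply_eq_sum_range _ hφ, Finset.sum_congr rfl fun i _ => hterm i,
    Finset.sum_sub_distrib, ← Finset.mul_sum, ← Finset.mul_sum, hshift, hzero,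
    sum_pow_mul_virasoro hN, C_sub, C_1]
  ring

end GeneratingFunction

section PowerSeriesLogarithm

variable {A : Type*} [CommRing A]

theorem powerSeries_eq_zero_of_derivative_eq_mul [IsAddTorsionFree A] {f g : PowerSeries A}
    (h : PowerSeries.derivative A g = f * g) (h₀ : PowerSeries.constantCoeff g = 0) : g = 0 := by
  ext n
  rw [map_zero]
  induction n using Nat.strong_induction_on with
  | _ n ih =>
    rcases n with _ | n
    · rwa [PowerSeries.coeff_zero_eq_constantCoeff_apply]
    · have hn := congrArg (PowerSeries.coeff n) h
      rw [PowerSeries.coeff_derivative, PowerSeries.coeff_mul, Finset.sum_eq_zero fun p hp => by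
        rw [ih p.2 (by have := Finset.HasAntidiagonal.mem_antidiagonal.mp hp; lia), mul_zero],
        ← Nat.cast_succ, mul_comm, ← nsmul_eq_mul] at hn
      exact (smul_eq_zero.mp hn).resolve_left n.succ_ne_zero

section CoeffDerivation

variable {R : Type*} [CommRing R] [Algebra R A]

/-- A derivation of the coefficient ring, extended coefficientwise to power series. -/
noncomputable def coeffDerivation (D : Derivation R A A) :
    Derivation R (PowerSeries A) (PowerSeries A) :=
  Derivation.mk'
    { toFun f := PowerSeries.mk fun n => D (PowerSeries.coeff n f)
      map_add' f g := by ext n; simp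
      map_smul' c f := by ext n; simp }
    fun f g => by
      ext n
      simp only [LinearMap.coe_mk, AddHom.coe_mk, PowerSeries.coeff_mk, PowerSeries.coeff_mul,
        map_sum, Derivation.leibniz, smul_eq_mul, map_add, Finset.sum_add_distrib]
      rw [← Finset.Nat.sum_antidiagonal_swap (n := n)
        (f := fun p => PowerSeries.coeff p.1 g * D (PowerSeries.coeff p.2 f))]
      rfl

theorem coeff_coeffDerivation (D : Derivation R A A) (f : PowerSeries A) (n : ℕ) :
    PowerSeries.coeff n (coeffDerivation D f) = D (PowerSeries.coeff n f) :=
  PowerSeries.coeff_mk n fun n => D (PowerSeries.coeff n f)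

theorem derivative_coeffDerivation (D : Derivation R A A) (f : PowerSeries A) :
    PowerSeries.derivative A (coeffDerivation D f) =
      coeffDerivation D (PowerSeries.derivative A f) := by
  ext n
  rw [coeff_coeffDerivation, PowerSeries.coeff_derivative, PowerSeries.coeff_derivative,
    coeff_coeffDerivation, ← Nat.cast_succ, mul_comm, mul_comm (PowerSeries.coeff _ _),
    ← nsmul_eq_mul, ← nsmul_eq_mul, map_nsmul]

end CoeffDerivation

variable [Algebra ℚ A]

theorem derivative_log_mul_one_add_X :
    PowerSeries.derivative A (PowerSeries.log A) * (1 + PowerSeries.X) = 1 := by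
  rw [PowerSeries.deriv_log]
  ext n
  rcases n with _ | n
  · simp
  · simp [mul_add, PowerSeries.coeff_one, pow_succ]

theorem derivative_logOf_mul {f : PowerSeries A} (hf : PowerSeries.constantCoeff f = 1) :
    PowerSeries.derivative A (PowerSeries.logOf f) * f = PowerSeries.derivative A f := by
  have hsubst : PowerSeries.HasSubst (f - 1) :=
    PowerSeries.HasSubst.of_constantCoeff_zero' (by rw [map_sub, hf, map_one, sub_self])
  have hone := congrArg (PowerSeries.substAlgHom (R := A) hsubst)
    (derivative_log_mul_one_add_X (A := A))
  rw [map_mul, map_add, map_one, PowerSeries.substAlgHom_X, add_sub_cancel,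
    PowerSeries.coe_substAlgHom] at hone
  rw [PowerSeries.logOf_eq, PowerSeries.derivative_subst hsubst, mul_right_comm, hone, one_mul,
    map_sub, PowerSeries.derivative_one, sub_zero]

theorem logOf_one : PowerSeries.logOf (1 : PowerSeries A) = 0 := by
  rw [PowerSeries.logOf_eq, sub_self]
  exact PowerSeries.subst_zero_of_constantCoeff_zero PowerSeries.constantCoeff_log

theorem map_logOf {B : Type*} [CommRing B] [Algebra ℚ B] (φ : A →+* B) {f : PowerSeries A}
    (hf : PowerSeries.constantCoeff f = 1) :
    PowerSeries.map φ (PowerSeries.logOf f) = PowerSeries.logOf (PowerSeries.map φ f) := by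
  have hsubst : PowerSeries.HasSubst (f - 1) :=
    PowerSeries.HasSubst.of_constantCoeff_zero' (by rw [map_sub, hf, map_one, sub_self])
  rw [PowerSeries.logOf_eq, PowerSeries.logOf_eq]
  refine (PowerSeries.map_subst hsubst _).trans ?_
  rw [PowerSeries.map_log]
  congr 1
  exact (map_sub (PowerSeries.map φ) f 1).trans (by rw [map_one])

theorem coeffDerivation_logOf_mul {R : Type*} [CommRing R] [Algebra R A] (D : Derivation R A A)
    {f : PowerSeries A} (hf : PowerSeries.constantCoeff f = 1) :
    coeffDerivation D (PowerSeries.logOf f) * f = coeffDerivation D f := by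
  have := IsAddTorsionFree.of_module_rat A
  rw [← sub_eq_zero]
  refine powerSeries_eq_zero_of_derivative_eq_mul
    (f := PowerSeries.derivative A (PowerSeries.logOf f)) ?_ ?_
  · have hleibniz := congrArg (coeffDerivation D) (derivative_logOf_mul hf)
    rw [Derivation.leibniz, smul_eq_mul, smul_eq_mul] at hleibniz
    rw [map_sub, Derivation.leibniz, derivative_coeffDerivation, derivative_coeffDerivation,
      ← hleibniz, smul_eq_mul, smul_eq_mul, ← derivative_logOf_mul hf]
    ring
  · have hconst : ∀ g, PowerSeries.constantCoeff (coeffDerivation D g) =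
        D (PowerSeries.constantCoeff g) := fun g => by
      rw [← PowerSeries.coeff_zero_eq_constantCoeff_apply, coeff_coeffDerivation,
        PowerSeries.coeff_zero_eq_constantCoeff_apply]
    rw [map_sub, map_mul, hconst, hconst, hf, PowerSeries.constantCoeff_logOf hf, map_zero,
      zero_mul, D.map_one_eq_zero, sub_zero]

theorem exp_subst_logOf {f : PowerSeries A} (hf : PowerSeries.constantCoeff f = 1) :
    (PowerSeries.exp A).subst (PowerSeries.logOf f) = f := by
  have := IsAddTorsionFree.of_module_rat A
  have hlog := PowerSeries.constantCoeff_logOf hf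
  have hsubst := PowerSeries.HasSubst.of_constantCoeff_zero' hlog
  have hexp := PowerSeries.constantCoeff_subst_eq_zero hlog (PowerSeries.exp A - 1)
    (by rw [map_sub, PowerSeries.constantCoeff_exp, map_one, sub_self])
  rw [← PowerSeries.coe_substAlgHom hsubst, map_sub, map_one, map_sub, map_one] at hexp
  rw [← sub_eq_zero]
  refine powerSeries_eq_zero_of_derivative_eq_mul
    (f := PowerSeries.derivative A (PowerSeries.logOf f)) ?_ ?_
  · rw [map_sub, PowerSeries.derivative_subst hsubst, PowerSeries.derivative_exp,
      ← derivative_logOf_mul hf]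
    ring
  · rw [map_sub, hf, ← PowerSeries.coe_substAlgHom hsubst]
    exact hexp

end PowerSeriesLogarithm

section PartitionFunction

variable {K : Type*} [Field K]

/-- The partition function `Z = ∑ ħ^n Z_n` of the Airy structure. -/
noncomputable def partitionSeries (Λ : K) : PowerSeries (MvPolynomial ℕ K) :=
  PowerSeries.mk (partitionCoeff Λ)

theorem constantCoeff_partitionSeries (Λ : K) :
    PowerSeries.constantCoeff (partitionSeries Λ) = 1 := by
  rw [← PowerSeries.coeff_zero_eq_constantCoeff_apply, partitionSeries, PowerSeries.coeff_mk,
    partitionCoeff]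

variable [CharZero K]

/-- The coefficients of the logarithm of the partition function. -/
noncomputable def freeCoeff (Λ : K) (n : ℕ) : MvPolynomial ℕ K :=
  PowerSeries.coeff n (PowerSeries.logOf (partitionSeries Λ))

theorem freeCoeff_zero (Λ : K) : freeCoeff Λ 0 = 0 := by
  rw [freeCoeff, PowerSeries.coeff_zero_eq_constantCoeff_apply]
  exact PowerSeries.constantCoeff_logOf (constantCoeff_partitionSeries Λ)

theorem constantCoeff_freeCoeff (Λ : K) (n : ℕ) : constantCoeff (freeCoeff Λ n) = 0 := by
  have hmap : PowerSeries.map constantCoeff (partitionSeries Λ) = 1 := by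
    ext n
    rw [PowerSeries.coeff_map, partitionSeries, PowerSeries.coeff_mk, PowerSeries.coeff_one]
    rcases n with _ | n
    · rw [partitionCoeff, map_one, if_pos rfl]
    · rw [(partitionCoeff_succ_spec Λ n).1, if_neg n.succ_ne_zero]
  rw [freeCoeff, ← PowerSeries.coeff_map, map_logOf _ (constantCoeff_partitionSeries Λ), hmap,
    logOf_one, map_zero]

theorem coeffDerivation_insertionDirection_partitionSeries (Λ u : K) :
    coeffDerivation (directionalDeriv (insertionDirection u)) (partitionSeries Λ) =
      PowerSeries.X * (PowerSeries.C (C (-1 / 4)) * (PowerSeries.C (C (1 - Λ * u)) *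
        (coeffDerivation (directionalDeriv (insertionDirection u))
            (coeffDerivation (directionalDeriv (insertionDirection u)) (partitionSeries Λ)) +
          coeffDerivation (virasoroShiftSeries u) (partitionSeries Λ) +
          PowerSeries.C (C (u / 4) + X 0 ^ 2) * partitionSeries Λ) -
        coeffDerivation (virasoroShift K 0) (partitionSeries Λ) -
          PowerSeries.C (X 0 ^ 2) * partitionSeries Λ)) := by
  ext1 n
  rcases n with _ | n
  · rw [coeff_coeffDerivation, PowerSeries.coeff_zero_X_mul, partitionSeries,
      PowerSeries.coeff_mk, partitionCoeff, Derivation.map_one_eq_zero]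
  · rw [PowerSeries.coeff_succ_X_mul, coeff_coeffDerivation, PowerSeries.coeff_C_mul,
      map_sub (PowerSeries.coeff n), map_sub (PowerSeries.coeff n), PowerSeries.coeff_C_mul,
      PowerSeries.coeff_C_mul, map_add (PowerSeries.coeff n), map_add (PowerSeries.coeff n),
      PowerSeries.coeff_C_mul]
    simp only [coeff_coeffDerivation, partitionSeries, PowerSeries.coeff_mk]
    exact directionalDeriv_insertionDirection (partitionCoeff_succ_spec Λ n).2 u

theorem coeffDerivation_insertionDirection_logOf_partitionSeries (Λ u : K) :
    let F := PowerSeries.logOf (partitionSeries Λ)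
    let D := coeffDerivation (directionalDeriv (insertionDirection u))
    D F = PowerSeries.X * (PowerSeries.C (C (-1 / 4)) * (PowerSeries.C (C (1 - Λ * u)) *
        (D (D F) + D F * D F + coeffDerivation (virasoroShiftSeries u) F +
          PowerSeries.C (C (u / 4) + X 0 ^ 2)) -
        coeffDerivation (virasoroShift K 0) F - PowerSeries.C (X 0 ^ 2))) := by
  intro F D
  have hone := constantCoeff_partitionSeries Λ
  have hD : D F * partitionSeries Λ = D (partitionSeries Λ) := coeffDerivation_logOf_mul _ hone
  have hDD : D (D (partitionSeries Λ)) = (D (D F) + D F * D F) * partitionSeries Λ := by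
    rw [← hD, Derivation.leibniz, ← hD, smul_eq_mul, smul_eq_mul]
    ring
  have hne : partitionSeries Λ ≠ 0 := fun h => by
    rw [h, map_zero] at hone
    exact zero_ne_one hone
  have hZ := coeffDerivation_insertionDirection_partitionSeries Λ u
  rw [hDD, ← hD, ← coeffDerivation_logOf_mul (virasoroShiftSeries u) hone,
    ← coeffDerivation_logOf_mul (virasoroShift K 0) hone] at hZ
  refine mul_right_cancel₀ hne (hZ.trans ?_)
  ring

theorem directionalDeriv_insertionDirection_freeCoeff_succ (Λ u : K) (n : ℕ) :
    directionalDeriv (insertionDirection u) (freeCoeff Λ (n + 1)) =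
      C (-1 / 4) * (C (1 - Λ * u) *
        (directionalDeriv (insertionDirection u)
            (directionalDeriv (insertionDirection u) (freeCoeff Λ n)) +
          ∑ p ∈ Finset.HasAntidiagonal.antidiagonal n,
            directionalDeriv (insertionDirection u) (freeCoeff Λ p.1) *
              directionalDeriv (insertionDirection u) (freeCoeff Λ p.2) +
          virasoroShiftSeries u (freeCoeff Λ n) + if n = 0 then C (u / 4) + X 0 ^ 2 else 0) -
        virasoroShift K 0 (freeCoeff Λ n) - if n = 0 then X 0 ^ 2 else 0) := by
  have hseries := coeffDerivation_insertionDirection_logOf_partitionSeries Λ u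
  simp only [freeCoeff]
  generalize PowerSeries.logOf (partitionSeries Λ) = F at hseries ⊢
  have h := congrArg (PowerSeries.coeff (n + 1)) hseries
  rw [PowerSeries.coeff_succ_X_mul, coeff_coeffDerivation, PowerSeries.coeff_C_mul,
    map_sub (PowerSeries.coeff n), map_sub (PowerSeries.coeff n), PowerSeries.coeff_C_mul,
    map_add (PowerSeries.coeff n), map_add (PowerSeries.coeff n), map_add (PowerSeries.coeff n),
    PowerSeries.coeff_mul] at h
  simp only [coeff_coeffDerivation, PowerSeries.coeff_C n] at h
  exact h

theorem exp_subst_map_logOf_partitionSeries {B : Type*} [CommRing B] [Algebra ℚ B] (Λ : K)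
    (φ : MvPolynomial ℕ K →+* B) :
    (PowerSeries.exp B).subst
        (PowerSeries.map φ (PowerSeries.logOf (partitionSeries Λ))) =
      PowerSeries.map φ (partitionSeries Λ) := by
  have hone := constantCoeff_partitionSeries Λ
  rw [map_logOf φ hone, exp_subst_logOf]
  rw [← PowerSeries.coeff_zero_eq_constantCoeff_apply, PowerSeries.coeff_map,
    PowerSeries.coeff_zero_eq_constantCoeff_apply, hone, map_one]

end PartitionFunction

section IteratedDerivatives

variable {R : Type*} [CommRing R]

instance : LeftCommutative fun (c : ℕ → R) (T : Module.End R (MvPolynomial ℕ R)) =>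
    (directionalDeriv c).toLinearMap * T :=
  ⟨fun c d T => LinearMap.ext fun φ => directionalDeriv_comm c d (T φ)⟩

/-- The composition of the derivations `directionalDeriv c` for `c` in a multiset. -/
noncomputable def directionalDerivs (M : Multiset (ℕ → R)) : Module.End R (MvPolynomial ℕ R) :=
  M.foldr (fun c T => (directionalDeriv c).toLinearMap * T) 1

/-- The value at the origin of an iterated directional derivative. On the logarithm of the partition
function, in the directions `insertionDirection (z_i⁻²)`, these are the correlators. -/
noncomputable def derivsAtZero (M : Multiset (ℕ → R)) : MvPolynomial ℕ R →ₗ[R] R :=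
  lcoeff R 0 ∘ₗ directionalDerivs M

theorem directionalDerivs_zero (φ : MvPolynomial ℕ R) : directionalDerivs 0 φ = φ := by
  rw [directionalDerivs, Multiset.foldr_zero, Module.End.one_apply]

theorem directionalDerivs_cons (c : ℕ → R) (M : Multiset (ℕ → R)) (φ : MvPolynomial ℕ R) :
    directionalDerivs (c ::ₘ M) φ = directionalDeriv c (directionalDerivs M φ) := by
  rw [directionalDerivs, Multiset.foldr_cons, Module.End.mul_apply, Derivation.coeFn_coe,
    directionalDerivs]

theorem directionalDerivs_directionalDeriv (c : ℕ → R) (M : Multiset (ℕ → R))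
    (φ : MvPolynomial ℕ R) :
    directionalDerivs M (directionalDeriv c φ) = directionalDeriv c (directionalDerivs M φ) := by
  induction M using Multiset.induction_on with
  | empty => rw [directionalDerivs_zero, directionalDerivs_zero]
  | cons d M ih => rw [directionalDerivs_cons, directionalDerivs_cons, ih, directionalDeriv_comm]

theorem derivsAtZero_apply (M : Multiset (ℕ → R)) (φ : MvPolynomial ℕ R) :
    derivsAtZero M φ = constantCoeff (directionalDerivs M φ) := rfl

theorem derivsAtZero_C_mul (M : Multiset (ℕ → R)) (a : R) (φ : MvPolynomial ℕ R) :
    derivsAtZero M (C a * φ) = a * derivsAtZero M φ := by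
  rw [C_mul', map_smul, smul_eq_mul]

theorem derivsAtZero_zero (φ : MvPolynomial ℕ R) : derivsAtZero 0 φ = constantCoeff φ := by
  rw [derivsAtZero_apply, directionalDerivs_zero]

theorem derivsAtZero_cons (c : ℕ → R) (M : Multiset (ℕ → R)) (φ : MvPolynomial ℕ R) :
    derivsAtZero (c ::ₘ M) φ = constantCoeff (directionalDeriv c (directionalDerivs M φ)) := by
  rw [derivsAtZero_apply, directionalDerivs_cons]

theorem derivsAtZero_directionalDeriv (c : ℕ → R) (M : Multiset (ℕ → R)) (φ : MvPolynomial ℕ R) :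
    derivsAtZero M (directionalDeriv c φ) = derivsAtZero (c ::ₘ M) φ := by
  rw [derivsAtZero_cons, derivsAtZero_apply, directionalDerivs_directionalDeriv]

theorem derivsAtZero_C {M : Multiset (ℕ → R)} (hM : M ≠ 0) (a : R) : derivsAtZero M (C a) = 0 := by
  obtain ⟨c, hc⟩ := Multiset.exists_mem_of_ne_zero hM
  obtain ⟨M, rfl⟩ := Multiset.exists_cons_of_mem hc
  rw [← derivsAtZero_directionalDeriv, derivation_C, map_zero]

theorem derivsAtZero_X {M : Multiset (ℕ → R)} (hM : M.card ≠ 1) (a : ℕ) :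
    derivsAtZero M (X a) = 0 := by
  induction M using Multiset.induction_on with
  | empty => rw [derivsAtZero_zero, constantCoeff_X]
  | cons c M _ =>
    rw [← derivsAtZero_directionalDeriv, directionalDeriv_X, derivsAtZero_C]
    rintro rfl
    exact hM (Multiset.card_singleton c)

theorem directionalDeriv_X_sq (c : ℕ → R) (a : ℕ) :
    directionalDeriv c (X a ^ 2) = C (2 * c a) * X a := by
  rw [Derivation.leibniz_pow, directionalDeriv_X, pow_one, C_mul, map_ofNat C 2, smul_eq_mul,
    nsmul_eq_mul, Nat.cast_ofNat]
  ring

theorem derivsAtZero_X_sq_of_ne {M : Multiset (ℕ → R)} (hM : M.card ≠ 2) (a : ℕ) :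
    derivsAtZero M (X a ^ 2) = 0 := by
  induction M using Multiset.induction_on with
  | empty => rw [derivsAtZero_zero, map_pow, constantCoeff_X, zero_pow two_ne_zero]
  | cons c M _ =>
    rw [← derivsAtZero_directionalDeriv, directionalDeriv_X_sq, derivsAtZero_C_mul, derivsAtZero_X,
      mul_zero]
    intro h
    exact hM (by rw [Multiset.card_cons, h])

theorem derivsAtZero_X_sq_pair (c d : ℕ → R) (a : ℕ) :
    derivsAtZero {c, d} (X a ^ 2) = 2 * c a * d a := by
  rw [Multiset.insert_eq_cons, ← derivsAtZero_directionalDeriv, directionalDeriv_X_sq,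
    derivsAtZero_C_mul, ← Multiset.cons_zero, ← derivsAtZero_directionalDeriv, directionalDeriv_X,
    derivsAtZero_zero, constantCoeff_C]

theorem map_univ_val_succ {α : Type*} {n : ℕ} (d : Fin (n + 1) → α) :
    (Finset.univ : Finset (Fin (n + 1))).val.map d =
      d 0 ::ₘ (Finset.univ : Finset (Fin n)).val.map (fun i => d i.succ) := by
  rw [Fin.univ_val_map, Fin.univ_val_map, List.ofFn_succ, ← Multiset.cons_coe]

theorem exists_derivsAtZero_eq_sum (n : ℕ) {φ : MvPolynomial ℕ R} {N : ℕ}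
    (hN : ∀ i, N ≤ i → pderiv i φ = 0) :
    ∃ a : (Fin n → Fin N) → R, ∀ d : Fin n → ℕ → R,
      derivsAtZero ((Finset.univ : Finset (Fin n)).val.map d) φ = ∑ k, (∏ i, d i (k i)) * a k := by
  induction n generalizing φ with
  | zero => exact ⟨fun _ => constantCoeff φ, fun d => by simp [derivsAtZero_zero]⟩
  | succ n ih =>
    have hpderiv : ∀ j : Fin N, ∀ i, N ≤ i → pderiv i (pderiv (j : ℕ) φ) = 0 := fun j i hi => by
      rw [pderiv_comm_apply, hN i hi, map_zero]
    choose a ha using fun j => ih (hpderiv j)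
    refine ⟨fun k => a (k 0) (fun i => k i.succ), fun d => ?_⟩
    rw [map_univ_val_succ, ← derivsAtZero_directionalDeriv, derivation_apply_eq_sum_range _ hN,
      map_sum, ← Fin.sum_univ_eq_sum_range (fun i => derivsAtZero
        ((Finset.univ : Finset (Fin n)).val.map fun i => d i.succ)
          (pderiv i φ * directionalDeriv (d 0) (X i))) N,
      ← (Fin.consEquiv fun _ : Fin (n + 1) => Fin N).sum_comp, Fintype.sum_prod_type]
    refine Finset.sum_congr rfl fun j _ => ?_
    rw [directionalDeriv_X, mul_comm, derivsAtZero_C_mul, ha, Finset.mul_sum]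
    refine Finset.sum_congr rfl fun k _ => ?_
    rw [Fin.prod_univ_succ]
    simp only [Fin.consEquiv_apply, Fin.cons_zero, Fin.cons_succ]
    ring

section Leibniz

variable {ι : Type*} [DecidableEq ι]

theorem directionalDerivs_mul (S : Finset ι) (d : ι → ℕ → R) (φ ψ : MvPolynomial ℕ R) :
    directionalDerivs (S.val.map d) (φ * ψ) = ∑ J ∈ S.powerset,
      directionalDerivs (J.val.map d) φ * directionalDerivs ((S \ J).val.map d) ψ := by
  induction S using Finset.induction_on with
  | empty => simp [directionalDerivs_zero]
  | insert a S ha ih =>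
    rw [Finset.insert_val_of_notMem ha, Multiset.map_cons, directionalDerivs_cons, ih, map_sum,
      Finset.sum_powerset_insert ha, ← Finset.sum_add_distrib]
    refine Finset.sum_congr rfl fun J hJ => ?_
    have haJ : a ∉ J := fun h => ha (Finset.mem_powerset.mp hJ h)
    have haSJ : a ∉ S \ J := fun h => ha (Finset.mem_sdiff.mp h).1
    rw [Finset.insert_sdiff_of_notMem S haJ, Finset.insert_sdiff_insert,
      Finset.sdiff_insert_of_notMem ha, Finset.insert_val_of_notMem haJ,
      Finset.insert_val_of_notMem haSJ, Multiset.map_cons, Multiset.map_cons,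
      directionalDerivs_cons, directionalDerivs_cons, Derivation.leibniz, smul_eq_mul, smul_eq_mul]
    ring

theorem derivsAtZero_mul (S : Finset ι) (d : ι → ℕ → R) (φ ψ : MvPolynomial ℕ R) :
    derivsAtZero (S.val.map d) (φ * ψ) = ∑ J ∈ S.powerset,
      derivsAtZero (J.val.map d) φ * derivsAtZero ((S \ J).val.map d) ψ := by
  simp only [derivsAtZero_apply, directionalDerivs_mul, map_sum, map_mul]

theorem directionalDerivs_derivation
    {D : Derivation R (MvPolynomial ℕ R) (MvPolynomial ℕ R)} {κ : (ℕ → R) → ℕ → R}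
    (hD : ∀ c a, directionalDeriv c (D (X a)) = C (κ c a)) (S : Finset ι) (d : ι → ℕ → R)
    (φ : MvPolynomial ℕ R) :
    directionalDerivs (S.val.map d) (D φ) = D (directionalDerivs (S.val.map d) φ) +
      ∑ j ∈ S, directionalDerivs (κ (d j) ::ₘ (S.erase j).val.map d) φ := by
  have hcomm : ∀ c φ,
      directionalDeriv c (D φ) = D (directionalDeriv c φ) + directionalDeriv (κ c) φ := by
    intro c φ
    have hlie : ⁅directionalDeriv c, D⁆ = directionalDeriv (κ c) := derivation_ext fun a => by
      rw [Derivation.commutator_apply, hD, directionalDeriv_X, directionalDeriv_X, derivation_C,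
        sub_zero]
    rw [← hlie, Derivation.commutator_apply, add_sub_cancel]
  induction S using Finset.induction_on with
  | empty => simp [directionalDerivs_zero]
  | insert a S ha ih =>
    rw [Finset.insert_val_of_notMem ha, Multiset.map_cons, directionalDerivs_cons, ih, map_add,
      hcomm, map_sum, Finset.sum_insert ha, Finset.erase_insert ha, directionalDerivs_cons,
      directionalDerivs_cons, add_assoc]
    refine congrArg₂ _ rfl (congrArg₂ _ rfl (Finset.sum_congr rfl fun j hj => ?_))
    have haj : a ≠ j := fun h => ha (h ▸ hj)
    rw [Finset.erase_insert_of_ne haj,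
      Finset.insert_val_of_notMem fun h => ha (Finset.mem_erase.mp h).2, Multiset.map_cons,
      directionalDerivs_cons, directionalDerivs_cons, directionalDerivs_cons,
      directionalDeriv_comm]

theorem derivsAtZero_derivation
    {D : Derivation R (MvPolynomial ℕ R) (MvPolynomial ℕ R)} {κ : (ℕ → R) → ℕ → R}
    (hD : ∀ c a, directionalDeriv c (D (X a)) = C (κ c a))
    (h₀ : ∀ a, constantCoeff (D (X a)) = 0) (S : Finset ι) (d : ι → ℕ → R)
    (φ : MvPolynomial ℕ R) : derivsAtZero (S.val.map d) (D φ) =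
      ∑ j ∈ S, derivsAtZero (κ (d j) ::ₘ (S.erase j).val.map d) φ := by
  obtain ⟨N, hN⟩ := exists_forall_ge_pderiv_eq_zero (directionalDerivs (S.val.map d) φ)
  have hvanish : constantCoeff (D (directionalDerivs (S.val.map d) φ)) = 0 := by
    rw [derivation_apply_eq_sum_range D hN, map_sum]
    exact Finset.sum_eq_zero fun i _ => by rw [map_mul, h₀, mul_zero]
  rw [derivsAtZero_apply, directionalDerivs_derivation hD, map_add, map_sum, hvanish, zero_add]
  rfl

end Leibniz

section RestrictToLine

/-- The restriction of a polynomial to the line spanned by `τ`. -/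
noncomputable def restrictToLine (τ : ℕ → R) : MvPolynomial ℕ R →ₐ[R] Polynomial R :=
  aeval fun a => Polynomial.C (τ a) * Polynomial.X

theorem restrictToLine_X (τ : ℕ → R) (a : ℕ) :
    restrictToLine τ (X a) = Polynomial.C (τ a) * Polynomial.X :=
  aeval_X _ _

theorem restrictToLine_C (τ : ℕ → R) (c : R) : restrictToLine τ (C c) = Polynomial.C c := by
  rw [restrictToLine, aeval_C, Polynomial.algebraMap_eq]

theorem derivative_restrictToLine (τ : ℕ → R) (φ : MvPolynomial ℕ R) :
    Polynomial.derivative (restrictToLine τ φ) = restrictToLine τ (directionalDeriv τ φ) := by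
  induction φ using MvPolynomial.induction_on with
  | C a => rw [derivation_C, map_zero, restrictToLine_C, Polynomial.derivative_C]
  | add p q hp hq => simp only [map_add, hp, hq]
  | mul_X p a hp =>
    rw [map_mul, Polynomial.derivative_mul, hp, Derivation.leibniz, directionalDeriv_X, map_add,
      smul_eq_mul, smul_eq_mul, map_mul, map_mul, restrictToLine_X, restrictToLine_C,
      Polynomial.derivative_C_mul, Polynomial.derivative_X]
    ring

theorem coeff_zero_restrictToLine (τ : ℕ → R) (φ : MvPolynomial ℕ R) :
    (restrictToLine τ φ).coeff 0 = constantCoeff φ := by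
  have h : Polynomial.constantCoeff.comp (restrictToLine τ).toRingHom = constantCoeff :=
    ringHom_ext (by simp) (by simp [restrictToLine_X])
  exact RingHom.congr_fun h φ

theorem eval_one_restrictToLine (τ : ℕ → R) (φ : MvPolynomial ℕ R) :
    (restrictToLine τ φ).eval 1 = eval τ φ := by
  have h : (Polynomial.evalRingHom 1).comp (restrictToLine τ).toRingHom = eval τ :=
    ringHom_ext (by simp) (by simp [restrictToLine_X])
  exact RingHom.congr_fun h φ

theorem derivsAtZero_replicate (n : ℕ) (τ : ℕ → R) (φ : MvPolynomial ℕ R) :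
    derivsAtZero (Multiset.replicate n τ) φ = n.factorial * (restrictToLine τ φ).coeff n := by
  have hiterate : derivsAtZero (Multiset.replicate n τ) φ =
      (Polynomial.derivative^[n] (restrictToLine τ φ)).coeff 0 := by
    induction n generalizing φ with
    | zero => rw [Multiset.replicate_zero, derivsAtZero_zero, Function.iterate_zero_apply,
        coeff_zero_restrictToLine]
    | succ n ih => rw [Multiset.replicate_succ, ← derivsAtZero_directionalDeriv, ih,
        Function.iterate_succ_apply, derivative_restrictToLine]
  rw [hiterate, Polynomial.coeff_iterate_derivative, zero_add, Nat.descFactorial_self,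
    nsmul_eq_mul]

end RestrictToLine

end IteratedDerivatives

section Correlators

variable {K : Type*} [Field K]

/-- The linear vector field in the recursion for the free energies. -/
noncomputable def recursionField (Λ u : K) :
    Derivation K (MvPolynomial ℕ K) (MvPolynomial ℕ K) :=
  (1 - Λ * u) • virasoroShiftSeries u - virasoroShift K 0

/-- The direction `κ` with `[directionalDeriv c, recursionField Λ u] = directionalDeriv κ`. -/
noncomputable def recursionDirection (Λ u : K) (c : ℕ → K) (a : ℕ) : K :=
  (1 - Λ * u) * ∑ k ∈ Finset.range (a + 2), 2 * (2 * (k : K) + 1) * u ^ (a + 1 - k) * c k -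
    2 * (2 * (a : K) + 3) * c (a + 1)

/-- The inhomogeneous term in the recursion for the free energies. -/
noncomputable def recursionConst (Λ u : K) : MvPolynomial ℕ K :=
  C (1 - Λ * u) * (C (u / 4) + X 0 ^ 2) - X 0 ^ 2

theorem recursionField_apply (Λ u : K) (φ : MvPolynomial ℕ K) :
    recursionField Λ u φ = C (1 - Λ * u) * virasoroShiftSeries u φ - virasoroShift K 0 φ := by
  rw [recursionField, Derivation.sub_apply, Derivation.smul_apply, smul_eq_C_mul]

theorem directionalDeriv_recursionField_X (Λ u : K) (c : ℕ → K) (a : ℕ) :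
    directionalDeriv c (recursionField Λ u (X a)) = C (recursionDirection Λ u c a) := by
  rw [recursionField_apply, map_sub, derivation_C_mul, virasoroShiftSeries_X,
    virasoroShift_X_of_eq (m := 0) (k := a + 1) (by lia), derivation_C_mul, directionalDeriv_X,
    map_sum]
  simp only [derivation_C_mul, directionalDeriv_X, ← C_mul]
  rw [← map_sum, ← C_mul, ← C_sub, recursionDirection]
  push_cast
  ring_nf

theorem constantCoeff_recursionField_X (Λ u : K) (a : ℕ) :
    constantCoeff (recursionField Λ u (X a)) = 0 := by
  rw [recursionField_apply, virasoroShiftSeries_X,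
    virasoroShift_X_of_eq (m := 0) (k := a + 1) (by lia)]
  simp

theorem derivsAtZero_zero_recursionConst (Λ u : K) :
    derivsAtZero 0 (recursionConst Λ u) = (1 - Λ * u) * (u / 4) := by
  rw [derivsAtZero_zero, recursionConst]
  simp

theorem derivsAtZero_pair_recursionConst (Λ u : K) (c d : ℕ → K) :
    derivsAtZero {c, d} (recursionConst Λ u) = -(Λ * u) * (2 * c 0 * d 0) := by
  rw [recursionConst, map_sub, derivsAtZero_C_mul, map_add, derivsAtZero_X_sq_pair,
    derivsAtZero_C (M := {c, d}) (by simp)]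
  ring

theorem derivsAtZero_recursionConst_of_ne {M : Multiset (ℕ → K)} (h₀ : M.card ≠ 0)
    (h₂ : M.card ≠ 2) (Λ u : K) : derivsAtZero M (recursionConst Λ u) = 0 := by
  rw [recursionConst, map_sub, derivsAtZero_C_mul, map_add, derivsAtZero_X_sq_of_ne h₂,
    derivsAtZero_C (Multiset.card_pos.mp (Nat.pos_of_ne_zero h₀)), add_zero, mul_zero, sub_zero]

theorem constantCoeff_directionalDeriv_eq_sum {φ : MvPolynomial ℕ K} {N : ℕ}
    (hN : ∀ i, N ≤ i → pderiv i φ = 0) (c : ℕ → K) :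
    constantCoeff (directionalDeriv c φ) =
      ∑ i ∈ Finset.range N, c i * constantCoeff (pderiv i φ) := by
  rw [derivation_apply_eq_sum_range _ hN, map_sum]
  exact Finset.sum_congr rfl fun i _ => by
    rw [map_mul, directionalDeriv_X, constantCoeff_C, mul_comm]

variable [CharZero K]

theorem derivsAtZero_cons_freeCoeff_succ {ι : Type*} [DecidableEq ι] (Λ u : K) (n : ℕ)
    (S : Finset ι) (d : ι → ℕ → K) :
    derivsAtZero (insertionDirection u ::ₘ S.val.map d) (freeCoeff Λ (n + 1)) =
      -1 / 4 * ((1 - Λ * u) *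
        (derivsAtZero (insertionDirection u ::ₘ insertionDirection u ::ₘ S.val.map d)
            (freeCoeff Λ n) +
          ∑ p ∈ Finset.HasAntidiagonal.antidiagonal n, ∑ J ∈ S.powerset,
            derivsAtZero (insertionDirection u ::ₘ J.val.map d) (freeCoeff Λ p.1) *
              derivsAtZero (insertionDirection u ::ₘ (S \ J).val.map d) (freeCoeff Λ p.2)) +
        ∑ j ∈ S, derivsAtZero (recursionDirection Λ u (d j) ::ₘ (S.erase j).val.map d)
          (freeCoeff Λ n) +
        if n = 0 then derivsAtZero (S.val.map d) (recursionConst Λ u) else 0) := by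
  have h : directionalDeriv (insertionDirection u) (freeCoeff Λ (n + 1)) =
      C (-1 / 4) * (C (1 - Λ * u) *
        (directionalDeriv (insertionDirection u)
            (directionalDeriv (insertionDirection u) (freeCoeff Λ n)) +
          ∑ p ∈ Finset.HasAntidiagonal.antidiagonal n,
            directionalDeriv (insertionDirection u) (freeCoeff Λ p.1) *
              directionalDeriv (insertionDirection u) (freeCoeff Λ p.2)) +
        recursionField Λ u (freeCoeff Λ n) + if n = 0 then recursionConst Λ u else 0) := by
    rw [directionalDeriv_insertionDirection_freeCoeff_succ, recursionField_apply, recursionConst]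
    split_ifs <;> ring
  rw [← derivsAtZero_directionalDeriv, h, derivsAtZero_C_mul, map_add, map_add,
    derivsAtZero_C_mul, map_add, map_sum, derivsAtZero_directionalDeriv,
    derivsAtZero_directionalDeriv, derivsAtZero_derivation (directionalDeriv_recursionField_X Λ u)
      (constantCoeff_recursionField_X Λ u), apply_ite (derivsAtZero _), map_zero]
  simp only [derivsAtZero_mul, derivsAtZero_directionalDeriv]

-- The derivative in the direction `(u^(a+1))_a` is a polynomial in `u`.
theorem constantCoeff_directionalDeriv_eq_zero {φ : MvPolynomial ℕ K}
    (h : ∀ u, constantCoeff (directionalDeriv (insertionDirection u) φ) = 0) (c : ℕ → K) :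
    constantCoeff (directionalDeriv c φ) = 0 := by
  obtain ⟨N, hN⟩ := exists_forall_ge_pderiv_eq_zero φ
  have hpoly : (∑ i ∈ Finset.range N,
      Polynomial.monomial (i + 1) (constantCoeff (pderiv i φ)) : Polynomial K) = 0 := by
    refine Polynomial.funext fun u => ?_
    rw [Polynomial.eval_finsetSum, Polynomial.eval_zero, ← h u,
      constantCoeff_directionalDeriv_eq_sum hN]
    refine Finset.sum_congr rfl fun i _ => ?_
    rw [Polynomial.eval_monomial, insertionDirection, mul_comm]
  rw [constantCoeff_directionalDeriv_eq_sum hN]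
  refine Finset.sum_eq_zero fun i hi => ?_
  have hcoeff := congrArg (fun p => Polynomial.coeff p (i + 1)) hpoly
  simp only [Polynomial.finsetSum_coeff, Polynomial.coeff_monomial, Polynomial.coeff_zero,
    add_left_inj] at hcoeff
  rw [Finset.sum_ite_eq' (Finset.range N) i, if_pos hi] at hcoeff
  rw [hcoeff, mul_zero]

theorem exists_eq_map_univ_val {α : Type*} (M : Multiset α) :
    ∃ (n : ℕ) (d : Fin n → α), M = Finset.univ.val.map d := by
  induction M using Quotient.inductionOn with
  | _ l => exact ⟨l.length, l.get, by rw [Fin.univ_val_map, List.ofFn_get]; rfl⟩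

theorem derivsAtZero_cons_freeCoeff_succ_eq_zero {Λ : K} {n m : ℕ} {d : Fin m → ℕ → K}
    (ih : ∀ k ≤ n, ∀ M : Multiset (ℕ → K),
      derivsAtZero M (freeCoeff Λ k) ≠ 0 → ∃ g, 2 * g + M.card = k + 2)
    (hm : ∀ g, 2 * g + m ≠ n + 2) (u : K) :
    derivsAtZero (insertionDirection u ::ₘ Finset.univ.val.map d) (freeCoeff Λ (n + 1)) = 0 := by
  have hquad : derivsAtZero (insertionDirection u ::ₘ insertionDirection u ::ₘ
      Finset.univ.val.map d) (freeCoeff Λ n) = 0 := by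
    by_contra hne
    obtain ⟨g, hg⟩ := ih n le_rfl _ hne
    exact hm (g + 1) (by simp at hg; lia)
  have hprod : ∀ p ∈ Finset.HasAntidiagonal.antidiagonal n, ∀ J : Finset (Fin m),
      derivsAtZero (insertionDirection u ::ₘ J.val.map d) (freeCoeff Λ p.1) *
        derivsAtZero (insertionDirection u ::ₘ (Finset.univ \ J).val.map d)
          (freeCoeff Λ p.2) = 0 := by
    intro p hp J
    have hpn := Finset.HasAntidiagonal.mem_antidiagonal.mp hp
    by_contra hne
    obtain ⟨g, hg⟩ := ih p.1 (by lia) _ (left_ne_zero_of_mul hne)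
    obtain ⟨g', hg'⟩ := ih p.2 (by lia) _ (right_ne_zero_of_mul hne)
    have hJ := Finset.card_sdiff_add_card_eq_card (Finset.subset_univ J)
    rw [Finset.card_univ, Fintype.card_fin] at hJ
    rw [Multiset.card_cons, Multiset.card_map, Finset.card_val] at hg hg'
    exact hm (g + g') (by lia)
  have hfield : ∀ j, derivsAtZero (recursionDirection Λ u (d j) ::ₘ
      (Finset.univ.erase j).val.map d) (freeCoeff Λ n) = 0 := by
    intro j
    by_contra hne
    obtain ⟨g, hg⟩ := ih n le_rfl _ hne
    have := j.isLt
    exact hm g (by simp at hg; lia)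
  have hconst : (if n = 0 then derivsAtZero (Finset.univ.val.map d) (recursionConst Λ u)
      else 0) = 0 := by
    have hcard : (Finset.univ.val.map d).card = m := by simp
    have h₀ := hm 0
    have h₁ := hm 1
    split_ifs with hn
    · exact derivsAtZero_recursionConst_of_ne (by lia) (by lia) Λ u
    · rfl
  rw [derivsAtZero_cons_freeCoeff_succ, hquad,
    Finset.sum_eq_zero fun p hp => Finset.sum_eq_zero fun J _ => hprod p hp J,
    Finset.sum_eq_zero fun j _ => hfield j, hconst]
  ring

theorem exists_genus_of_derivsAtZero_freeCoeff_ne_zero {Λ : K} {n : ℕ} {M : Multiset (ℕ → K)}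
    (h : derivsAtZero M (freeCoeff Λ n) ≠ 0) : ∃ g, 2 * g + M.card = n + 2 := by
  induction n using Nat.strong_induction_on generalizing M with
  | _ n ih =>
  rcases n with _ | n
  · rw [freeCoeff_zero, map_zero] at h
    exact absurd rfl h
  induction M using Multiset.induction_on with
  | empty =>
    rw [derivsAtZero_zero, constantCoeff_freeCoeff] at h
    exact absurd rfl h
  | cons c M _ =>
    by_contra! hM
    obtain ⟨m, d, rfl⟩ := exists_eq_map_univ_val M
    refine h ?_
    rw [derivsAtZero_cons]
    refine constantCoeff_directionalDeriv_eq_zero (fun u => ?_) c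
    rw [← derivsAtZero_cons]
    refine derivsAtZero_cons_freeCoeff_succ_eq_zero
      (fun k hk M hne => ih k (Nat.lt_succ_of_le hk) hne) (fun g hg => hM g ?_) u
    rw [Multiset.card_cons, Multiset.card_map, Finset.card_val, Finset.card_univ,
      Fintype.card_fin]
    lia

theorem coeff_restrictToLine_freeCoeff_eq_zero {Λ : K} {n k : ℕ} (τ : ℕ → K)
    (hk : ∀ g, 2 * g + k ≠ n + 2) : (restrictToLine τ (freeCoeff Λ n)).coeff k = 0 := by
  by_contra hne
  obtain ⟨g, hg⟩ := exists_genus_of_derivsAtZero_freeCoeff_ne_zero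
    (M := Multiset.replicate k τ) (Λ := Λ) (n := n) (by
      rw [derivsAtZero_replicate]
      exact mul_ne_zero (Nat.cast_ne_zero.mpr k.factorial_ne_zero) hne)
  exact hk g (by rwa [Multiset.card_replicate] at hg)

theorem eval_freeCoeff_eq_sum (Λ : K) (n : ℕ) (τ : ℕ → K) :
    eval τ (freeCoeff Λ n) =
      ∑ k ∈ Finset.range (n + 3), (restrictToLine τ (freeCoeff Λ n)).coeff k := by
  rw [← eval_one_restrictToLine, Polynomial.eval_eq_sum_range' (n := n + 3)]
  · simp only [one_pow, mul_one]
  · rw [Nat.lt_succ_iff, Polynomial.natDegree_le_iff_coeff_eq_zero]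
    exact fun k hk => coeff_restrictToLine_freeCoeff_eq_zero τ fun g => by lia

end Correlators

section Residues

/-- `f` is integrable over all small circles about `q`, with integral `2πi c`: unlike the equation
`residue f q = c`, this is stable under sums. -/
def HasResidue (f : ℂ → ℂ) (q c : ℂ) : Prop :=
  ∀ᶠ r in 𝓝[>] (0 : ℝ), CircleIntegrable f q r ∧
    (2 * Real.pi * Complex.I)⁻¹ * ∮ w in C(q, r), f w = c

variable {f g : ℂ → ℂ} {q a b : ℂ}

namespace HasResidue

theorem residue_eq (h : HasResidue f q a) : residue f q = a :=
  (tendsto_const_nhds.congr' (h.mono fun _ hr => hr.2.symm)).limUnder_eq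

theorem add (hf : HasResidue f q a) (hg : HasResidue g q b) :
    HasResidue (fun w => f w + g w) q (a + b) := by
  filter_upwards [hf, hg] with r hfr hgr
  refine ⟨hfr.1.add hgr.1, ?_⟩
  rw [circleIntegral.integral_add hfr.1 hgr.1, mul_add, hfr.2, hgr.2]

theorem const_mul (c : ℂ) (hf : HasResidue f q a) : HasResidue (fun w => c * f w) q (c * a) := by
  filter_upwards [hf] with r hfr
  refine ⟨IntervalIntegrable.const_mul hfr.1 c, ?_⟩
  rw [circleIntegral.integral_const_mul, ← hfr.2, mul_left_comm]

theorem sum {ι : Type*} (s : Finset ι) {f : ι → ℂ → ℂ} {a : ι → ℂ}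
    (h : ∀ i ∈ s, HasResidue (f i) q (a i)) :
    HasResidue (fun w => ∑ i ∈ s, f i w) q (∑ i ∈ s, a i) := by
  classical
  induction s using Finset.induction_on with
  | empty => exact Eventually.of_forall fun r => ⟨by simp, by simp [circleIntegral]⟩
  | insert i s hi ih =>
    simp only [Finset.sum_insert hi]
    exact (h i (Finset.mem_insert_self _ _)).add
      (ih fun j hj => h j (Finset.mem_insert_of_mem hj))

theorem congr (hf : HasResidue f q a) (h : ∀ᶠ w in 𝓝[≠] q, f w = g w) : HasResidue g q a := by
  obtain ⟨ε, hε, hball⟩ := Metric.mem_nhdsWithin_iff.mp h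
  have hlt : ∀ᶠ r in 𝓝[>] (0 : ℝ), r < ε := mem_nhdsWithin_of_mem_nhds (Iio_mem_nhds hε)
  filter_upwards [hf, hlt, self_mem_nhdsWithin] with r hfr hrε (hr : 0 < r)
  have heq : EqOn f g (Metric.sphere q r) := fun w hw =>
    hball ⟨Metric.closedBall_subset_ball hrε (Metric.sphere_subset_closedBall hw),
      Metric.ne_of_mem_sphere hw hr.ne'⟩
  refine ⟨(circleIntegrable_congr ?_).mp hfr.1, ?_⟩
  · rwa [abs_of_pos hr]
  · rw [← hfr.2, circleIntegral.integral_congr hr.le heq]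

end HasResidue

theorem hasResidue_inv_sub_mul_of_analyticAt (hf : AnalyticAt ℂ f q) :
    HasResidue (fun w => (w - q)⁻¹ * f w) q (f q) := by
  obtain ⟨ε, hε, hball⟩ := Metric.eventually_nhds_iff_ball.mp hf.eventually_analyticAt
  have hlt : ∀ᶠ r in 𝓝[>] (0 : ℝ), r < ε := mem_nhdsWithin_of_mem_nhds (Iio_mem_nhds hε)
  filter_upwards [hlt, self_mem_nhdsWithin] with r hrε (hr : 0 < r)
  have hd : DifferentiableOn ℂ f (Metric.closedBall q r) := fun w hw =>
    (hball w (Metric.closedBall_subset_ball hrε hw)).differentiableAt.differentiableWithinAt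
  constructor
  · refine ContinuousOn.circleIntegrable hr.le (ContinuousOn.mul ?_
      (hd.continuousOn.mono Metric.sphere_subset_closedBall))
    exact ContinuousOn.inv₀ (by fun_prop) fun w hw =>
      sub_ne_zero.mpr (Metric.ne_of_mem_sphere hw hr.ne')
  · have hcauchy := DifferentiableOn.circleIntegral_sub_inv_smul hd (Metric.mem_ball_self hr)
    simp only [smul_eq_mul] at hcauchy
    rw [hcauchy, inv_mul_cancel_left₀ Complex.two_pi_I_ne_zero]

theorem hasResidue_zero_of_analyticAt (hf : AnalyticAt ℂ f q) : HasResidue f q 0 := by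
  have h := hasResidue_inv_sub_mul_of_analyticAt (f := fun w => (w - q) * f w) (q := q)
    (by fun_prop)
  rw [sub_self, zero_mul] at h
  refine h.congr ?_
  filter_upwards [self_mem_nhdsWithin] with w hw
  rw [inv_mul_cancel_left₀ (sub_ne_zero.mpr hw)]

theorem hasResidue_sub_zpow_of_ne {n : ℤ} (hn : n ≠ -1) (q : ℂ) :
    HasResidue (fun w => (w - q) ^ n) q 0 := by
  filter_upwards [self_mem_nhdsWithin] with r (hr : 0 < r)
  refine ⟨circleIntegrable_sub_zpow_iff.mpr (Or.inr (Or.inr ?_)), ?_⟩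
  · rw [abs_of_pos hr, Metric.mem_sphere, dist_self]
    exact hr.ne
  · rw [circleIntegral.integral_sub_zpow_of_ne hn, mul_zero]

end Residues

section Kernel

/-- The recursion kernel of the curve `x = z² - Λ`, `y = z + const` in the variable `s = z²`,
times `dw̄/dw = -1`. -/
noncomputable def gkzKernel (Λ s w : ℂ) : ℂ := -(w ^ 2 - Λ) / (4 * w * (s - w ^ 2))

theorem eventually_ne_zero_and_sub_sq_ne_zero {s : ℂ} (hs : s ≠ 0) :
    ∀ᶠ w in 𝓝[≠] (0 : ℂ), w ≠ 0 ∧ s - w ^ 2 ≠ 0 := by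
  have hcont : ContinuousAt (fun w : ℂ => s - w ^ 2) 0 := by fun_prop
  have hne : ∀ᶠ w in 𝓝 (0 : ℂ), s - w ^ 2 ≠ 0 := hcont.eventually_ne (by simpa using hs)
  filter_upwards [mem_nhdsWithin_of_mem_nhds hne, self_mem_nhdsWithin] with w hw hw₀
  exact ⟨hw₀, hw⟩

theorem analyticAt_inv_sub_sq {s : ℂ} (hs : s ≠ 0) :
    AnalyticAt ℂ (fun w : ℂ => (s - w ^ 2)⁻¹) 0 :=
  AnalyticAt.inv (by fun_prop) (by simpa using hs)

theorem hasResidue_gkzKernel_mul_of_analyticAt (Λ : ℂ) {s : ℂ} (hs : s ≠ 0) {f : ℂ → ℂ}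
    (hf : AnalyticAt ℂ f 0) :
    HasResidue (fun w => gkzKernel Λ s w * f w) 0 (Λ * s⁻¹ / 4 * f 0) := by
  have hregular : AnalyticAt ℂ (fun w => -(w ^ 2 - Λ) / 4 * (s - w ^ 2)⁻¹ * f w) 0 :=
    ((by fun_prop : AnalyticAt ℂ (fun w : ℂ => -(w ^ 2 - Λ) / 4) 0).mul
      (analyticAt_inv_sub_sq hs)).mul hf
  have h := hasResidue_inv_sub_mul_of_analyticAt hregular
  rw [show -((0 : ℂ) ^ 2 - Λ) / 4 * (s - 0 ^ 2)⁻¹ * f 0 = Λ * s⁻¹ / 4 * f 0 by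
    rw [zero_pow two_ne_zero, sub_zero]; ring] at h
  refine h.congr ?_
  filter_upwards [eventually_ne_zero_and_sub_sq_ne_zero hs] with w ⟨hw, hsw⟩
  rw [gkzKernel, sub_zero]
  field_simp

theorem hasResidue_inv_mul_pow_mul_inv_sub_sq {s : ℂ} (hs : s ≠ 0) (p : ℕ) :
    HasResidue (fun w => w⁻¹ * (w ^ 2)⁻¹ ^ p * (s - w ^ 2)⁻¹) 0 (s⁻¹ ^ (p + 1)) := by
  induction p with
  | zero =>
    simpa using hasResidue_inv_sub_mul_of_analyticAt (analyticAt_inv_sub_sq hs)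
  | succ p ih =>
    have h := ((hasResidue_sub_zpow_of_ne (n := -(2 * p + 3 : ℕ)) (by lia) 0).const_mul s⁻¹).add
      (ih.const_mul s⁻¹)
    rw [mul_zero, zero_add, ← pow_succ'] at h
    refine h.congr ?_
    filter_upwards [eventually_ne_zero_and_sub_sq_ne_zero hs] with w ⟨hw, hsw⟩
    simp only [sub_zero, zpow_neg, zpow_natCast, inv_pow]
    field_simp
    ring

theorem hasResidue_gkzKernel_mul_pow {Λ s : ℂ} (hs : s ≠ 0) (p : ℕ) :
    HasResidue (fun w => gkzKernel Λ s w * (w ^ 2)⁻¹ ^ p) 0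
      (-1 / 4 * ((1 - Λ * s⁻¹) * s⁻¹ ^ p - if p = 0 then 1 else 0)) := by
  rcases p with _ | p
  · convert hasResidue_gkzKernel_mul_of_analyticAt Λ hs (f := fun w => (w ^ 2)⁻¹ ^ 0)
      (by simp only [pow_zero]; exact analyticAt_const) using 1
    rw [if_pos rfl]
    ring
  · have h := ((hasResidue_inv_mul_pow_mul_inv_sub_sq hs p).const_mul (-1 / 4)).add
      ((hasResidue_inv_mul_pow_mul_inv_sub_sq hs (p + 1)).const_mul (Λ / 4))
    rw [show -1 / 4 * s⁻¹ ^ (p + 1) + Λ / 4 * s⁻¹ ^ (p + 1 + 1) =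
      -1 / 4 * ((1 - Λ * s⁻¹) * s⁻¹ ^ (p + 1) - if p + 1 = 0 then 1 else 0) by
        rw [if_neg p.succ_ne_zero]; ring] at h
    refine h.congr ?_
    filter_upwards [eventually_ne_zero_and_sub_sq_ne_zero hs] with w ⟨hw, hsw⟩
    rw [gkzKernel]
    simp only [inv_pow]
    field_simp
    ring

end Kernel

section PolynomialFunctions

variable {R : Type*} [CommRing R]

/-- `f` is given by a polynomial without constant term. -/
def IsPolynomialVanishingAtZero (f : R → R) : Prop :=
  ∃ Q : Polynomial R, Q.coeff 0 = 0 ∧ ∀ u, f u = Q.eval u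

namespace IsPolynomialVanishingAtZero

variable {f g : R → R}

theorem add (hf : IsPolynomialVanishingAtZero f) (hg : IsPolynomialVanishingAtZero g) :
    IsPolynomialVanishingAtZero fun u => f u + g u := by
  obtain ⟨P, hP, hf⟩ := hf
  obtain ⟨Q, hQ, hg⟩ := hg
  exact ⟨P + Q, by simp [hP, hQ], fun u => by simp [hf, hg]⟩

theorem mul (hf : IsPolynomialVanishingAtZero f) (hg : IsPolynomialVanishingAtZero g) :
    IsPolynomialVanishingAtZero fun u => f u * g u := by
  obtain ⟨P, hP, hf⟩ := hf
  obtain ⟨Q, -, hg⟩ := hg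
  exact ⟨P * Q, by simp [Polynomial.mul_coeff_zero, hP], fun u => by simp [hf, hg]⟩

theorem sum {ι : Type*} (s : Finset ι) {f : ι → R → R}
    (h : ∀ i ∈ s, IsPolynomialVanishingAtZero (f i)) :
    IsPolynomialVanishingAtZero fun u => ∑ i ∈ s, f i u := by
  classical
  induction s using Finset.induction_on with
  | empty => exact ⟨0, by simp, by simp⟩
  | insert i s hi ih =>
    simp only [Finset.sum_insert hi]
    exact (h i (Finset.mem_insert_self _ _)).add (ih fun j hj => h j (Finset.mem_insert_of_mem hj))

theorem pow_mul_const (p : ℕ) (c : R) :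
    IsPolynomialVanishingAtZero fun u => u ^ (p + 1) * c :=
  ⟨Polynomial.monomial (p + 1) c, by simp [Polynomial.coeff_monomial], fun u => by
    rw [Polynomial.eval_monomial, mul_comm]⟩

theorem hasResidue_gkzKernel_mul {f : ℂ → ℂ} (hf : IsPolynomialVanishingAtZero f) {Λ s : ℂ}
    (hs : s ≠ 0) :
    HasResidue (fun w => gkzKernel Λ s w * f (w ^ 2)⁻¹) 0
      (-1 / 4 * ((1 - Λ * s⁻¹) * f s⁻¹)) := by
  obtain ⟨Q, hQ, hf⟩ := hf
  have h := HasResidue.sum (Finset.range (Q.natDegree + 1)) fun i _ =>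
    (hasResidue_gkzKernel_mul_pow (Λ := Λ) hs i).const_mul (Q.coeff i)
  have hvalue : ∑ i ∈ Finset.range (Q.natDegree + 1), Q.coeff i *
      (-1 / 4 * ((1 - Λ * s⁻¹) * s⁻¹ ^ i - if i = 0 then 1 else 0)) =
        -1 / 4 * ((1 - Λ * s⁻¹) * f s⁻¹) := by
    rw [hf, Polynomial.eval_eq_sum_range, Finset.mul_sum, Finset.mul_sum]
    refine Finset.sum_congr rfl fun i _ => ?_
    split_ifs with hi
    · rw [hi, hQ]; ring
    · ring
  rw [hvalue] at h
  refine h.congr (Eventually.of_forall fun w => ?_)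
  rw [hf, Polynomial.eval_eq_sum_range, Finset.mul_sum]
  exact Finset.sum_congr rfl fun i _ => mul_left_comm _ _ _

end IsPolynomialVanishingAtZero

variable {K : Type*} [Field K]

theorem isPolynomialVanishingAtZero_directionalDeriv (φ : MvPolynomial ℕ K) :
    IsPolynomialVanishingAtZero fun u =>
      constantCoeff (directionalDeriv (insertionDirection u) φ) := by
  obtain ⟨N, hN⟩ := exists_forall_ge_pderiv_eq_zero φ
  simp only [constantCoeff_directionalDeriv_eq_sum hN]
  exact .sum _ fun i _ => .pow_mul_const i _

theorem isPolynomialVanishingAtZero_directionalDeriv_directionalDeriv (φ : MvPolynomial ℕ K) :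
    IsPolynomialVanishingAtZero fun u => constantCoeff
      (directionalDeriv (insertionDirection u) (directionalDeriv (insertionDirection u) φ)) := by
  obtain ⟨N, hN⟩ := exists_forall_ge_pderiv_eq_zero φ
  have h : ∀ u, constantCoeff (directionalDeriv (insertionDirection u)
      (directionalDeriv (insertionDirection u) φ)) = ∑ i ∈ Finset.range N,
        constantCoeff (directionalDeriv (insertionDirection u) (pderiv i φ)) *
          (u ^ (i + 1) * 1) := by
    intro u
    rw [derivation_apply_eq_sum_range (directionalDeriv (insertionDirection u)) hN, map_sum,
      map_sum]
    refine Finset.sum_congr rfl fun i _ => ?_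
    rw [directionalDeriv_X, Derivation.leibniz, derivation_C, smul_zero, zero_add, smul_eq_mul,
      map_mul, constantCoeff_C, mul_one, mul_comm, insertionDirection]
  simp only [h]
  exact .sum _ fun i _ => (isPolynomialVanishingAtZero_directionalDeriv _).mul (.pow_mul_const i _)

end PolynomialFunctions

section BergmanExpansion

theorem analyticAt_bergman_left {w v : ℂ} (h : w ≠ v) : AnalyticAt ℂ (fun w => bergman w v) w := by
  unfold bergman
  exact AnalyticAt.div (by fun_prop) (by fun_prop) (pow_ne_zero 2 (sub_ne_zero.mpr h))

theorem bergman_add_bergman_neg_eq_sum_add {v w : ℂ} (hv : v ≠ 0) (hw : v ^ 2 - w ^ 2 ≠ 0)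
    (M : ℕ) :
    bergman w v + bergman (-w) v =
      ∑ k ∈ Finset.range M, 2 * (2 * (k : ℂ) + 1) * (w ^ 2) ^ k * (v ^ 2)⁻¹ ^ (k + 1) +
        (w ^ 2) ^ M * (2 * ((2 * (M : ℂ) + 1) * v ^ 2 - (2 * M - 1) * w ^ 2) *
          (v ^ 2)⁻¹ ^ M * (v ^ 2 - w ^ 2)⁻¹ ^ 2) := by
  induction M with
  | zero =>
    have hfactor : v ^ 2 - w ^ 2 = -(w - v) * (w + v) := by ring
    rw [hfactor] at hw
    have hsub : w - v ≠ 0 := neg_ne_zero.mp (left_ne_zero_of_mul hw)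
    have hadd : w + v ≠ 0 := right_ne_zero_of_mul hw
    simp only [bergman, Finset.range_zero, Finset.sum_empty, hfactor, ← neg_add', neg_sq]
    field_simp
    push_cast
    ring
  | succ M ih =>
    rw [ih, Finset.sum_range_succ, add_assoc]
    congr 1
    push_cast
    simp only [inv_pow]
    field_simp
    ring

theorem exists_bergman_add_bergman_neg_mul_pow_eq {v : ℂ} (hv : v ≠ 0) (a : ℕ) :
    ∃ R : ℂ → ℂ, AnalyticAt ℂ R 0 ∧ R 0 = 0 ∧ ∀ᶠ w in 𝓝[≠] (0 : ℂ),
      (bergman w v + bergman (-w) v) * (w ^ 2)⁻¹ ^ (a + 1) = ∑ k ∈ Finset.range (a + 2),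
        2 * (2 * (k : ℂ) + 1) * (v ^ 2)⁻¹ ^ (k + 1) * (w ^ 2)⁻¹ ^ (a + 1 - k) + R w := by
  have hv2 := pow_ne_zero 2 hv
  refine ⟨fun w => w ^ 2 * (2 * ((2 * ((a + 2 : ℕ) : ℂ) + 1) * v ^ 2 -
    (2 * ((a + 2 : ℕ) : ℂ) - 1) * w ^ 2) * (v ^ 2)⁻¹ ^ (a + 2) * (v ^ 2 - w ^ 2)⁻¹ ^ 2),
    ?_, by simp, ?_⟩
  · have := analyticAt_inv_sub_sq hv2
    fun_prop
  filter_upwards [eventually_ne_zero_and_sub_sq_ne_zero hv2] with w ⟨hw, hvw⟩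
  have hcancel : ∀ {i j : ℕ}, i ≤ j → (w ^ 2) ^ i * (w ^ 2)⁻¹ ^ j = (w ^ 2)⁻¹ ^ (j - i) := by
    intro i j hij
    rw [← Nat.sub_add_cancel hij, pow_add, Nat.add_sub_cancel, mul_left_comm, ← mul_pow,
      mul_inv_cancel₀ (pow_ne_zero 2 hw), one_pow, mul_one]
  rw [bergman_add_bergman_neg_eq_sum_add hv hvw (a + 2), add_mul, Finset.sum_mul]
  congr 1
  · refine Finset.sum_congr rfl fun k hk => ?_
    rw [← hcancel (Nat.lt_succ_iff.mp (Finset.mem_range.mp hk))]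
    ring
  · rw [mul_right_comm, pow_succ _ (a + 1), mul_right_comm _ (w ^ 2), hcancel le_rfl, Nat.sub_self,
      pow_zero, one_mul]

theorem sum_range_sub_ite_eq_recursionDirection (Λ s u : ℂ) (a : ℕ) :
    ∑ k ∈ Finset.range (a + 2), 2 * (2 * (k : ℂ) + 1) * u ^ (k + 1) *
      ((1 - Λ * s) * s ^ (a + 1 - k) - if a + 1 - k = 0 then 1 else 0) =
        recursionDirection Λ s (insertionDirection u) a := by
  have hlast : ∑ k ∈ Finset.range (a + 2), 2 * (2 * (k : ℂ) + 1) * u ^ (k + 1) *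
      (if a + 1 - k = 0 then 1 else 0) = 2 * (2 * (a : ℂ) + 3) * u ^ (a + 2) := by
    rw [Finset.sum_eq_single_of_mem (a + 1) (Finset.self_mem_range_succ _)]
    · rw [Nat.sub_self, if_pos rfl]; push_cast; ring
    · intro k hk hka
      rw [Finset.mem_range] at hk
      rw [if_neg (by lia), mul_zero]
  simp only [recursionDirection, insertionDirection]
  rw [← hlast, Finset.mul_sum, ← Finset.sum_sub_distrib]
  exact Finset.sum_congr rfl fun k _ => by ring

theorem hasResidue_gkzKernel_mul_bergman_mul_pow (Λ : ℂ) {s v : ℂ} (hs : s ≠ 0) (hv : v ≠ 0)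
    (a : ℕ) :
    HasResidue
      (fun w => gkzKernel Λ s w * ((bergman w v + bergman (-w) v) * (w ^ 2)⁻¹ ^ (a + 1))) 0
      (-1 / 4 * recursionDirection Λ s⁻¹ (insertionDirection (v ^ 2)⁻¹) a) := by
  obtain ⟨R, hR, hR₀, hexpansion⟩ := exists_bergman_add_bergman_neg_mul_pow_eq hv a
  have h := (HasResidue.sum (Finset.range (a + 2)) fun k _ =>
    (hasResidue_gkzKernel_mul_pow (Λ := Λ) hs (a + 1 - k)).const_mul
      (2 * (2 * (k : ℂ) + 1) * (v ^ 2)⁻¹ ^ (k + 1))).add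
    (hasResidue_gkzKernel_mul_of_analyticAt Λ hs hR)
  simp only [mul_left_comm _ (-1 / 4 : ℂ)] at h
  rw [hR₀, mul_zero, add_zero, ← Finset.mul_sum, sum_range_sub_ite_eq_recursionDirection] at h
  refine h.congr ?_
  filter_upwards [hexpansion] with w hw
  rw [hw, mul_add, Finset.mul_sum]
  exact congrArg (· + _) (Finset.sum_congr rfl fun k _ => mul_left_comm _ _ _)

theorem hasResidue_gkzKernel_mul_bergman_mul_directionalDeriv (Λ : ℂ) {s v : ℂ} (hs : s ≠ 0)
    (hv : v ≠ 0) (φ : MvPolynomial ℕ ℂ) :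
    HasResidue (fun w => gkzKernel Λ s w * ((bergman w v + bergman (-w) v) *
        constantCoeff (directionalDeriv (insertionDirection (w ^ 2)⁻¹) φ))) 0
      (-1 / 4 * constantCoeff
        (directionalDeriv (recursionDirection Λ s⁻¹ (insertionDirection (v ^ 2)⁻¹)) φ)) := by
  obtain ⟨N, hN⟩ := exists_forall_ge_pderiv_eq_zero φ
  have h := HasResidue.sum (Finset.range N) fun i _ =>
    (hasResidue_gkzKernel_mul_bergman_mul_pow Λ hs hv i).const_mul (constantCoeff (pderiv i φ))
  simp only [constantCoeff_directionalDeriv_eq_sum hN, Finset.mul_sum]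
  convert h using 1
  · exact funext fun w => Finset.sum_congr rfl fun i _ => by rw [insertionDirection]; ring
  · exact Finset.sum_congr rfl fun i _ => by ring

end BergmanExpansion

section GkzKernel

theorem segmentIntegral_bergman_of_notMem_segment {a b z : ℂ} (hz : z ∉ segment ℝ a b) :
    segmentIntegral a b (fun t => bergman t z) = (z - b)⁻¹ - (z - a)⁻¹ := by
  have hne : ∀ t ∈ Icc (0 : ℝ) 1, a + t • (b - a) - z ≠ 0 := fun t ht h => hz <| by
    rw [segment_eq_image']
    exact ⟨t, ht, sub_eq_zero.mp h⟩
  have hderiv : ∀ t ∈ Icc (0 : ℝ) 1, HasDerivAt (fun w => (z - w)⁻¹)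
      (bergman (a + t • (b - a)) z) (a + t • (b - a)) := fun t ht => by
    have hne' : z - (a + t • (b - a)) ≠ 0 := fun h => hne t ht (by linear_combination -h)
    refine (((hasDerivAt_id _).const_sub z).inv hne').congr_deriv ?_
    rw [bergman, id, neg_neg, ← neg_sub, neg_sq]
  have hcont : ContinuousOn (fun t : ℝ => bergman (a + t • (b - a)) z) (Icc 0 1) := by
    unfold bergman
    exact ContinuousOn.div (by fun_prop) (by fun_prop) fun t ht => pow_ne_zero 2 (hne t ht)
  have h := intervalIntegral.integral_unitInterval_deriv_eq_sub
    (f := fun w => (z - w)⁻¹) (f' := fun w => bergman w z) hcont hderiv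
  rw [add_sub_cancel] at h
  rw [segmentIntegral, intervalIntegral.integral_mul_const, mul_comm, ← h]
  simp only [Complex.real_smul, smul_eq_mul]

theorem notMem_segment_neg_of_norm_lt {w z : ℂ} (h : ‖w‖ < ‖z‖) : z ∉ segment ℝ (-w) w := by
  have hsub : segment ℝ (-w) w ⊆ Metric.closedBall 0 ‖w‖ :=
    (convex_closedBall _ _).segment_subset (by simp) (by simp)
  intro hz
  exact h.not_ge (by simpa using hsub hz)

theorem segmentIntegral_neg_bergman {w z : ℂ} (h : ‖w‖ < ‖z‖) :
    segmentIntegral (-w) w (fun t => bergman t z) = 2 * w / (z ^ 2 - w ^ 2) := by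
  have hsub : z - w ≠ 0 := sub_ne_zero.mpr fun hzw => h.ne (by rw [hzw])
  have hadd : z + w ≠ 0 := fun hzw => h.ne (by rw [eq_neg_of_add_eq_zero_left hzw, norm_neg])
  rw [segmentIntegral_bergman_of_notMem_segment (notMem_segment_neg_of_norm_lt h), sub_neg_eq_add,
    show z ^ 2 - w ^ 2 = (z - w) * (z + w) by ring]
  field_simp
  ring

theorem oneForm_gkzCurve (w₀ w₁ z : ℂ) : (gkzCurve w₀ w₁).oneForm z =
    (z + (w₀ + w₁) / 2) * (2 * z) / (z ^ 2 - (w₀ - w₁) ^ 2 / 4) := by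
  have : deriv (fun z : ℂ => z ^ 2 - (w₀ - w₁) ^ 2 / 4) z = 2 * z := by simp
  simp only [SpectralCurve.oneForm, gkzCurve, this]

theorem eventually_sq_sub_ne_zero (Λ : ℂ) : ∀ᶠ w in 𝓝[≠] (0 : ℂ), w ^ 2 - Λ ≠ 0 := by
  rcases eq_or_ne Λ 0 with rfl | hΛ
  · filter_upwards [self_mem_nhdsWithin] with w hw
    rw [sub_zero]
    exact pow_ne_zero 2 hw
  · filter_upwards [eventually_ne_zero_and_sub_sq_ne_zero hΛ] with w hw
    exact sub_ne_zero.mpr (sub_ne_zero.mp hw.2).symm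

theorem kernel_gkzCurve_mul_deriv_conj (w₀ w₁ : ℂ) {z : ℂ} (hz : z ≠ 0) :
    ∀ᶠ w in 𝓝[≠] (0 : ℂ),
      (gkzCurve w₀ w₁).kernel 0 w z * deriv ((gkzCurve w₀ w₁).conj 0) w =
        gkzKernel ((w₀ - w₁) ^ 2 / 4) (z ^ 2) w := by
  have hnorm : ∀ᶠ w in 𝓝[≠] (0 : ℂ), ‖w‖ < ‖z‖ := by
    refine mem_nhdsWithin_of_mem_nhds (ContinuousAt.eventually_lt (by fun_prop) (by fun_prop) ?_)
    simpa using hz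
  filter_upwards [hnorm, eventually_sq_sub_ne_zero ((w₀ - w₁) ^ 2 / 4),
    eventually_ne_zero_and_sub_sq_ne_zero (pow_ne_zero 2 hz)] with w hwz hx ⟨hw, hzw⟩
  have hconj : (gkzCurve w₀ w₁).conj 0 = fun w => -w := rfl
  have hderiv : deriv (fun w : ℂ => -w) w = -1 := by simp
  rw [SpectralCurve.kernel, hconj, hderiv, segmentIntegral_neg_bergman hwz, oneForm_gkzCurve,
    oneForm_gkzCurve, gkzKernel, neg_sq]
  generalize (w₀ - w₁) ^ 2 / 4 = Λ at *
  generalize (w₀ + w₁) / 2 = c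
  have hdenom : (w + c) * (2 * w) / (w ^ 2 - Λ) - (-w + c) * (2 * -w) / (w ^ 2 - Λ) * -1 =
      4 * w ^ 2 / (w ^ 2 - Λ) := by
    field_simp
    ring
  rw [hdenom]
  field_simp

end GkzKernel

section StableCorrelators

variable {K : Type*} [Field K] [CharZero K]

/-- The derivative of order `n = M.card` at the origin of the free energy of genus `g`, which is the
coefficient of `ħ ^ (2g - 2 + n)` in the logarithm of the partition function. The truncated
subtraction only affects `2g + n < 2`, where the value is zero. -/
noncomputable def stableCorrelator (Λ : K) (g : ℕ) (M : Multiset (ℕ → K)) : K :=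
  derivsAtZero M (freeCoeff Λ (2 * g + M.card - 2))

theorem stableCorrelator_of_le {Λ : K} {g : ℕ} {M : Multiset (ℕ → K)} (h : 2 * g + M.card ≤ 2) :
    stableCorrelator Λ g M = 0 := by
  rw [stableCorrelator, Nat.sub_eq_zero_of_le h, freeCoeff_zero, map_zero]

theorem stableCorrelator_eq {Λ : K} {g m : ℕ} {M : Multiset (ℕ → K)} (h : 2 * g + M.card = m + 2) :
    stableCorrelator Λ g M = derivsAtZero M (freeCoeff Λ m) := by
  rw [stableCorrelator, h, Nat.add_sub_cancel]

theorem sum_stableCorrelator_mul_eq_sum_antidiagonal (Λ : K) {g m : ℕ} {M N : Multiset (ℕ → K)}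
    (hm : 2 * g + (M.card + N.card) = m + 4) :
    ∑ l : Fin (g + 1), stableCorrelator Λ (g - l) M * stableCorrelator Λ l N =
      ∑ p ∈ Finset.HasAntidiagonal.antidiagonal m,
        derivsAtZero M (freeCoeff Λ p.1) * derivsAtZero N (freeCoeff Λ p.2) := by
  have hlt : ∀ {g : ℕ} {M : Multiset (ℕ → K)}, stableCorrelator Λ g M ≠ 0 → 2 < 2 * g + M.card :=
    fun h => not_le.mp (mt stableCorrelator_of_le h)
  refine Finset.sum_bij_ne_zero
    (fun l _ _ => (2 * (g - (l : ℕ)) + M.card - 2, 2 * (l : ℕ) + N.card - 2)) ?_ ?_ ?_ ?_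
  · intro l _ hne
    have hM := hlt (left_ne_zero_of_mul hne)
    have hN := hlt (right_ne_zero_of_mul hne)
    have := l.isLt
    rw [Finset.HasAntidiagonal.mem_antidiagonal]
    lia
  · intro l _ hl l' _ hl' heq
    have hN := hlt (right_ne_zero_of_mul hl)
    have hN' := hlt (right_ne_zero_of_mul hl')
    rw [Prod.mk.injEq] at heq
    exact Fin.ext (by lia)
  · intro p hp hne
    obtain ⟨g₁, hg₁⟩ := exists_genus_of_derivsAtZero_freeCoeff_ne_zero (left_ne_zero_of_mul hne)
    obtain ⟨g₂, hg₂⟩ := exists_genus_of_derivsAtZero_freeCoeff_ne_zero (right_ne_zero_of_mul hne)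
    have hpm := Finset.HasAntidiagonal.mem_antidiagonal.mp hp
    have hp₁ : 2 * (g - g₂) + M.card = p.1 + 2 := by lia
    refine ⟨⟨g₂, by lia⟩, Finset.mem_univ _, ?_, ?_⟩
    · rwa [stableCorrelator_eq hp₁, stableCorrelator_eq hg₂]
    · exact Prod.ext (by lia) (by lia)
  · exact fun l _ _ => rfl

theorem ite_stableCorrelator_eq {Λ : K} {g n m : ℕ} {M : Multiset (ℕ → K)}
    (hm : 2 * g + n = m + 2) (hM : M.card = n + 2) :
    (if g = 0 then 0 else stableCorrelator Λ (g - 1) M) = derivsAtZero M (freeCoeff Λ m) := by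
  split_ifs with hg
  · by_contra hne
    obtain ⟨g', hg'⟩ := exists_genus_of_derivsAtZero_freeCoeff_ne_zero (Ne.symm hne)
    lia
  · exact stableCorrelator_eq (by lia)

theorem stableCorrelator_cons_insertionDirection (Λ u : K) {g n : ℕ} (h : 2 ≤ 2 * g + n)
    (d : Fin n → ℕ → K) :
    stableCorrelator Λ g (insertionDirection u ::ₘ Finset.univ.val.map d) =
      -1 / 4 * ((1 - Λ * u) *
        ((if g = 0 then 0 else stableCorrelator Λ (g - 1)
            (insertionDirection u ::ₘ insertionDirection u ::ₘ Finset.univ.val.map d)) +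
          ∑ l : Fin (g + 1), ∑ J : Finset (Fin n),
            stableCorrelator Λ (g - l) (insertionDirection u ::ₘ J.val.map d) *
              stableCorrelator Λ l (insertionDirection u ::ₘ Jᶜ.val.map d))) +
        -1 / 4 * ∑ j, stableCorrelator Λ g
          (recursionDirection Λ u (d j) ::ₘ (({j} : Finset (Fin n))ᶜ).val.map d) +
        -1 / 4 * if 2 * g + n = 2 then derivsAtZero (Finset.univ.val.map d) (recursionConst Λ u)
          else 0 := by
  obtain ⟨m, hm⟩ : ∃ m, 2 * g + n = m + 2 := ⟨2 * g + n - 2, by lia⟩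
  have hsplit : ∑ l : Fin (g + 1), ∑ J : Finset (Fin n),
      stableCorrelator Λ (g - l) (insertionDirection u ::ₘ J.val.map d) *
        stableCorrelator Λ l (insertionDirection u ::ₘ Jᶜ.val.map d) =
      ∑ p ∈ Finset.HasAntidiagonal.antidiagonal m, ∑ J : Finset (Fin n),
        derivsAtZero (insertionDirection u ::ₘ J.val.map d) (freeCoeff Λ p.1) *
          derivsAtZero (insertionDirection u ::ₘ (Finset.univ \ J).val.map d)
            (freeCoeff Λ p.2) := by
    rw [Finset.sum_comm, Finset.sum_comm (s := Finset.HasAntidiagonal.antidiagonal m)]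
    refine Finset.sum_congr rfl fun J _ => ?_
    rw [← Finset.compl_eq_univ_sdiff]
    have hJ := Finset.card_add_card_compl J
    rw [Fintype.card_fin] at hJ
    exact sum_stableCorrelator_mul_eq_sum_antidiagonal Λ
      (by simp only [Multiset.card_cons, Multiset.card_map, Finset.card_val]; lia)
  have hfield : ∀ j, stableCorrelator Λ g
      (recursionDirection Λ u (d j) ::ₘ (({j} : Finset (Fin n))ᶜ).val.map d) =
      derivsAtZero (recursionDirection Λ u (d j) ::ₘ (Finset.univ.erase j).val.map d)
        (freeCoeff Λ m) := fun j => by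
    have := j.isLt
    rw [Finset.compl_eq_univ_sdiff, Finset.sdiff_singleton_eq_erase]
    exact stableCorrelator_eq (by simp; lia)
  rw [stableCorrelator_eq (m := m + 1) (by simp; lia), derivsAtZero_cons_freeCoeff_succ,
    ite_stableCorrelator_eq hm (by simp), hsplit, Finset.powerset_univ,
    Finset.sum_congr rfl fun j _ => hfield j,
    if_congr (show 2 * g + n = 2 ↔ m = 0 by lia) rfl rfl]
  ring

end StableCorrelators

section TopologicalRecursion

/-- The correlators of the unstable types: `ω_2^{(0)} = B`, and zero otherwise. -/
noncomputable def unstableOmega : (g n : ℕ) → (Fin n → ℂ) → ℂ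
  | 0, 2, z => bergman (z 0) (z 1)
  | _, _, _ => 0

theorem unstableOmega_of_ne {g n : ℕ} (h : g ≠ 0 ∨ n ≠ 2) (z : Fin n → ℂ) :
    unstableOmega g n z = 0 := by
  unfold unstableOmega
  split
  · simp at h
  · rfl

theorem unstableOmega_cons {n : ℕ} (g : ℕ) (J : Finset (Fin n)) (x : ℂ) (y : Fin n → ℂ) :
    unstableOmega g (J.card + 1) (Fin.cons x fun i => y (J.orderEmbOfFin rfl i)) =
      ∑ j, if g = 0 ∧ J = {j} then bergman x (y j) else 0 := by
  by_cases h : g = 0 ∧ J.card = 1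
  · obtain ⟨rfl, hJ⟩ := h
    have hcons : ∀ (k : ℕ) (hk : k = 1) (f : Fin k → ℂ),
        unstableOmega 0 (k + 1) (Fin.cons x f) = bergman x (f ⟨0, by lia⟩) := by
      rintro k rfl f
      rfl
    rw [hcons _ hJ]
    obtain ⟨j, rfl⟩ := Finset.card_eq_one.mp hJ
    have hj := Finset.orderEmbOfFin_mem ({j} : Finset (Fin n)) rfl ⟨0, by lia⟩
    rw [Finset.mem_singleton.mp hj]
    simp only [true_and, Finset.singleton_inj, Finset.sum_ite_eq, Finset.mem_univ, if_true]
  · rw [unstableOmega_of_ne (by lia), Finset.sum_eq_zero]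
    rintro j -
    rw [if_neg]
    rintro ⟨rfl, rfl⟩
    exact h ⟨rfl, Finset.card_singleton j⟩

/-- The closed form of the correlators of the curve `gkzCurve`, see `omega_gkzCurve`. -/
noncomputable def gkzOmega (Λ : ℂ) (g n : ℕ) (z : Fin n → ℂ) : ℂ :=
  stableCorrelator Λ g (Finset.univ.val.map fun i => insertionDirection (z i ^ 2)⁻¹) +
    unstableOmega g n z

theorem gkzOmega_of_le (Λ : ℂ) {g n : ℕ} (h : 2 * g + n ≤ 1) (z : Fin n → ℂ) :
    gkzOmega Λ g n z = 0 := by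
  rw [gkzOmega, stableCorrelator_of_le (by simp; lia), unstableOmega_of_ne (by lia), add_zero]

theorem map_univ_orderEmbOfFin {α ι : Type*} [LinearOrder ι] (J : Finset ι) (d : ι → α) :
    (Finset.univ : Finset (Fin J.card)).val.map (fun i => d (J.orderEmbOfFin rfl i)) =
      J.val.map d := by
  conv_rhs => rw [← Finset.map_orderEmbOfFin_univ J rfl]
  rw [Finset.map_val, Multiset.map_map]
  rfl

theorem gkzOmega_cons_orderEmbOfFin (Λ : ℂ) {n : ℕ} (g : ℕ) (J : Finset (Fin n)) (x : ℂ)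
    (y : Fin n → ℂ) :
    gkzOmega Λ g (J.card + 1) (Fin.cons x fun i => y (J.orderEmbOfFin rfl i)) =
      stableCorrelator Λ g
          (insertionDirection (x ^ 2)⁻¹ ::ₘ J.val.map fun j => insertionDirection (y j ^ 2)⁻¹) +
        ∑ j, if g = 0 ∧ J = {j} then bergman x (y j) else 0 := by
  rw [gkzOmega, unstableOmega_cons, map_univ_val_succ, ← map_univ_orderEmbOfFin J]
  simp only [Fin.cons_zero, Fin.cons_succ]

theorem gkzOmega_cons_cons_neg (Λ : ℂ) {n : ℕ} (g : ℕ) (x : ℂ) (y : Fin n → ℂ) :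
    gkzOmega Λ g (n + 2) (Fin.cons x (Fin.cons (-x) y)) =
      stableCorrelator Λ g (insertionDirection (x ^ 2)⁻¹ ::ₘ insertionDirection (x ^ 2)⁻¹ ::ₘ
          Finset.univ.val.map fun j => insertionDirection (y j ^ 2)⁻¹) +
        unstableOmega g (n + 2) (Fin.cons x (Fin.cons (-x) y)) := by
  rw [gkzOmega, map_univ_val_succ, map_univ_val_succ]
  simp only [Fin.cons_zero, Fin.cons_succ, neg_sq]

theorem sum_sum_ite_singleton_mul {R : Type*} [CommSemiring R] {g n : ℕ}
    (F : Fin (g + 1) → Finset (Fin n) → R) (b : Fin n → R) :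
    ∑ l : Fin (g + 1), ∑ J : Finset (Fin n),
        (∑ j, if g - (l : ℕ) = 0 ∧ J = {j} then b j else 0) * F l J =
      ∑ j, b j * F (Fin.last g) {j} := by
  rw [Finset.sum_eq_single_of_mem (Fin.last g) (Finset.mem_univ _)]
  · simp only [Fin.val_last, Nat.sub_self, true_and, Finset.sum_mul, ite_mul, zero_mul]
    rw [Finset.sum_comm]
    simp only [Finset.sum_ite_eq', Finset.mem_univ, if_true]
  · intro l _ hl
    have hgl : g - (l : ℕ) ≠ 0 := fun h => hl (Fin.ext (by have := l.isLt; simp; lia))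
    simp only [hgl, false_and, if_false, Finset.sum_const_zero, zero_mul]

theorem sum_sum_mul_ite_compl_singleton {R : Type*} [CommSemiring R] {g n : ℕ}
    (F : Fin (g + 1) → Finset (Fin n) → R) (b : Fin n → R) :
    ∑ l : Fin (g + 1), ∑ J : Finset (Fin n),
        F l J * (∑ j, if (l : ℕ) = 0 ∧ Jᶜ = {j} then b j else 0) =
      ∑ j, F 0 {j}ᶜ * b j := by
  rw [Finset.sum_eq_single_of_mem 0 (Finset.mem_univ _)]
  · have hcompl : ∀ (J : Finset (Fin n)) (j : Fin n), Jᶜ = {j} ↔ {j}ᶜ = J := fun _ _ =>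
      compl_eq_comm
    simp only [Fin.val_zero, true_and, Finset.mul_sum, mul_ite, mul_zero, hcompl]
    rw [Finset.sum_comm]
    simp only [Finset.sum_ite_eq, Finset.mem_univ, if_true]
  · intro l _ hl
    have hl₀ : (l : ℕ) ≠ 0 := fun h => hl (Fin.ext h)
    simp only [hl₀, false_and, if_false, Finset.sum_const_zero, mul_zero]

theorem sum_sum_add_ite_singleton_mul_add_ite_compl_singleton {R : Type*} [CommSemiring R]
    {g n : ℕ} (A B : Fin (g + 1) → Finset (Fin n) → R) (a b : Fin n → R) :
    ∑ l : Fin (g + 1), ∑ J : Finset (Fin n),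
        (A l J + ∑ j, if g - (l : ℕ) = 0 ∧ J = {j} then a j else 0) *
          (B l J + ∑ j, if (l : ℕ) = 0 ∧ Jᶜ = {j} then b j else 0) =
      ∑ l, ∑ J, A l J * B l J + ∑ j, (a j * B (Fin.last g) {j} + A 0 {j}ᶜ * b j) +
        ∑ j, a j * ∑ i, if g = 0 ∧ ({j} : Finset (Fin n))ᶜ = {i} then b i else 0 := by
  have hleft := sum_sum_ite_singleton_mul B a
  have hright := sum_sum_mul_ite_compl_singleton A b
  have hboth := sum_sum_ite_singleton_mul (g := g)
    (fun l J => ∑ j, if (l : ℕ) = 0 ∧ Jᶜ = {j} then b j else 0) a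
  rw [Fin.val_last] at hboth
  rw [Finset.sum_add_distrib, ← hleft, ← hright, ← hboth]
  simp only [add_mul, mul_add, Finset.sum_add_distrib]
  ring

/-- The terms of the recursion for `ω_{n+1}^{(g)}` whose factors are all equal to `B`. -/
noncomputable def unstableSource (g : ℕ) {n : ℕ} (y : Fin n → ℂ) (w : ℂ) : ℂ :=
  (if g = 0 then 0 else unstableOmega (g - 1) (n + 2) (Fin.cons w (Fin.cons (-w) y))) +
    ∑ j, bergman w (y j) *
      ∑ i, if g = 0 ∧ ({j} : Finset (Fin n))ᶜ = {i} then bergman (-w) (y i) else 0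

theorem unstableSource_zero_two (y : Fin 2 → ℂ) (w : ℂ) : unstableSource 0 y w =
    bergman w (y 0) * bergman (-w) (y 1) + bergman w (y 1) * bergman (-w) (y 0) := by
  have h₀ : ({0} : Finset (Fin 2))ᶜ = {1} := by decide
  have h₁ : ({1} : Finset (Fin 2))ᶜ = {0} := by decide
  simp only [unstableSource, if_true, true_and, zero_add, Fin.sum_univ_two, h₀, h₁,
    Finset.singleton_inj, zero_ne_one, one_ne_zero, if_false, add_zero]

theorem unstableSource_one_zero (y : Fin 0 → ℂ) {w : ℂ} (hw : w ≠ 0) :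
    unstableSource 1 y w = (w ^ 2)⁻¹ / 4 := by
  have hbase : unstableOmega 0 2 (Fin.cons w (Fin.cons (-w) y)) = bergman w (-w) := rfl
  rw [unstableSource, if_neg one_ne_zero, Nat.sub_self, hbase, Fin.sum_univ_zero, bergman]
  field_simp
  ring

theorem unstableSource_of_ne {g n : ℕ} (h : 2 * g + n ≠ 2) (y : Fin n → ℂ) (w : ℂ) :
    unstableSource g y w = 0 := by
  have hcard : ∀ i j : Fin n, ({j} : Finset (Fin n))ᶜ = {i} → n = 2 := fun i j hij => by
    have hcompl := Finset.card_compl ({j} : Finset (Fin n))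
    rw [hij, Finset.card_singleton, Finset.card_singleton, Fintype.card_fin] at hcompl
    lia
  rw [unstableSource, Finset.sum_eq_zero, add_zero]
  · split_ifs with hg
    · rfl
    · exact unstableOmega_of_ne (by lia) _
  · intro j _
    rw [Finset.sum_eq_zero, mul_zero]
    rintro i -
    rw [if_neg]
    rintro ⟨rfl, hij⟩
    exact h (by rw [hcard i j hij])

theorem hasResidue_gkzKernel_mul_unstableSource (Λ : ℂ) {s : ℂ} (hs : s ≠ 0) (g : ℕ) {n : ℕ}
    {y : Fin n → ℂ} (hy : ∀ j, y j ≠ 0) :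
    HasResidue (fun w => gkzKernel Λ s w * unstableSource g y w) 0
      (-1 / 4 * if 2 * g + n = 2 then derivsAtZero
        (Finset.univ.val.map fun j => insertionDirection (y j ^ 2)⁻¹) (recursionConst Λ s⁻¹)
          else 0) := by
  by_cases h : 2 * g + n = 2
  · rw [if_pos h]
    obtain ⟨rfl, rfl⟩ | ⟨rfl, rfl⟩ : (g = 0 ∧ n = 2) ∨ (g = 1 ∧ n = 0) := by lia
    · have hB : ∀ j, AnalyticAt ℂ (fun w => bergman w (y j)) 0 := fun j =>
        analyticAt_bergman_left (hy j).symm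
      have hB' : ∀ j, AnalyticAt ℂ (fun w => bergman (-w) (y j)) 0 := fun j =>
        (show AnalyticAt ℂ (fun w => bergman w (y j)) (-0) by simpa using hB j).comp
          (g := fun w => bergman w (y j)) analyticAt_id.neg
      have hsource : AnalyticAt ℂ (unstableSource 0 y) 0 := by
        rw [show unstableSource 0 y = _ from funext (unstableSource_zero_two y)]
        exact ((hB 0).mul (hB' 1)).add ((hB 1).mul (hB' 0))
      convert hasResidue_gkzKernel_mul_of_analyticAt Λ hs hsource using 1
      have hpair : (Finset.univ : Finset (Fin 2)).val.map
          (fun j => insertionDirection (y j ^ 2)⁻¹) =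
            {insertionDirection (y 0 ^ 2)⁻¹, insertionDirection (y 1 ^ 2)⁻¹} := rfl
      rw [hpair, derivsAtZero_pair_recursionConst, unstableSource_zero_two, neg_zero]
      simp only [bergman, insertionDirection, zero_sub, neg_sq, zero_add, pow_one]
      ring
    · have hpoly := IsPolynomialVanishingAtZero.pow_mul_const 0 (1 / 4 : ℂ)
      convert (hpoly.hasResidue_gkzKernel_mul (Λ := Λ) hs).congr ?_ using 1
      · rw [Finset.univ_eq_empty, Finset.empty_val, Multiset.map_zero,
          derivsAtZero_zero_recursionConst]
        ring
      · filter_upwards [self_mem_nhdsWithin] with w hw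
        rw [unstableSource_one_zero y hw]
        ring
  · rw [if_neg h, mul_zero]
    simp only [unstableSource_of_ne h, mul_zero]
    exact hasResidue_zero_of_analyticAt analyticAt_const

theorem isPolynomialVanishingAtZero_stableCorrelator (Λ : ℂ) (g : ℕ) (M : Multiset (ℕ → ℂ)) :
    IsPolynomialVanishingAtZero fun u => stableCorrelator Λ g (insertionDirection u ::ₘ M) := by
  simp only [stableCorrelator, Multiset.card_cons, derivsAtZero_cons]
  exact isPolynomialVanishingAtZero_directionalDeriv _

theorem isPolynomialVanishingAtZero_stableCorrelator_cons_cons (Λ : ℂ) (g : ℕ)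
    (M : Multiset (ℕ → ℂ)) : IsPolynomialVanishingAtZero fun u =>
      stableCorrelator Λ g (insertionDirection u ::ₘ insertionDirection u ::ₘ M) := by
  simp only [stableCorrelator, Multiset.card_cons, derivsAtZero_cons, directionalDerivs_cons]
  exact isPolynomialVanishingAtZero_directionalDeriv_directionalDeriv _

theorem hasResidue_gkzKernel_mul_stableSource (Λ : ℂ) {s : ℂ} (hs : s ≠ 0) (g : ℕ) {n : ℕ}
    (d : Fin n → ℕ → ℂ) :
    HasResidue (fun w => gkzKernel Λ s w * ((if g = 0 then 0 else stableCorrelator Λ (g - 1)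
        (insertionDirection (w ^ 2)⁻¹ ::ₘ insertionDirection (w ^ 2)⁻¹ ::ₘ
          Finset.univ.val.map d)) +
      ∑ l : Fin (g + 1), ∑ J : Finset (Fin n),
        stableCorrelator Λ (g - l) (insertionDirection (w ^ 2)⁻¹ ::ₘ J.val.map d) *
          stableCorrelator Λ l (insertionDirection (w ^ 2)⁻¹ ::ₘ Jᶜ.val.map d))) 0
      (-1 / 4 * ((1 - Λ * s⁻¹) * ((if g = 0 then 0 else stableCorrelator Λ (g - 1)
          (insertionDirection s⁻¹ ::ₘ insertionDirection s⁻¹ ::ₘ Finset.univ.val.map d)) +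
        ∑ l : Fin (g + 1), ∑ J : Finset (Fin n),
          stableCorrelator Λ (g - l) (insertionDirection s⁻¹ ::ₘ J.val.map d) *
            stableCorrelator Λ l (insertionDirection s⁻¹ ::ₘ Jᶜ.val.map d)))) := by
  have hfirst : IsPolynomialVanishingAtZero fun u : ℂ => if g = 0 then 0 else
      stableCorrelator Λ (g - 1)
        (insertionDirection u ::ₘ insertionDirection u ::ₘ Finset.univ.val.map d) := by
    split_ifs
    · exact ⟨0, by simp, by simp⟩
    · exact isPolynomialVanishingAtZero_stableCorrelator_cons_cons _ _ _
  exact (hfirst.add (.sum _ fun l _ => .sum _ fun J _ =>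
    (isPolynomialVanishingAtZero_stableCorrelator _ _ _).mul
      (isPolynomialVanishingAtZero_stableCorrelator _ _ _))).hasResidue_gkzKernel_mul hs

theorem hasResidue_gkzKernel_mul_bergman_mul_stableCorrelator (Λ : ℂ) {s v : ℂ} (hs : s ≠ 0)
    (hv : v ≠ 0) (g : ℕ) (M : Multiset (ℕ → ℂ)) :
    HasResidue (fun w => gkzKernel Λ s w * ((bergman w v + bergman (-w) v) *
        stableCorrelator Λ g (insertionDirection (w ^ 2)⁻¹ ::ₘ M))) 0
      (-1 / 4 * stableCorrelator Λ g
        (recursionDirection Λ s⁻¹ (insertionDirection (v ^ 2)⁻¹) ::ₘ M)) := by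
  simp only [stableCorrelator, Multiset.card_cons, derivsAtZero_cons]
  exact hasResidue_gkzKernel_mul_bergman_mul_directionalDeriv Λ hs hv _

theorem gkzOmega_recursionTerm_eq (Λ : ℂ) (g : ℕ) {n : ℕ} (y : Fin n → ℂ)
    (d : Fin n → ℕ → ℂ) (hd : d = fun j => insertionDirection (y j ^ 2)⁻¹) (w : ℂ) :
    (if g = 0 then 0 else gkzOmega Λ (g - 1) (n + 2) (Fin.cons w (Fin.cons (-w) y))) +
        ∑ l : Fin (g + 1), ∑ J : Finset (Fin n),
          gkzOmega Λ (g - l) (J.card + 1) (Fin.cons w fun i => y (J.orderEmbOfFin rfl i)) *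
            gkzOmega Λ l (Jᶜ.card + 1) (Fin.cons (-w) fun i => y (Jᶜ.orderEmbOfFin rfl i)) =
      ((if g = 0 then 0 else stableCorrelator Λ (g - 1)
          (insertionDirection (w ^ 2)⁻¹ ::ₘ insertionDirection (w ^ 2)⁻¹ ::ₘ
            Finset.univ.val.map d)) +
        ∑ l : Fin (g + 1), ∑ J : Finset (Fin n),
          stableCorrelator Λ (g - l) (insertionDirection (w ^ 2)⁻¹ ::ₘ J.val.map d) *
            stableCorrelator Λ l (insertionDirection (w ^ 2)⁻¹ ::ₘ Jᶜ.val.map d)) +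
        ∑ j, (bergman w (y j) + bergman (-w) (y j)) * stableCorrelator Λ g
          (insertionDirection (w ^ 2)⁻¹ ::ₘ (({j} : Finset (Fin n))ᶜ).val.map d) +
        unstableSource g y w := by
  subst hd
  simp only [gkzOmega_cons_orderEmbOfFin, gkzOmega_cons_cons_neg, neg_sq]
  rw [sum_sum_add_ite_singleton_mul_add_ite_compl_singleton, unstableSource]
  simp only [Fin.val_last, Fin.val_zero, Nat.sub_zero, add_mul, mul_comm (stableCorrelator Λ g _)]
  split_ifs <;> ring

theorem hasResidue_gkzKernel_mul_gkzOmega (Λ : ℂ) {g n : ℕ} (h : 2 ≤ 2 * g + n)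
    {z : Fin (n + 1) → ℂ} (hz : ∀ i, z i ≠ 0) :
    HasResidue (fun w => gkzKernel Λ (z 0 ^ 2) w *
        ((if g = 0 then 0 else
            gkzOmega Λ (g - 1) (n + 2) (Fin.cons w (Fin.cons (-w) (Fin.tail z)))) +
          ∑ l : Fin (g + 1), ∑ J : Finset (Fin n),
            gkzOmega Λ (g - l) (J.card + 1)
                (Fin.cons w fun i => Fin.tail z (J.orderEmbOfFin rfl i)) *
              gkzOmega Λ l (Jᶜ.card + 1)
                (Fin.cons (-w) fun i => Fin.tail z (Jᶜ.orderEmbOfFin rfl i)))) 0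
      (gkzOmega Λ g (n + 1) z) := by
  have hs : z 0 ^ 2 ≠ 0 := pow_ne_zero 2 (hz 0)
  have hy : ∀ j, Fin.tail z j ≠ 0 := fun j => hz j.succ
  have hres := ((hasResidue_gkzKernel_mul_stableSource Λ hs g
    fun j => insertionDirection (Fin.tail z j ^ 2)⁻¹).add
      (.sum Finset.univ fun j _ => hasResidue_gkzKernel_mul_bergman_mul_stableCorrelator Λ hs
        (hy j) g ((({j} : Finset (Fin n))ᶜ).val.map
          fun j => insertionDirection (Fin.tail z j ^ 2)⁻¹))).add
    (hasResidue_gkzKernel_mul_unstableSource Λ hs g hy)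
  rw [← Finset.mul_sum, ← stableCorrelator_cons_insertionDirection Λ _ h] at hres
  rw [gkzOmega, map_univ_val_succ, unstableOmega_of_ne (by lia), add_zero]
  refine hres.congr (Eventually.of_forall fun w => ?_)
  rw [gkzOmega_recursionTerm_eq Λ g (Fin.tail z) _ rfl, ← Finset.mul_sum]
  ring

theorem omega_eq_zero_of_le (C : SpectralCurve) {g n : ℕ} (h : 2 * g + n ≤ 1) (z : Fin n → ℂ) :
    C.omega g n z = 0 := by
  obtain rfl : g = 0 := by lia
  obtain rfl | rfl : n = 0 ∨ n = 1 := by lia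
  · rw [SpectralCurve.omega]
  · exact C.omega_zero_one z

theorem omega_gkzCurve (w₀ w₁ : ℂ) {g n : ℕ} (hn : n ≠ 0) {z : Fin n → ℂ} (hz : ∀ i, z i ≠ 0) :
    (gkzCurve w₀ w₁).omega g n z = gkzOmega ((w₀ - w₁) ^ 2 / 4) g n z := by
  induction hN : 2 * g + n using Nat.strong_induction_on generalizing g n with
  | _ N ih =>
  obtain ⟨n, rfl⟩ := Nat.exists_eq_succ_of_ne_zero hn
  rcases Nat.lt_or_ge (2 * g + n) 2 with hunstable | hstable
  · obtain rfl : g = 0 := by lia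
    obtain rfl | rfl : n = 0 ∨ n = 1 := by lia
    · rw [SpectralCurve.omega_zero_one, gkzOmega_of_le _ (by simp)]
    · rw [SpectralCurve.omega_zero_two, gkzOmega, stableCorrelator_of_le (by simp), zero_add]
      rfl
  have hcons : ∀ {l : ℕ} {J : Finset (Fin n)} {x : ℂ}, x ≠ 0 → 2 * l + (J.card + 1) < N →
      (gkzCurve w₀ w₁).omega l (J.card + 1)
          (Fin.cons x fun i => Fin.tail z (J.orderEmbOfFin rfl i)) =
        gkzOmega ((w₀ - w₁) ^ 2 / 4) l (J.card + 1)
          (Fin.cons x fun i => Fin.tail z (J.orderEmbOfFin rfl i)) := fun hx hlt =>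
    ih _ hlt (by lia) (Fin.cases hx fun i => hz _) rfl
  have hram : (gkzCurve w₀ w₁).ram = {0} := rfl
  have hconj : ∀ w, (gkzCurve w₀ w₁).conj 0 w = -w := fun w => rfl
  rw [SpectralCurve.omega_recursion _ _ _ (by lia), hram, Finset.sum_singleton]
  refine ((hasResidue_gkzKernel_mul_gkzOmega _ hstable hz).congr ?_).residue_eq
  filter_upwards [kernel_gkzCurve_mul_deriv_conj w₀ w₁ (hz 0), self_mem_nhdsWithin]
    with w hkernel (hw : w ≠ 0)
  rw [hkernel]
  simp only [hconj]
  congr 2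
  · split_ifs with hg
    · rfl
    · exact (ih _ (by lia) (by lia) (Fin.cases hw (Fin.cases (neg_ne_zero.mpr hw) fun i => hz _))
        rfl).symm
  · refine Finset.sum_congr rfl fun l _ => Finset.sum_congr rfl fun J _ => ?_
    have hJ := Finset.card_add_card_compl J
    rw [Fintype.card_fin] at hJ
    have hl := l.isLt
    rcases Nat.lt_or_ge 1 (2 * (g - l) + (J.card + 1)) with hleft | hleft
    · rcases Nat.lt_or_ge 1 (2 * (l : ℕ) + (Jᶜ.card + 1)) with hright | hright
      · rw [hcons hw (by lia), hcons (neg_ne_zero.mpr hw) (by lia)]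
      · rw [omega_eq_zero_of_le _ hright, gkzOmega_of_le _ hright, mul_zero, mul_zero]
    · rw [omega_eq_zero_of_le _ hleft, gkzOmega_of_le _ hleft, zero_mul, zero_mul]

end TopologicalRecursion

section IntegratedCorrelators

/-- The integrals from `∞` to `z` of the one-forms `t ^ (-2 (k + 1)) dt`: integrating every variable
of a correlator from `∞` to `z` replaces its directions `insertionDirection (t ^ 2)⁻¹` by this
one. -/
noncomputable def integratedDirection (z : ℂ) (k : ℕ) : ℂ := -(z ^ (2 * k + 1))⁻¹ / (2 * k + 1)

theorem insertionDirection_ofReal_mul (z : ℂ) (k : ℕ) {t : ℝ} (ht : 1 < t) :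
    insertionDirection (((t : ℂ) * z) ^ 2)⁻¹ k =
      ((t ^ (-(2 * k + 2) : ℝ) : ℝ) : ℂ) * (z ^ (2 * k + 2))⁻¹ := by
  have hrpow : (t : ℝ) ^ (-(2 * k + 2) : ℝ) = (t ^ (2 * k + 2))⁻¹ := by
    rw [Real.rpow_neg (by linarith)]
    congr 1
    exact_mod_cast Real.rpow_natCast t (2 * k + 2)
  rw [hrpow, insertionDirection, inv_pow, ← pow_mul, mul_pow, mul_inv,
    show 2 * (k + 1) = 2 * k + 2 by ring]
  push_cast
  rfl

theorem neg_two_mul_add_two_lt (k : ℕ) : (-(2 * k + 2) : ℝ) < -1 := by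
  have : (0 : ℝ) ≤ k := k.cast_nonneg
  linarith

theorem integrableOn_insertionDirection (z : ℂ) (k : ℕ) :
    IntegrableOn (fun t : ℝ => insertionDirection (((t : ℂ) * z) ^ 2)⁻¹ k) (Ioi 1) :=
  IntegrableOn.congr_fun
    (((integrableOn_Ioi_rpow_of_lt (neg_two_mul_add_two_lt k) one_pos).ofReal (𝕜 := ℂ)).mul_const
      (z ^ (2 * k + 2))⁻¹)
    (fun _ ht => (insertionDirection_ofReal_mul z k ht).symm) measurableSet_Ioi

theorem integralFromInfinity_insertionDirection {z : ℂ} (hz : z ≠ 0) (k : ℕ) :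
    integralFromInfinity (fun t => insertionDirection (t ^ 2)⁻¹ k) z = integratedDirection z k := by
  rw [integralFromInfinity,
    setIntegral_congr_fun measurableSet_Ioi fun t ht => insertionDirection_ofReal_mul z k ht,
    integral_mul_const, integral_complex_ofReal,
    integral_Ioi_rpow_of_lt (neg_two_mul_add_two_lt k) one_pos, integratedDirection, Real.one_rpow]
  have hk : (2 * (k : ℂ) + 1) ≠ 0 := by exact_mod_cast (by positivity : (2 * k + 1 : ℕ) ≠ 0)
  push_cast
  rw [show (-(2 * (k : ℂ) + 2) + 1) = -(2 * k + 1) by ring]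
  field_simp
  ring

theorem setOf_forall_one_lt_eq_pi (n : ℕ) :
    {t : Fin n → ℝ | ∀ i, 1 < t i} = univ.pi fun _ => Ioi (1 : ℝ) := by
  ext t
  simp

theorem measurableSet_setOf_forall_one_lt (n : ℕ) :
    MeasurableSet {t : Fin n → ℝ | ∀ i, 1 < t i} := by
  rw [setOf_forall_one_lt_eq_pi]
  exact MeasurableSet.univ_pi fun _ => measurableSet_Ioi

theorem convergesFromInfinity_prod {n : ℕ} {f : Fin n → ℂ → ℂ} {z : Fin n → ℂ}
    (hf : ∀ i, IntegrableOn (fun t : ℝ => f i (t * z i)) (Ioi 1)) :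
    ConvergesFromInfinity (fun w => ∏ i, f i (w i)) z := by
  rw [ConvergesFromInfinity, setOf_forall_one_lt_eq_pi, IntegrableOn, volume_pi,
    Measure.restrict_pi_pi]
  exact Integrable.fintype_prod (f := fun i (t : ℝ) => f i (t * z i)) hf

theorem multiIntegralFromInfinity_prod {n : ℕ} (f : Fin n → ℂ → ℂ) (z : Fin n → ℂ) :
    multiIntegralFromInfinity (fun w => ∏ i, f i (w i)) z =
      ∏ i, integralFromInfinity (f i) (z i) := by
  rw [multiIntegralFromInfinity, setOf_forall_one_lt_eq_pi, volume_pi, Measure.restrict_pi_pi,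
    integral_fintype_prod_eq_prod fun i (t : ℝ) => f i (t * z i), ← Finset.prod_mul_distrib]
  rfl

theorem multiIntegralFromInfinity_sum_mul_const {n : ℕ} {ι : Type*} [Fintype ι]
    {f : ι → (Fin n → ℂ) → ℂ} (a : ι → ℂ) {z : Fin n → ℂ}
    (hf : ∀ k, ConvergesFromInfinity (f k) z) :
    multiIntegralFromInfinity (fun w => ∑ k, f k w * a k) z =
      ∑ k, multiIntegralFromInfinity (f k) z * a k := by
  simp only [multiIntegralFromInfinity]
  rw [integral_finsetSum _ fun k _ => (hf k).mul_const (a k), Finset.mul_sum]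
  exact Finset.sum_congr rfl fun k _ => by rw [integral_mul_const, mul_assoc]

theorem ofReal_mul_ne_zero_of_one_lt {n : ℕ} {z : Fin n → ℂ} (hz : ∀ i, z i ≠ 0) {t : Fin n → ℝ}
    (ht : ∀ i, 1 < t i) (i : Fin n) : (t i : ℂ) * z i ≠ 0 :=
  mul_ne_zero (Complex.ofReal_ne_zero.mpr (by linarith [ht i])) (hz i)

theorem convergesFromInfinity_prod_insertionDirection {n : ℕ} (z : Fin n → ℂ) (k : Fin n → ℕ) :
    ConvergesFromInfinity (fun w => ∏ i, insertionDirection (w i ^ 2)⁻¹ (k i)) z :=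
  convergesFromInfinity_prod (f := fun i w => insertionDirection (w ^ 2)⁻¹ (k i))
    fun i => integrableOn_insertionDirection (z i) (k i)

theorem convergesFromInfinity_derivsAtZero {n : ℕ} {f : (Fin n → ℂ) → ℂ} {φ : MvPolynomial ℕ ℂ}
    (hf : ∀ z, (∀ i, z i ≠ 0) →
      f z = derivsAtZero (Finset.univ.val.map fun i => insertionDirection (z i ^ 2)⁻¹) φ)
    {z : Fin n → ℂ} (hz : ∀ i, z i ≠ 0) : ConvergesFromInfinity f z := by
  obtain ⟨N, hN⟩ := exists_forall_ge_pderiv_eq_zero φ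
  obtain ⟨a, ha⟩ := exists_derivsAtZero_eq_sum n hN
  refine IntegrableOn.congr_fun (f := fun t : Fin n → ℝ => ∑ k : Fin n → Fin N,
    (∏ i, insertionDirection (((t i : ℂ) * z i) ^ 2)⁻¹ (k i)) * a k) ?_ (fun t ht => ?_)
    (measurableSet_setOf_forall_one_lt n)
  · exact integrable_finsetSum _ fun k _ => (convergesFromInfinity_prod_insertionDirection z
      fun i => k i).mul_const _
  · exact ((hf _ (ofReal_mul_ne_zero_of_one_lt hz ht)).trans (ha _)).symm

theorem multiIntegralFromInfinity_derivsAtZero {n : ℕ} {f : (Fin n → ℂ) → ℂ}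
    {φ : MvPolynomial ℕ ℂ}
    (hf : ∀ z, (∀ i, z i ≠ 0) →
      f z = derivsAtZero (Finset.univ.val.map fun i => insertionDirection (z i ^ 2)⁻¹) φ)
    {z : Fin n → ℂ} (hz : ∀ i, z i ≠ 0) :
    multiIntegralFromInfinity f z =
      derivsAtZero (Finset.univ.val.map fun i => integratedDirection (z i)) φ := by
  obtain ⟨N, hN⟩ := exists_forall_ge_pderiv_eq_zero φ
  obtain ⟨a, ha⟩ := exists_derivsAtZero_eq_sum n hN
  calc multiIntegralFromInfinity f z
      = multiIntegralFromInfinity (fun w => ∑ k : Fin n → Fin N,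
          (∏ i, insertionDirection (w i ^ 2)⁻¹ (k i)) * a k) z := by
        rw [multiIntegralFromInfinity, multiIntegralFromInfinity,
          setIntegral_congr_fun (measurableSet_setOf_forall_one_lt n) fun t ht =>
            (hf _ (ofReal_mul_ne_zero_of_one_lt hz ht)).trans (ha _)]
    _ = ∑ k, (∏ i, integratedDirection (z i) (k i)) * a k := by
        rw [multiIntegralFromInfinity_sum_mul_const a fun k =>
          convergesFromInfinity_prod_insertionDirection z fun i => k i]
        refine Finset.sum_congr rfl fun k _ => ?_
        rw [multiIntegralFromInfinity_prod fun i w => insertionDirection (w ^ 2)⁻¹ (k i)]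
        simp only [integralFromInfinity_insertionDirection (hz _)]
    _ = derivsAtZero (Finset.univ.val.map fun i => integratedDirection (z i)) φ := (ha _).symm

theorem omega_gkzCurve_of_stable (w₀ w₁ : ℂ) {g n : ℕ} (hn : n ≠ 0) (h : 2 < 2 * g + n)
    {z : Fin n → ℂ} (hz : ∀ i, z i ≠ 0) :
    (gkzCurve w₀ w₁).omega g n z =
      derivsAtZero (Finset.univ.val.map fun i => insertionDirection (z i ^ 2)⁻¹)
        (freeCoeff ((w₀ - w₁) ^ 2 / 4) (2 * g + n - 2)) := by
  rw [omega_gkzCurve w₀ w₁ hn hz, gkzOmega, unstableOmega_of_ne (by lia), add_zero,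
    stableCorrelator_eq (m := 2 * g + n - 2) (by simp; lia)]

theorem one_div_factorial_mul_freeEnergy_gkzCurve (w₀ w₁ : ℂ) (F₁ : ℂ → ℂ) (F₂ : ℂ → ℂ → ℂ)
    {g n : ℕ} (hn : n ≠ 0) (h : 2 < 2 * g + n) {z : ℂ} (hz : z ≠ 0) :
    1 / (n.factorial : ℂ) * (gkzCurve w₀ w₁).freeEnergy F₁ F₂ g n (fun _ => z) =
      (restrictToLine (integratedDirection z)
        (freeCoeff ((w₀ - w₁) ^ 2 / 4) (2 * g + n - 2))).coeff n := by
  have hF : (gkzCurve w₀ w₁).freeEnergy F₁ F₂ g n (fun _ => z) =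
      multiIntegralFromInfinity ((gkzCurve w₀ w₁).omega g n) fun _ => z := by
    unfold SpectralCurve.freeEnergy
    split
    · lia
    · lia
    · rfl
  have hrep : (Finset.univ : Finset (Fin n)).val.map (fun _ => integratedDirection z) =
      Multiset.replicate n (integratedDirection z) := by
    rw [Multiset.map_const', Finset.card_val, Finset.card_univ, Fintype.card_fin]
  rw [hF, multiIntegralFromInfinity_derivsAtZero
    (fun z hz => omega_gkzCurve_of_stable w₀ w₁ hn h hz) (fun _ => hz), hrep,
    derivsAtZero_replicate, ← mul_assoc, one_div,
    inv_mul_cancel₀ (Nat.cast_ne_zero.mpr n.factorial_ne_zero), one_mul]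

theorem wkbF_zero (C : SpectralCurve) (F₁ : ℂ → ℂ) (F₂ : ℂ → ℂ → ℂ) (z : ℂ) :
    C.wkbF F₁ F₂ 0 z = F₁ z := by
  have hindex : (Finset.range (0 + 1) ×ˢ Finset.Icc 1 (0 + 1)).filter
      (fun p : ℕ × ℕ => 2 * p.1 + p.2 = 0 + 1) = {(0, 1)} := by decide
  rw [SpectralCurve.wkbF, hindex, Finset.sum_singleton]
  simp [SpectralCurve.freeEnergy]

theorem wkbF_one (C : SpectralCurve) (F₁ : ℂ → ℂ) (F₂ : ℂ → ℂ → ℂ) (z : ℂ) :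
    C.wkbF F₁ F₂ 1 z = 1 / 2 * F₂ z z := by
  have hindex : (Finset.range (1 + 1) ×ˢ Finset.Icc 1 (1 + 1)).filter
      (fun p : ℕ × ℕ => 2 * p.1 + p.2 = 1 + 1) = {(0, 2)} := by decide
  rw [SpectralCurve.wkbF, hindex, Finset.sum_singleton]
  simp [SpectralCurve.freeEnergy]

theorem wkbF_add_two (w₀ w₁ : ℂ) (F₁ : ℂ → ℂ) (F₂ : ℂ → ℂ → ℂ) (m : ℕ) {z : ℂ} (hz : z ≠ 0) :
    (gkzCurve w₀ w₁).wkbF F₁ F₂ (m + 2) z =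
      eval (integratedDirection z) (freeCoeff ((w₀ - w₁) ^ 2 / 4) (m + 1)) := by
  rw [eval_freeCoeff_eq_sum, SpectralCurve.wkbF]
  refine Finset.sum_of_injOn (fun p => p.2) ?_ ?_ ?_ ?_
  · rintro ⟨g, n⟩ hp ⟨g', n'⟩ hp' (h : n = n')
    simp only [Finset.coe_filter, mem_ofPred_eq] at hp hp'
    ext <;> simp <;> lia
  · rintro ⟨g, n⟩ hp
    simp only [Finset.coe_filter, mem_ofPred_eq, Finset.mem_product, Finset.mem_range,
      Finset.mem_Icc] at hp
    simp only [Finset.coe_range, mem_Iio]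
    lia
  · intro k _ hk
    by_cases hk0 : k = 0
    · rw [hk0, coeff_zero_restrictToLine, constantCoeff_freeCoeff]
    · refine coeff_restrictToLine_freeCoeff_eq_zero _ fun g hg => hk ⟨(g, k), ?_, rfl⟩
      simp only [Finset.coe_filter, mem_ofPred_eq, Finset.mem_product, Finset.mem_range,
        Finset.mem_Icc]
      lia
  · rintro ⟨g, n⟩ hp
    simp only [Finset.mem_filter, Finset.mem_product, Finset.mem_range, Finset.mem_Icc] at hp
    rw [one_div_factorial_mul_freeEnergy_gkzCurve w₀ w₁ F₁ F₂ (by lia) (by lia) hz,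
      show 2 * g + n - 2 = m + 1 by lia]

end IntegratedCorrelators

section RegularizedBergman

theorem hatOmega₂_gkzCurve (w₀ w₁ : ℂ) {a b : ℂ} (h : a ^ 2 ≠ b ^ 2) :
    (gkzCurve w₀ w₁).hatOmega₂ a b = 1 / (a + b) ^ 2 := by
  have hderiv : ∀ z, deriv (gkzCurve w₀ w₁).x z = 2 * z := fun z => by
    have : (gkzCurve w₀ w₁).x = fun z => z ^ 2 - (w₀ - w₁) ^ 2 / 4 := rfl
    rw [this]
    simp
  have hsub : a - b ≠ 0 := fun h0 => h (by rw [sub_eq_zero.mp h0])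
  have hadd : a + b ≠ 0 := fun h0 => h (by rw [eq_neg_of_add_eq_zero_left h0, neg_sq])
  have hx : (gkzCurve w₀ w₁).x a - (gkzCurve w₀ w₁).x b = (a - b) * (a + b) := by
    simp only [gkzCurve]
    ring
  rw [SpectralCurve.hatOmega₂, hderiv, hderiv, hx, bergman]
  field_simp
  ring

theorem hatOmega₂_comm (C : SpectralCurve) (a b : ℂ) : C.hatOmega₂ a b = C.hatOmega₂ b a := by
  rw [SpectralCurve.hatOmega₂, SpectralCurve.hatOmega₂, bergman, bergman, ← neg_sq (a - b),
    ← neg_sq (C.x a - C.x b), neg_sub, neg_sub, mul_comm (deriv C.x a)]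

theorem re_div_self_pos {z : ℂ} (hz : z ≠ 0) : 0 < (z / z).re := by
  rw [div_self hz, Complex.one_re]
  exact one_pos

theorem ne_zero_of_re_div_pos {a z : ℂ} (h : 0 < (a / z).re) : a ≠ 0 := by
  rintro rfl
  simp at h

theorem eventually_re_div_pos {a z : ℂ} (h : 0 < (a / z).re) :
    ∀ᶠ p : ℂ × ℂ in 𝓝 (a, a), 0 < (p.1 / z).re ∧ 0 < (p.2 / z).re := by
  have h₁ : Continuous fun p : ℂ × ℂ => (p.1 / z).re := by fun_prop
  have h₂ : Continuous fun p : ℂ × ℂ => (p.2 / z).re := by fun_prop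
  exact (h₁.continuousAt.eventually (lt_mem_nhds h)).and (h₂.continuousAt.eventually
    (lt_mem_nhds h))

theorem mul_re_div_lt_norm_add_ofReal_mul {z a : ℂ} (b : ℂ) (ha : 0 < (a / z).re) (t : ℝ) :
    t * (‖z‖ * (b / z).re) < ‖a + t * b‖ := by
  have hz : 0 < ‖z‖ := norm_pos_iff.mpr fun h0 => by simp [h0] at ha
  have hre : (a / z + t * (b / z)).re ≤ ‖(a + t * b) / z‖ := by
    rw [show a / z + t * (b / z) = (a + t * b) / z by ring]
    exact Complex.re_le_norm _
  rw [Complex.add_re, Complex.re_ofReal_mul, norm_div, le_div_iff₀ hz] at hre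
  nlinarith [mul_pos ha hz]

theorem add_ofReal_mul_ne_zero {z a b : ℂ} (ha : 0 < (a / z).re) (hb : 0 < (b / z).re) {t : ℝ}
    (ht : 0 ≤ t) : a + t * b ≠ 0 :=
  norm_pos_iff.mp ((by positivity : 0 ≤ t * (‖z‖ * (b / z).re)).trans_lt
    (mul_re_div_lt_norm_add_ofReal_mul b ha t))

theorem integrableOn_one_div_add_ofReal_mul_sq {z a b : ℂ} (ha : 0 < (a / z).re)
    (hb : 0 < (b / z).re) : IntegrableOn (fun t : ℝ => 1 / (a + t * b) ^ 2) (Ioi 1) := by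
  have hz : 0 < ‖z‖ := norm_pos_iff.mpr fun h0 => by simp [h0] at ha
  refine Integrable.mono' (g := fun t : ℝ => t ^ (-2 : ℝ) * ((‖z‖ * (b / z).re) ^ 2)⁻¹)
    ((integrableOn_Ioi_rpow_of_lt (by norm_num) one_pos).mul_const _) ?_ ?_
  · refine ContinuousOn.aestronglyMeasurable (fun t ht => ContinuousAt.continuousWithinAt ?_)
      measurableSet_Ioi
    have hne : (a + t * b) ^ 2 ≠ 0 :=
      pow_ne_zero 2 (add_ofReal_mul_ne_zero ha hb (zero_le_one.trans (mem_Ioi.mp ht).le))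
    fun_prop (disch := exact hne)
  · filter_upwards [ae_restrict_mem measurableSet_Ioi] with t ht
    have ht0 : 0 < t := one_pos.trans ht
    rw [norm_div, norm_one, norm_pow, Real.rpow_neg ht0.le, Real.rpow_two, one_div, ← mul_inv,
      ← mul_pow]
    gcongr
    exact (mul_re_div_lt_norm_add_ofReal_mul b ha t).le

theorem ae_one_div_add_ofReal_mul_sq_eq_hatOmega₂ (w₀ w₁ : ℂ) {z a b : ℂ} (ha : 0 < (a / z).re)
    (hb : 0 < (b / z).re) :
    (fun t : ℝ => 1 / (a + t * b) ^ 2) =ᵐ[volume.restrict (Ioi 1)]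
      fun t : ℝ => (gkzCurve w₀ w₁).hatOmega₂ a (t * b) := by
  filter_upwards [ae_restrict_mem measurableSet_Ioi,
    ae_restrict_of_ae ((countable_singleton (a / b).re).ae_notMem volume)] with t ht hdiag
  rw [hatOmega₂_gkzCurve]
  intro hsq
  rcases sq_eq_sq_iff_eq_or_eq_neg.mp hsq with h | h
  · apply hdiag
    rw [h, mul_div_cancel_right₀ _ (ne_zero_of_re_div_pos hb)]
    simp
  · exact add_ofReal_mul_ne_zero ha hb (zero_le_one.trans (mem_Ioi.mp ht).le)
      (eq_neg_iff_add_eq_zero.mp h)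

theorem integrableOn_hatOmega₂ (w₀ w₁ : ℂ) {z a b : ℂ} (ha : 0 < (a / z).re)
    (hb : 0 < (b / z).re) :
    IntegrableOn (fun t : ℝ => (gkzCurve w₀ w₁).hatOmega₂ a (t * b)) (Ioi 1) :=
  (integrableOn_one_div_add_ofReal_mul_sq ha hb).congr
    (ae_one_div_add_ofReal_mul_sq_eq_hatOmega₂ w₀ w₁ ha hb)

theorem integral_one_div_add_ofReal_mul_sq {z a b : ℂ} (ha : 0 < (a / z).re)
    (hb : 0 < (b / z).re) :
    ∫ t in Ioi (1 : ℝ), 1 / (a + t * b) ^ 2 = (b * (a + b))⁻¹ := by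
  have hb0 := ne_zero_of_re_div_pos hb
  have hderiv : ∀ t ∈ Ici (1 : ℝ), HasDerivAt (fun t : ℝ => -(b * (a + t * b))⁻¹)
      (1 / (a + t * b) ^ 2) t := by
    intro t ht
    have hlin : HasDerivAt (fun t : ℝ => b * (a + (t : ℂ) * b)) (b * (1 * b)) t :=
      (((Complex.ofRealCLM.hasDerivAt (x := t)).mul_const b).const_add a).const_mul b
    have hne := add_ofReal_mul_ne_zero ha hb (zero_le_one.trans (mem_Ici.mp ht))
    refine (hlin.inv (mul_ne_zero hb0 hne)).neg.congr_deriv ?_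
    field_simp
  have hlim : Tendsto (fun t : ℝ => -(b * (a + t * b))⁻¹) atTop (𝓝 0) := by
    rw [← neg_zero]
    refine Tendsto.neg (tendsto_inv₀_cobounded.comp ?_)
    exact (tendsto_mul_left_cobounded hb0).comp ((tendsto_const_add_cobounded a).comp
      ((tendsto_mul_right_cobounded hb0).comp (RCLike.tendsto_ofReal_atTop_cobounded ℂ)))
  rw [integral_Ioi_of_hasDerivAt_of_tendsto' hderiv
    (integrableOn_one_div_add_ofReal_mul_sq ha hb) hlim]
  simp

theorem integralFromInfinity_hatOmega₂ (w₀ w₁ : ℂ) {z a b : ℂ} (ha : 0 < (a / z).re)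
    (hb : 0 < (b / z).re) :
    integralFromInfinity (fun t => (gkzCurve w₀ w₁).hatOmega₂ a t) b = -1 / (a + b) := by
  rw [integralFromInfinity,
    ← integral_congr_ae (ae_one_div_add_ofReal_mul_sq_eq_hatOmega₂ w₀ w₁ ha hb),
    integral_one_div_add_ofReal_mul_sq ha hb, mul_inv, ← mul_assoc, neg_mul,
    mul_inv_cancel₀ (ne_zero_of_re_div_pos hb), div_eq_mul_inv]

end RegularizedBergman

section ChainRule

variable {𝕜 : Type*} [NontriviallyNormedField 𝕜] {τ c : 𝕜 → ℕ → 𝕜} {τ' c' : ℕ → 𝕜} {z : 𝕜}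

theorem hasDerivAt_eval (hτ : ∀ k, HasDerivAt (fun z => τ z k) (τ' k) z) (φ : MvPolynomial ℕ 𝕜) :
    HasDerivAt (fun z => eval (τ z) φ) (eval (τ z) (directionalDeriv τ' φ)) z := by
  induction φ using MvPolynomial.induction_on with
  | C a =>
    simp only [eval_C, derivation_C, map_zero]
    exact hasDerivAt_const z a
  | add p q hp hq =>
    simp only [map_add]
    exact hp.add hq
  | mul_X p a hp =>
    simp only [map_mul, eval_X, Derivation.leibniz, map_add, smul_eq_mul, directionalDeriv_X,
      eval_C]
    refine (hp.mul (hτ a)).congr_deriv ?_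
    ring

theorem hasDerivAt_eval_directionalDeriv (hτ : ∀ k, HasDerivAt (fun z => τ z k) (τ' k) z)
    (hc : ∀ k, HasDerivAt (fun z => c z k) (c' k) z) (φ : MvPolynomial ℕ 𝕜) :
    HasDerivAt (fun z => eval (τ z) (directionalDeriv (c z) φ))
      (eval (τ z) (directionalDeriv τ' (directionalDeriv (c z) φ)) +
        eval (τ z) (directionalDeriv c' φ)) z := by
  obtain ⟨N, hN⟩ := exists_forall_ge_pderiv_eq_zero φ
  have hsum : ∀ d, directionalDeriv d φ =
      ∑ i ∈ Finset.range N, C (d i) * pderiv i φ := fun d => by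
    rw [derivation_apply_eq_sum_range _ hN]
    exact Finset.sum_congr rfl fun i _ => by rw [directionalDeriv_X, mul_comm]
  simp only [hsum c', hsum (c _), map_sum, map_mul, eval_C, derivation_C_mul,
    ← Finset.sum_add_distrib]
  refine (HasDerivAt.fun_sum fun i _ =>
    (hc i).mul (hasDerivAt_eval hτ (pderiv i φ))).congr_deriv ?_
  exact Finset.sum_congr rfl fun i _ => add_comm _ _

end ChainRule

section SpecializedPartition

theorem two_mul_natCast_add_one_ne_zero (k : ℕ) : (2 * (k : ℂ) + 1) ≠ 0 := by
  exact_mod_cast (by positivity : (2 * k + 1 : ℕ) ≠ 0)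

theorem insertionDirection_inv_sq (z : ℂ) (k : ℕ) :
    insertionDirection (z ^ 2)⁻¹ k = (z ^ (2 * k + 2))⁻¹ := by
  rw [insertionDirection, inv_pow, ← pow_mul, show 2 * (k + 1) = 2 * k + 2 by ring]

theorem hasDerivAt_integratedDirection {z : ℂ} (hz : z ≠ 0) (k : ℕ) :
    HasDerivAt (fun z => integratedDirection z k) (insertionDirection (z ^ 2)⁻¹ k) z := by
  have hk := two_mul_natCast_add_one_ne_zero k
  refine (((hasDerivAt_pow (2 * k + 1) z).inv (pow_ne_zero _ hz)).neg.div_const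
    (2 * (k : ℂ) + 1)).congr_deriv ?_
  rw [insertionDirection_inv_sq]
  push_cast
  field_simp
  ring

theorem hasDerivAt_insertionDirection_inv_sq {z : ℂ} (hz : z ≠ 0) (k : ℕ) :
    HasDerivAt (fun z => insertionDirection (z ^ 2)⁻¹ k)
      (-(2 * k + 2) * (z ^ (2 * k + 3))⁻¹) z := by
  simp only [insertionDirection_inv_sq]
  refine ((hasDerivAt_pow (2 * k + 2) z).inv (pow_ne_zero _ hz)).congr_deriv ?_
  push_cast
  field_simp
  ring

theorem eval_virasoroShift_zero {z : ℂ} (hz : z ≠ 0) (φ : MvPolynomial ℕ ℂ) :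
    eval (integratedDirection z) (virasoroShift ℂ 0 φ) =
      -2 * z⁻¹ *
        eval (integratedDirection z) (directionalDeriv (insertionDirection (z ^ 2)⁻¹) φ) := by
  obtain ⟨N, hN⟩ := exists_forall_ge_pderiv_eq_zero φ
  rw [derivation_apply_eq_sum_range _ hN, derivation_apply_eq_sum_range (directionalDeriv _) hN,
    map_sum, map_sum, Finset.mul_sum]
  refine Finset.sum_congr rfl fun a _ => ?_
  rw [map_mul, map_mul, virasoroShift_X_of_eq (zero_add (a + 1)).symm, directionalDeriv_X,
    map_mul, eval_C, eval_X, eval_C, integratedDirection, insertionDirection_inv_sq]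
  have ha := two_mul_natCast_add_one_ne_zero (a + 1)
  push_cast at ha ⊢
  field_simp
  ring

theorem eval_virasoroShiftSeries_X {z : ℂ} (hz : z ≠ 0) (a : ℕ) :
    eval (integratedDirection z) (virasoroShiftSeries (z ^ 2)⁻¹ (X a)) =
      -2 * (a + 2) * (z ^ (2 * a + 3))⁻¹ := by
  have hterm : ∀ k ∈ Finset.range (a + 2),
      eval (integratedDirection z)
          (C (2 * (2 * (k : ℂ) + 1) * (z ^ 2)⁻¹ ^ (a + 1 - k)) * X k) =
        -2 * (z ^ (2 * a + 3))⁻¹ := by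
    intro k hk
    obtain ⟨l, hl⟩ := Nat.exists_eq_add_of_le (Nat.lt_succ_iff.mp (Finset.mem_range.mp hk))
    have hk0 := two_mul_natCast_add_one_ne_zero k
    rw [map_mul, eval_C, eval_X, integratedDirection, hl, Nat.add_sub_cancel_left, inv_pow,
      ← pow_mul, show 2 * a + 3 = 2 * l + (2 * k + 1) by lia, pow_add]
    field_simp
    ring
  rw [virasoroShiftSeries_X, map_sum, Finset.sum_congr rfl hterm, Finset.sum_const,
    Finset.card_range, nsmul_eq_mul]
  push_cast
  ring

theorem eval_virasoroShiftSeries {z : ℂ} (hz : z ≠ 0) (φ : MvPolynomial ℕ ℂ) :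
    eval (integratedDirection z) (virasoroShiftSeries (z ^ 2)⁻¹ φ) =
      eval (integratedDirection z)
          (directionalDeriv (fun k => -(2 * k + 2) * (z ^ (2 * k + 3))⁻¹) φ) -
        2 * z⁻¹ *
          eval (integratedDirection z) (directionalDeriv (insertionDirection (z ^ 2)⁻¹) φ) := by
  obtain ⟨N, hN⟩ := exists_forall_ge_pderiv_eq_zero φ
  rw [derivation_apply_eq_sum_range _ hN, derivation_apply_eq_sum_range (directionalDeriv _) hN,
    derivation_apply_eq_sum_range (directionalDeriv _) hN, map_sum, map_sum, map_sum,
    Finset.mul_sum, ← Finset.sum_sub_distrib]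
  refine Finset.sum_congr rfl fun a _ => ?_
  rw [map_mul, map_mul, map_mul, eval_virasoroShiftSeries_X hz, directionalDeriv_X,
    directionalDeriv_X, eval_C, eval_C, insertionDirection_inv_sq]
  field_simp
  ring

/-- The coefficients in `ħ` of the partition function on the divisor `[z] - [∞]`, that is, at the
point `integratedDirection z`. -/
noncomputable def specializedPartition (Λ : ℂ) (n : ℕ) (z : ℂ) : ℂ :=
  eval (integratedDirection z) (partitionCoeff Λ n)

theorem specializedPartition_zero (Λ : ℂ) : specializedPartition Λ 0 = 1 := by
  funext z
  rw [specializedPartition, partitionCoeff, map_one, Pi.one_apply]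

theorem hasDerivAt_specializedPartition (Λ : ℂ) (n : ℕ) {z : ℂ} (hz : z ≠ 0) :
    HasDerivAt (specializedPartition Λ n) (eval (integratedDirection z)
      (directionalDeriv (insertionDirection (z ^ 2)⁻¹) (partitionCoeff Λ n))) z :=
  hasDerivAt_eval (hasDerivAt_integratedDirection hz) _

theorem hasDerivAt_deriv_specializedPartition (Λ : ℂ) (n : ℕ) {z : ℂ} (hz : z ≠ 0) :
    HasDerivAt (deriv (specializedPartition Λ n))
      (eval (integratedDirection z) (directionalDeriv (insertionDirection (z ^ 2)⁻¹)
          (directionalDeriv (insertionDirection (z ^ 2)⁻¹) (partitionCoeff Λ n))) +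
        eval (integratedDirection z)
          (directionalDeriv (fun k => -(2 * k + 2) * (z ^ (2 * k + 3))⁻¹) (partitionCoeff Λ n)))
      z :=
  (hasDerivAt_eval_directionalDeriv (hasDerivAt_integratedDirection hz)
    (hasDerivAt_insertionDirection_inv_sq hz) _).congr_of_eventuallyEq <| by
      filter_upwards [isOpen_ne.mem_nhds hz] with w hw
      exact (hasDerivAt_specializedPartition Λ n hw).deriv

theorem deriv_specializedPartition_succ (Λ : ℂ) (n : ℕ) {z : ℂ} (hz : z ≠ 0) :
    deriv (specializedPartition Λ (n + 1)) z =
      -1 / 4 * ((1 - Λ / z ^ 2) * (deriv (deriv (specializedPartition Λ n)) z -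
          2 / z * deriv (specializedPartition Λ n) z +
            5 / (4 * z ^ 2) * specializedPartition Λ n z) +
        2 / z * deriv (specializedPartition Λ n) z - specializedPartition Λ n z / z ^ 2) := by
  have hzero : integratedDirection z 0 = -z⁻¹ := by simp [integratedDirection]
  have hrec := congrArg (eval (integratedDirection z)) (directionalDeriv_insertionDirection
    (partitionCoeff_succ_spec Λ n).2 (z ^ 2)⁻¹)
  simp only [map_mul, map_add, map_sub, map_pow, eval_C, eval_X, eval_virasoroShift_zero hz,
    eval_virasoroShiftSeries hz, hzero] at hrec
  rw [(hasDerivAt_specializedPartition Λ _ hz).deriv, hrec,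
    (hasDerivAt_deriv_specializedPartition Λ n hz).deriv,
    (hasDerivAt_specializedPartition Λ n hz).deriv, specializedPartition]
  ring

end SpecializedPartition

section TwistedTheta

/-- The operator `x d/dx` in the coordinate `x = z ^ 2 - Λ`, conjugated by `z ^ (1 / 2)`. On the
curve `gkzCurve` this is the conjugation by `exp F₁`. -/
noncomputable def twistedTheta (Λ : ℂ) (f : ℂ → ℂ) (z : ℂ) : ℂ :=
  (z ^ 2 - Λ) * (-f z / (4 * z ^ 2) + deriv f z / (2 * z))

theorem twistedTheta_add (Λ : ℂ) {f g : ℂ → ℂ} {z : ℂ} (hf : DifferentiableAt ℂ f z)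
    (hg : DifferentiableAt ℂ g z) :
    twistedTheta Λ (f + g) z = twistedTheta Λ f z + twistedTheta Λ g z := by
  rw [twistedTheta, deriv_add hf hg, Pi.add_apply, twistedTheta, twistedTheta]
  ring

theorem sub_mul_twistedTheta_add (Λ δ : ℂ) {f : ℂ → ℂ} {z : ℂ} (hz : z ≠ 0)
    (hf : DifferentiableAt ℂ f z) :
    (z - δ) * twistedTheta Λ f z + twistedTheta Λ (fun z => (z + δ) * f z) z =
      (z ^ 2 - Λ) * deriv f z := by
  have hderiv : deriv (fun z => (z + δ) * f z) z = 1 * f z + (z + δ) * deriv f z :=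
    (((hasDerivAt_id z).add_const δ).mul hf.hasDerivAt).deriv
  rw [twistedTheta, twistedTheta, hderiv]
  field_simp
  ring

theorem hasDerivAt_twistedTheta (Λ : ℂ) {f : ℂ → ℂ} {z : ℂ} (hz : z ≠ 0)
    (hf : DifferentiableAt ℂ f z) (hf' : DifferentiableAt ℂ (deriv f) z) :
    HasDerivAt (twistedTheta Λ f)
      (2 * z * (-f z / (4 * z ^ 2) + deriv f z / (2 * z)) + (z ^ 2 - Λ) *
        (deriv (deriv f) z / (2 * z) - 3 * deriv f z / (4 * z ^ 2) + f z / (2 * z ^ 3))) z := by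
  have hsq : HasDerivAt (fun z : ℂ => z ^ 2 - Λ) (2 * z) z := by
    simpa using (hasDerivAt_pow 2 z).sub_const Λ
  have hden₄ : HasDerivAt (fun z : ℂ => 4 * z ^ 2) (4 * (2 * z)) z := by
    simpa using (hasDerivAt_pow 2 z).const_mul 4
  have hden₂ : HasDerivAt (fun z : ℂ => 2 * z) (2 * 1) z := (hasDerivAt_id z).const_mul 2
  refine (hsq.mul ((hf.hasDerivAt.fun_neg.fun_div hden₄ (by simp [hz])).fun_add
    (hf'.hasDerivAt.fun_div hden₂ (by simp [hz])))).congr_deriv ?_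
  field_simp
  ring

theorem twistedTheta_twistedTheta_specializedPartition (Λ : ℂ) (n : ℕ) {z : ℂ} (hz : z ≠ 0) :
    twistedTheta Λ (twistedTheta Λ (specializedPartition Λ n)) z =
      -((z ^ 2 - Λ) * deriv (specializedPartition Λ (n + 1)) z) := by
  rw [twistedTheta, (hasDerivAt_twistedTheta Λ hz
    (hasDerivAt_specializedPartition Λ n hz).differentiableAt
    (hasDerivAt_deriv_specializedPartition Λ n hz).differentiableAt).deriv, twistedTheta,
    deriv_specializedPartition_succ Λ n hz]
  field_simp
  ring

/-- The operator `ħ x d/dx - w` conjugated by `exp (F₀ / ħ + F₁)`, namely `(z + c) + ħ twistedTheta`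
with `c = (w₀ + w₁) / 2 - w`, acting on a power series in `ħ` whose coefficients are functions of
`z`. -/
noncomputable def twistedThetaSub (Λ c : ℂ) (G : ℕ → ℂ → ℂ) : ℕ → ℂ → ℂ
  | 0, z => (z + c) * G 0 z
  | k + 1, z => (z + c) * G (k + 1) z + twistedTheta Λ (G k) z

theorem differentiableAt_twistedThetaSub_specializedPartition (Λ c : ℂ) (k : ℕ) {z : ℂ}
    (hz : z ≠ 0) : DifferentiableAt ℂ (twistedThetaSub Λ c (specializedPartition Λ) k) z := by
  have hlin : ∀ n, DifferentiableAt ℂ (fun z => (z + c) * specializedPartition Λ n z) z := fun n =>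
    (differentiableAt_id.add_const c).mul (hasDerivAt_specializedPartition Λ n hz).differentiableAt
  cases k with
  | zero => exact hlin 0
  | succ k => exact (hlin (k + 1)).add (hasDerivAt_twistedTheta Λ hz
      (hasDerivAt_specializedPartition Λ k hz).differentiableAt
      (hasDerivAt_deriv_specializedPartition Λ k hz).differentiableAt).differentiableAt

theorem twistedThetaSub_neg_twistedThetaSub_specializedPartition (δ : ℂ) (k : ℕ) {z : ℂ}
    (hz : z ≠ 0) :
    twistedThetaSub (δ ^ 2) (-δ) (twistedThetaSub (δ ^ 2) δ (specializedPartition (δ ^ 2))) k z =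
      (z ^ 2 - δ ^ 2) * specializedPartition (δ ^ 2) k z := by
  have hdiff : ∀ n, DifferentiableAt ℂ (specializedPartition (δ ^ 2) n) z := fun n =>
    (hasDerivAt_specializedPartition _ n hz).differentiableAt
  have hlin := fun n => sub_mul_twistedTheta_add (δ ^ 2) δ hz (hdiff n)
  match k with
  | 0 => simp only [twistedThetaSub]; ring
  | 1 =>
    have hzero : deriv (specializedPartition (δ ^ 2) 0) z = 0 := by
      rw [specializedPartition_zero]
      exact deriv_const z 1
    have hfirst : twistedThetaSub (δ ^ 2) δ (specializedPartition (δ ^ 2)) 0 =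
        fun z => (z + δ) * specializedPartition (δ ^ 2) 0 z := rfl
    rw [twistedThetaSub, hfirst, twistedThetaSub]
    linear_combination hlin 0 + (z ^ 2 - δ ^ 2) * hzero
  | k + 2 =>
    have hsplit : twistedTheta (δ ^ 2)
        (twistedThetaSub (δ ^ 2) δ (specializedPartition (δ ^ 2)) (k + 1)) z =
          twistedTheta (δ ^ 2) (fun z => (z + δ) * specializedPartition (δ ^ 2) (k + 1) z) z +
            twistedTheta (δ ^ 2) (twistedTheta (δ ^ 2) (specializedPartition (δ ^ 2) k)) z :=
      twistedTheta_add _ ((differentiableAt_id.add_const δ).mul (hdiff (k + 1)))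
        (hasDerivAt_twistedTheta _ hz (hdiff k)
          (hasDerivAt_deriv_specializedPartition _ k hz).differentiableAt).differentiableAt
    rw [twistedThetaSub, hsplit, twistedThetaSub]
    linear_combination hlin (k + 1) + twistedTheta_twistedTheta_specializedPartition (δ ^ 2) k hz

end TwistedTheta

section DiagonalDerivative

theorem hasDerivAt_diagonal {𝕜 : Type*} [RCLike 𝕜] {f : 𝕜 → 𝕜 → 𝕜} {f₁ f₂ : 𝕜 × 𝕜 → 𝕜} {a : 𝕜}
    (h₁ : ∀ᶠ p in 𝓝 (a, a), HasDerivAt (f · p.2) (f₁ p) p.1)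
    (h₂ : ∀ᶠ p in 𝓝 (a, a), HasDerivAt (f p.1 ·) (f₂ p) p.2)
    (hf₁ : ContinuousAt f₁ (a, a)) (hf₂ : ContinuousAt f₂ (a, a)) :
    HasDerivAt (fun z => f z z) (f₁ (a, a) + f₂ (a, a)) a := by
  have hspan : Continuous (ContinuousLinearMap.toSpanSingleton 𝕜 : 𝕜 → 𝕜 →L[𝕜] 𝕜) :=
    (ContinuousLinearMap.toSpanSingletonCLE (𝕜 := 𝕜) (E := 𝕜)).continuous
  have hstrict := hasStrictFDerivAt_uncurry_coprod
    (f₁ := fun x y => ContinuousLinearMap.toSpanSingleton 𝕜 (f₁ (x, y)))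
    (f₂ := fun x y => ContinuousLinearMap.toSpanSingleton 𝕜 (f₂ (x, y)))
    (h₁.mono fun _ h => h.hasFDerivAt) (h₂.mono fun _ h => h.hasFDerivAt)
    (hspan.continuousAt.comp hf₁) (hspan.continuousAt.comp hf₂)
  refine (HasFDerivAt.comp_hasDerivAt (f := fun z => (z, z)) a hstrict.hasFDerivAt
    ((hasDerivAt_id a).prodMk (hasDerivAt_id a))).congr_deriv ?_
  simp [Function.HasUncurry.uncurry]

end DiagonalDerivative

section FormalWKB

variable {S : ℂ → ℂ} (w : ℂ) (ψ : WKBSeries S) (x : ℂ)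

theorem coeff_mulFun (a : ℂ → ℂ) (k : ℕ) :
    PowerSeries.coeff k ((WKBSeries.mulFun a ψ).amp x) = a x * PowerSeries.coeff k (ψ.amp x) :=
  PowerSeries.coeff_C_mul _ _ _

theorem coeff_zero_thetaSub :
    PowerSeries.coeff 0 ((WKBSeries.thetaSub w ψ).amp x) =
      (x * deriv S x - w) * PowerSeries.coeff 0 (ψ.amp x) := by
  change PowerSeries.coeff 0 (_ + _ - _) = _
  rw [mul_assoc PowerSeries.X, map_sub, map_add, PowerSeries.coeff_C_mul, coeff_mulFun,
    PowerSeries.coeff_zero_X_mul]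
  ring

theorem coeff_succ_thetaSub (k : ℕ) :
    PowerSeries.coeff (k + 1) ((WKBSeries.thetaSub w ψ).amp x) =
      (x * deriv S x - w) * PowerSeries.coeff (k + 1) (ψ.amp x) +
        x * deriv (fun t => PowerSeries.coeff k (ψ.amp t)) x := by
  change PowerSeries.coeff (k + 1) (_ + _ - _) = _
  rw [mul_assoc PowerSeries.X, map_sub, map_add, PowerSeries.coeff_C_mul, coeff_mulFun,
    PowerSeries.coeff_succ_X_mul, PowerSeries.coeff_C_mul, PowerSeries.coeff_mk]
  ring

end FormalWKB

section LocalBranch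

variable {w₀ w₁ : ℂ} {V : Set ℂ} {s : ℂ → ℂ} {F₁ : ℂ → ℂ} {F₂ : ℂ → ℂ → ℂ} {x : ℂ}

theorem branch_ne_zero (h : (gkzCurve w₀ w₁).IsLocalBranch V s F₁ F₂) (hx : x ∈ V) : s x ≠ 0 :=
  fun h0 => h.not_ram x hx (by rw [h0]; exact Finset.mem_singleton_self 0)

theorem branch_sq_sub (h : (gkzCurve w₀ w₁).IsLocalBranch V s F₁ F₂) (hx : x ∈ V) :
    s x ^ 2 - ((w₀ - w₁) / 2) ^ 2 = x := by
  rw [div_pow, show (2 : ℂ) ^ 2 = 4 by norm_num]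
  exact h.x_s x hx

theorem hasDerivAt_branch (h : (gkzCurve w₀ w₁).IsLocalBranch V s F₁ F₂) (hx : x ∈ V) :
    HasDerivAt s (2 * s x)⁻¹ x := by
  have hsq : HasDerivAt (fun z : ℂ => z ^ 2 - ((w₀ - w₁) / 2) ^ 2) (2 * s x) (s x) := by
    simpa using (hasDerivAt_pow 2 (s x)).sub_const (((w₀ - w₁) / 2) ^ 2)
  exact HasDerivAt.of_local_left_inverse (h.continuousOn.continuousAt (h.isOpen.mem_nhds hx)) hsq
    (mul_ne_zero two_ne_zero (branch_ne_zero h hx))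
    (mem_of_superset (h.isOpen.mem_nhds hx) fun y hy => branch_sq_sub h hy)

theorem hasDerivAt_phase (h : (gkzCurve w₀ w₁).IsLocalBranch V s F₁ F₂) (hx : x ∈ V) :
    HasDerivAt (fun x => (gkzCurve w₀ w₁).wkbF F₁ F₂ 0 (s x)) ((s x + (w₀ + w₁) / 2) / x) x := by
  have hz := branch_ne_zero h hx
  have hx0 := h.ne_zero x hx
  simp only [wkbF_zero]
  refine ((h.hasDerivAt_F₁ x hx).comp x (hasDerivAt_branch h hx)).congr_deriv ?_
  rw [oneForm_gkzCurve, show s x ^ 2 - (w₀ - w₁) ^ 2 / 4 = x from h.x_s x hx]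
  field_simp

theorem mul_deriv_phase (h : (gkzCurve w₀ w₁).IsLocalBranch V s F₁ F₂) (hx : x ∈ V) :
    x * deriv (fun x => (gkzCurve w₀ w₁).wkbF F₁ F₂ 0 (s x)) x = s x + (w₀ + w₁) / 2 := by
  rw [(hasDerivAt_phase h hx).deriv, mul_div_cancel₀ _ (h.ne_zero x hx)]

theorem hasDerivAt_diagonal_of_isLocalBranch (h : (gkzCurve w₀ w₁).IsLocalBranch V s F₁ F₂)
    (hx : x ∈ V) : HasDerivAt (fun z => F₂ z z) (-1 / s x) (s x) := by
  have hz := branch_ne_zero h hx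
  have hleft : ∀ᶠ p : ℂ × ℂ in 𝓝 (s x, s x), HasDerivAt (F₂ · p.2) (-1 / (p.1 + p.2)) p.1 := by
    filter_upwards [eventually_re_div_pos (re_div_self_pos hz), h.hasDerivAt_F₂_left x hx]
      with p hp hd
    rwa [integralFromInfinity_hatOmega₂ w₀ w₁ hp.1 hp.2] at hd
  have hright : ∀ᶠ p : ℂ × ℂ in 𝓝 (s x, s x), HasDerivAt (F₂ p.1 ·) (-1 / (p.1 + p.2)) p.2 := by
    filter_upwards [eventually_re_div_pos (re_div_self_pos hz), h.hasDerivAt_F₂_right x hx]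
      with p hp hd
    simp only [hatOmega₂_comm _ _ p.2] at hd
    rwa [integralFromInfinity_hatOmega₂ w₀ w₁ hp.2 hp.1, add_comm p.2] at hd
  have hne : s x + s x ≠ 0 := by
    rw [← two_mul]
    exact mul_ne_zero two_ne_zero hz
  have hcont : ContinuousAt (fun p : ℂ × ℂ => -1 / (p.1 + p.2)) (s x, s x) := by
    fun_prop (disch := exact hne)
  refine (hasDerivAt_diagonal hleft hright hcont hcont).congr_deriv ?_
  field_simp
  ring

/-- The factor `exp F₁` of the amplitude, where `F₁` is the WKB coefficient of index one. Up to a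
constant it is `z ^ (-1 / 2)`. -/
noncomputable def amplitudePrefactor (s : ℂ → ℂ) (F₂ : ℂ → ℂ → ℂ) (x : ℂ) : ℂ :=
  Complex.exp (1 / 2 * F₂ (s x) (s x))

theorem hasDerivAt_amplitudePrefactor (h : (gkzCurve w₀ w₁).IsLocalBranch V s F₁ F₂)
    (hx : x ∈ V) :
    HasDerivAt (amplitudePrefactor s F₂) (amplitudePrefactor s F₂ x * (-1 / (4 * s x ^ 2))) x := by
  have hz := branch_ne_zero h hx
  have hdiag := HasDerivAt.comp x (h₂ := fun z => F₂ z z)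
    (hasDerivAt_diagonal_of_isLocalBranch h hx) (hasDerivAt_branch h hx)
  refine (hdiag.const_mul (1 / 2)).cexp.congr_deriv ?_
  rw [amplitudePrefactor, Function.comp_apply]
  field_simp
  ring

theorem hasDerivAt_amplitudePrefactor_mul (h : (gkzCurve w₀ w₁).IsLocalBranch V s F₁ F₂)
    (hx : x ∈ V) {f : ℂ → ℂ} (hf : DifferentiableAt ℂ f (s x)) :
    HasDerivAt (fun x => amplitudePrefactor s F₂ x * f (s x))
      (amplitudePrefactor s F₂ x * (-f (s x) / (4 * s x ^ 2) + deriv f (s x) / (2 * s x))) x := by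
  refine ((hasDerivAt_amplitudePrefactor h hx).mul
    (hf.hasDerivAt.comp x (hasDerivAt_branch h hx))).congr_deriv ?_
  rw [Function.comp_apply]
  ring

theorem mul_deriv_amplitudePrefactor_mul (h : (gkzCurve w₀ w₁).IsLocalBranch V s F₁ F₂)
    (hx : x ∈ V) {f g : ℂ → ℂ} (hf : DifferentiableAt ℂ f (s x))
    (hg : ∀ t ∈ V, g t = amplitudePrefactor s F₂ t * f (s t)) :
    x * deriv g x = amplitudePrefactor s F₂ x * twistedTheta (((w₀ - w₁) / 2) ^ 2) f (s x) := by
  rw [((hasDerivAt_amplitudePrefactor_mul h hx hf).congr_of_eventuallyEq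
    (mem_of_superset (h.isOpen.mem_nhds hx) hg)).deriv, twistedTheta, branch_sq_sub h hx]
  ring

theorem coeff_amp_waveFunction (h : (gkzCurve w₀ w₁).IsLocalBranch V s F₁ F₂) (hx : x ∈ V)
    (k : ℕ) : PowerSeries.coeff k (((gkzCurve w₀ w₁).waveFunction s F₁ F₂).amp x) =
      amplitudePrefactor s F₂ x * specializedPartition (((w₀ - w₁) / 2) ^ 2) k (s x) := by
  have hlog : (PowerSeries.mk fun k => if k = 0 then 0 else
        (gkzCurve w₀ w₁).wkbF F₁ F₂ (k + 1) (s x)) =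
      PowerSeries.map (eval (integratedDirection (s x)))
        (PowerSeries.logOf (partitionSeries ((w₀ - w₁) ^ 2 / 4))) := by
    ext k
    rw [PowerSeries.coeff_mk, PowerSeries.coeff_map, ← freeCoeff]
    cases k with
    | zero => rw [if_pos rfl, freeCoeff_zero, map_zero]
    | succ k => rw [if_neg k.succ_ne_zero, wkbF_add_two w₀ w₁ F₁ F₂ k (branch_ne_zero h hx)]
  simp only [SpectralCurve.waveFunction]
  rw [hlog, exp_subst_map_logOf_partitionSeries, PowerSeries.coeff_C_mul, PowerSeries.coeff_map,
    partitionSeries, PowerSeries.coeff_mk, wkbF_one, div_pow, show (2 : ℂ) ^ 2 = 4 by norm_num]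
  rfl

theorem holomorphicOn_waveFunction (h : (gkzCurve w₀ w₁).IsLocalBranch V s F₁ F₂) :
    ((gkzCurve w₀ w₁).waveFunction s F₁ F₂).HolomorphicOn V := by
  refine ⟨fun x hx => (hasDerivAt_phase h hx).differentiableAt.differentiableWithinAt,
    fun k => DifferentiableOn.congr (fun x hx => ?_) fun x hx => coeff_amp_waveFunction h hx k⟩
  exact (hasDerivAt_amplitudePrefactor_mul h hx (hasDerivAt_specializedPartition _ k
    (branch_ne_zero h hx)).differentiableAt).differentiableAt.differentiableWithinAt

theorem coeff_amp_thetaSub (h : (gkzCurve w₀ w₁).IsLocalBranch V s F₁ F₂) (w : ℂ)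
    {ψ : WKBSeries fun x => (gkzCurve w₀ w₁).wkbF F₁ F₂ 0 (s x)} {G : ℕ → ℂ → ℂ}
    (hψ : ∀ k, ∀ x ∈ V, PowerSeries.coeff k (ψ.amp x) = amplitudePrefactor s F₂ x * G k (s x))
    (hG : ∀ k, ∀ x ∈ V, DifferentiableAt ℂ (G k) (s x)) (k : ℕ) (hx : x ∈ V) :
    PowerSeries.coeff k ((WKBSeries.thetaSub w ψ).amp x) = amplitudePrefactor s F₂ x *
      twistedThetaSub (((w₀ - w₁) / 2) ^ 2) ((w₀ + w₁) / 2 - w) G k (s x) := by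
  cases k with
  | zero =>
    rw [coeff_zero_thetaSub, mul_deriv_phase h hx, hψ 0 x hx, twistedThetaSub]
    ring
  | succ k =>
    rw [coeff_succ_thetaSub, mul_deriv_phase h hx, hψ (k + 1) x hx,
      mul_deriv_amplitudePrefactor_mul h hx (hG k x hx) (hψ k), twistedThetaSub]
    ring

theorem gkz_waveFunction (h : (gkzCurve w₀ w₁).IsLocalBranch V s F₁ F₂) (hx : x ∈ V) :
    (WKBSeries.thetaSub w₀ (WKBSeries.thetaSub w₁
        ((gkzCurve w₀ w₁).waveFunction s F₁ F₂))).amp x =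
      (WKBSeries.mulFun (fun x => x) ((gkzCurve w₀ w₁).waveFunction s F₁ F₂)).amp x := by
  have hinner := fun k t (ht : t ∈ V) => coeff_amp_thetaSub h w₁
    (fun k t ht => coeff_amp_waveFunction h ht k)
    (fun k t ht => (hasDerivAt_specializedPartition _ k (branch_ne_zero h ht)).differentiableAt)
    k ht
  ext k
  rw [coeff_amp_thetaSub h w₀ hinner (fun k t ht =>
      differentiableAt_twistedThetaSub_specializedPartition _ _ k (branch_ne_zero h ht)) k hx,
    show (w₀ + w₁) / 2 - w₁ = (w₀ - w₁) / 2 by ring,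
    show (w₀ + w₁) / 2 - w₀ = -((w₀ - w₁) / 2) by ring,
    twistedThetaSub_neg_twistedThetaSub_specializedPartition _ k (branch_ne_zero h hx),
    branch_sq_sub h hx, coeff_mulFun, coeff_amp_waveFunction h hx]
  ring

end LocalBranch

section Existence

/-- The holomorphic branch of the square root that takes the value `z` at `z ^ 2`. It is cut along
the ray from `0` through `-z ^ 2`. -/
noncomputable def sqrtNear (z u : ℂ) : ℂ :=
  z * (u / z ^ 2) ^ (1 / 2 : ℂ)

theorem sqrtNear_sq_self {z : ℂ} (hz : z ≠ 0) : sqrtNear z (z ^ 2) = z := by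
  rw [sqrtNear, div_self (pow_ne_zero 2 hz), Complex.one_cpow, mul_one]

theorem sq_sqrtNear {z : ℂ} (hz : z ≠ 0) (u : ℂ) : sqrtNear z u ^ 2 = u := by
  have hroot : ((u / z ^ 2) ^ (1 / 2 : ℂ)) ^ 2 = u / z ^ 2 := by
    rw [← Complex.cpow_nat_mul]
    simp
  rw [sqrtNear, mul_pow, hroot, mul_div_cancel₀ _ (pow_ne_zero 2 hz)]

theorem continuousOn_sqrtNear (z : ℂ) :
    ContinuousOn (sqrtNear z) {u | u / z ^ 2 ∈ Complex.slitPlane} :=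
  continuousOn_const.mul (ContinuousOn.cpow_const (by fun_prop) fun _ hu => hu)

theorem hasDerivAt_neg_log_add_div {z a b : ℂ} (ha : 0 < (a / z).re) (hb : 0 < (b / z).re) :
    HasDerivAt (fun u => -Complex.log ((u + b) / z)) (-1 / (a + b)) a := by
  have hmem : (a + b) / z ∈ Complex.slitPlane := by
    left
    rw [add_div, Complex.add_re]
    exact add_pos ha hb
  have hz : z ≠ 0 := fun h0 => by simp [h0] at ha
  refine (((hasDerivAt_id a).add_const b).div_const z).clog hmem |>.neg.congr_deriv ?_
  rw [id, div_div_div_cancel_right₀ hz, neg_div]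

theorem isLocalBranch_neg_log {w₀ w₁ z : ℂ} {V : Set ℂ} {s F₁ : ℂ → ℂ} (hV : IsOpen V)
    (hs : ContinuousOn s V) (hx0 : ∀ x ∈ V, x ≠ 0) (hxs : ∀ x ∈ V, (gkzCurve w₀ w₁).x (s x) = x)
    (hre : ∀ x ∈ V, 0 < (s x / z).re)
    (hF₁ : ∀ x ∈ V, HasDerivAt F₁ ((gkzCurve w₀ w₁).oneForm (s x)) (s x)) :
    (gkzCurve w₀ w₁).IsLocalBranch V s F₁ fun u v => -Complex.log ((u + v) / z) where
  isOpen := hV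
  ne_zero := hx0
  continuousOn := hs
  x_s := hxs
  not_ram x hx h0 := ne_zero_of_re_div_pos (hre x hx) (Finset.mem_singleton.mp h0)
  hasDerivAt_F₁ := hF₁
  hasDerivAt_F₂_left x hx := by
    filter_upwards [eventually_re_div_pos (hre x hx)] with p hp
    rw [integralFromInfinity_hatOmega₂ w₀ w₁ hp.1 hp.2]
    exact hasDerivAt_neg_log_add_div hp.1 hp.2
  hasDerivAt_F₂_right x hx := by
    filter_upwards [eventually_re_div_pos (hre x hx)] with p hp
    simp only [hatOmega₂_comm _ _ p.2, add_comm p.1]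
    rw [integralFromInfinity_hatOmega₂ w₀ w₁ hp.2 hp.1]
    exact hasDerivAt_neg_log_add_div hp.2 hp.1

theorem exists_ball_forall_hasDerivAt_oneForm (w₀ w₁ : ℂ) {z : ℂ}
    (hx : (gkzCurve w₀ w₁).x z ≠ 0) :
    ∃ r > 0, ∃ F₁ : ℂ → ℂ, ∀ p ∈ Metric.ball z r, (gkzCurve w₀ w₁).x p ≠ 0 ∧
      HasDerivAt F₁ ((gkzCurve w₀ w₁).oneForm p) p := by
  obtain ⟨r, hr, hball⟩ := Metric.isOpen_iff.mp
    (isOpen_ne_fun (gkzCurve w₀ w₁).x_differentiable.continuous continuous_const) z hx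
  have hform : DifferentiableOn ℂ (gkzCurve w₀ w₁).oneForm (Metric.ball z r) := by
    rw [funext (oneForm_gkzCurve w₀ w₁)]
    exact DifferentiableOn.div (by fun_prop) (by fun_prop) fun p hp => hball hp
  obtain ⟨F₁, hF₁⟩ := hform.isExactOn_ball
  exact ⟨r, hr, F₁, fun p hp => ⟨hball hp, hF₁ p hp⟩⟩

theorem exists_isLocalBranch (w₀ w₁ : ℂ) {z : ℂ} (hx : (gkzCurve w₀ w₁).x z ≠ 0) (hz : z ≠ 0) :
    ∃ (V : Set ℂ) (s : ℂ → ℂ) (F₁ : ℂ → ℂ) (F₂ : ℂ → ℂ → ℂ),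
      (gkzCurve w₀ w₁).IsLocalBranch V s F₁ F₂ ∧ (gkzCurve w₀ w₁).x z ∈ V ∧
        s ((gkzCurve w₀ w₁).x z) = z := by
  obtain ⟨r, hr, F₁, hF₁⟩ := exists_ball_forall_hasDerivAt_oneForm w₀ w₁ hx
  let s : ℂ → ℂ := fun x => sqrtNear z (x + (w₀ - w₁) ^ 2 / 4)
  let D : Set ℂ := {x | (x + (w₀ - w₁) ^ 2 / 4) / z ^ 2 ∈ Complex.slitPlane}
  let U : Set ℂ := Metric.ball z r ∩ {p | 0 < (p / z).re}
  have hshift : (gkzCurve w₀ w₁).x z + (w₀ - w₁) ^ 2 / 4 = z ^ 2 := sub_add_cancel _ _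
  have hs : ContinuousOn s D := (continuousOn_sqrtNear z).comp (by fun_prop) fun x hx => hx
  have hD : IsOpen D := Complex.isOpen_slitPlane.preimage (by fun_prop)
  have hU : IsOpen U := Metric.isOpen_ball.inter (isOpen_lt continuous_const (by fun_prop))
  have hxs : ∀ x, (gkzCurve w₀ w₁).x (s x) = x := fun x => by
    simp only [gkzCurve, s, sq_sqrtNear hz, add_sub_cancel_right]
  have hsz : s ((gkzCurve w₀ w₁).x z) = z := by
    simp only [s, hshift, sqrtNear_sq_self hz]
  refine ⟨D ∩ s ⁻¹' U, s, F₁, _, isLocalBranch_neg_log (hs.isOpen_inter_preimage hD hU)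
    (hs.mono inter_subset_left) (fun x hx => ?_) (fun x _ => hxs x) (fun x hx => hx.2.2)
    fun x hx => (hF₁ _ hx.2.1).2, ⟨?_, ?_⟩, hsz⟩
  · rw [← hxs x]
    exact (hF₁ _ hx.2.1).1
  · simp only [D, mem_ofPred_eq, hshift, div_self (pow_ne_zero 2 hz), Complex.one_mem_slitPlane]
  · rw [mem_preimage, hsz]
    exact ⟨Metric.mem_ball_self hr, re_div_self_pos hz⟩

end Existence

end TopRec

theorem mainTheorem9 (w₀ w₁ : ℂ) :
    -- the integrals from `∞` which enter the wave function converge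
    (∀ (g n : ℕ), 1 ≤ n → 2 < 2 * g + n → ∀ z : Fin n → ℂ, (∀ i, z i ≠ 0) →
      TopRec.ConvergesFromInfinity ((TopRec.gkzCurve w₀ w₁).omega g n) z) ∧
    (∀ z : ℂ, z ≠ 0 → ∀ᶠ p : ℂ × ℂ in nhds (z, z),
      MeasureTheory.IntegrableOn
          (fun t : ℝ => (TopRec.gkzCurve w₀ w₁).hatOmega₂ p.1 (t * p.2)) (Set.Ioi 1) ∧
        MeasureTheory.IntegrableOn
          (fun t : ℝ => (TopRec.gkzCurve w₀ w₁).hatOmega₂ (t * p.1) p.2) (Set.Ioi 1)) ∧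
    -- the wave function exists near every unramified point over `ℂ*`
    (∀ z : ℂ, (TopRec.gkzCurve w₀ w₁).x z ≠ 0 → z ∉ (TopRec.gkzCurve w₀ w₁).ram →
      ∃ (V : Set ℂ) (s : ℂ → ℂ) (F₁ : ℂ → ℂ) (F₂ : ℂ → ℂ → ℂ),
        (TopRec.gkzCurve w₀ w₁).IsLocalBranch V s F₁ F₂ ∧
          (TopRec.gkzCurve w₀ w₁).x z ∈ V ∧ s ((TopRec.gkzCurve w₀ w₁).x z) = z) ∧
    -- every local branch of it is holomorphic and satisfies the GKZ equation
    (∀ (V : Set ℂ) (s : ℂ → ℂ) (F₁ : ℂ → ℂ) (F₂ : ℂ → ℂ → ℂ),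
      (TopRec.gkzCurve w₀ w₁).IsLocalBranch V s F₁ F₂ →
        ((TopRec.gkzCurve w₀ w₁).waveFunction s F₁ F₂).HolomorphicOn V ∧
        ∀ x ∈ V,
          (TopRec.WKBSeries.thetaSub w₀ (TopRec.WKBSeries.thetaSub w₁
              ((TopRec.gkzCurve w₀ w₁).waveFunction s F₁ F₂))).amp x =
            (TopRec.WKBSeries.mulFun (fun x => x)
              ((TopRec.gkzCurve w₀ w₁).waveFunction s F₁ F₂)).amp x) := by
  refine ⟨fun g n hn h z hz => ?_, fun z hz => ?_, fun z hx hz => ?_, fun V s F₁ F₂ h =>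
    ⟨TopRec.holomorphicOn_waveFunction h, fun x hx => TopRec.gkz_waveFunction h hx⟩⟩
  · exact TopRec.convergesFromInfinity_derivsAtZero
      (fun z hz => TopRec.omega_gkzCurve_of_stable w₀ w₁ (by lia) h hz) hz
  · filter_upwards [TopRec.eventually_re_div_pos (TopRec.re_div_self_pos hz)] with p hp
    refine ⟨TopRec.integrableOn_hatOmega₂ w₀ w₁ hp.1 hp.2, ?_⟩
    simp only [TopRec.hatOmega₂_comm _ _ p.2]
    exact TopRec.integrableOn_hatOmega₂ w₀ w₁ hp.2 hp.1
  · exact TopRec.exists_isLocalBranch w₀ w₁ hx fun h0 => hz (by rw [h0]; simp [TopRec.gkzCurve])
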